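/- Let $F$ be a field of characteristic zero with algebraic closure $\overline F$, and let $p\ge q>0$ be even integers. For $n\ge 1$ let $J'_n$ be the $n\times n$ matrix with entries $(J'_n)_{i,n+1-i}=(-1)^{i-1}$ and zeros elsewhere, let $\epsilon_n$ be the $n\times n$ matrix with ones on the superdiagonal and zeros elsewhere, and put $$J'_{p,q}=\begin{pmatrix}J'_p&\\&J'_q\end{pmatrix},\qquad I_{p,q}=\begin{pmatrix}1_p&\\&-1_q\end{pmatrix}.$$ Let $G=\mathrm{Sp}(J'_{p,q})=\{g\in \mathrm{GL}_{p+q}: J'_{p,q}\,g^{-t}\,(J'_{p,q})^{-1}=g\}$ with Lie algebra $\mathfrak g=\mathfrak{sp}(J'_{p,q})$, and let $\theta$ be the involution of $G$ and of $\mathfrak g$ given by conjugation by $I_{p,q}$. Let $G(1)=G^\theta$, let $\mathfrak g(-1)$ be the $(-1)$-eigenspace of $\theta$ on $\mathfrak g$, and for $X\in\mathfrak g(-1)(F)$ let $\mathfrak g(-1)^X=\{Y\in\mathfrak g(-1)(F):[X,Y]=0\}$. A Cartan subspace of $\mathfrak g(-1)$ is a subspace over $F$ that is maximal among the commutative subspaces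 consisting of semisimple elements; $\mathrm{rank}\,\theta$ is the common dimension of all Cartan subspaces. An element $X\in\mathfrak g(-1)(\overline F)$ is relatively regular if its $G(1)(\overline F)$-orbit under conjugation has maximal dimension among all $G(1)(\overline F)$-orbits in $\mathfrak g(-1)(\overline F)$. Put $r=(p-q)/2$ and let $$e=\begin{pmatrix}0&A\\B&0\end{pmatrix},\qquad A=\begin{pmatrix}0_{r-1,q}\\1_q\\0_{r+1,q}\end{pmatrix},\quad B=\begin{pmatrix}0_{q,r+1}&(-1)^r1_q&0_{q,r-1}\end{pmatrix}\quad\text{if }p\ne q,$$ and $A=B=\epsilon_q$ if $p=q$. Then $e\in\mathfrak g(-1)(F)$, $e$ is nilpotent, $$\dim_F\mathfrak g(-1)^e=\frac q2=\mathrm{rank}\,\theta$$ (in particular, Cartan subspaces exist and all have dimension $q/2$), and $e$ is relatively regular. -/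

import Mathlib

open scoped Matrix

namespace SympSym

attribute [local instance] LieRing.ofAssociativeRing

/-- The antidiagonal matrix `J'_r` with alternating entries `1, -1, …, (-1)^(r-1)`,
read from the top right corner to the bottom left corner. -/
def J' (R : Type*) [Ring R] (r : ℕ) : Matrix (Fin r) (Fin r) R :=
  Matrix.of fun i j => if i.val + j.val + 1 = r then (-1) ^ i.val else 0

/-- `J'_{p,q} = diag(J'_p, J'_q)`. -/
def J'pq (R : Type*) [Ring R] (p q : ℕ) : Matrix (Fin p ⊕ Fin q) (Fin p ⊕ Fin q) R :=
  Matrix.fromBlocks (J' R p) 0 0 (J' R q)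

/-- `I_{p,q} = diag(1_p, -1_q)`, as an element of the general linear group. -/
def Ipq (R : Type*) [CommRing R] (p q : ℕ) : GL (Fin p ⊕ Fin q) R where
  val := Matrix.fromBlocks 1 0 0 (-1)
  inv := Matrix.fromBlocks 1 0 0 (-1)
  val_inv := by simp [Matrix.fromBlocks_multiply]
  inv_val := by simp [Matrix.fromBlocks_multiply]

/-- The group `Sp(J)(R) = {g ∈ GL_n(R) | g J gᵗ = J}`
(for invertible `J` the condition says `J g⁻ᵗ J⁻¹ = g`). -/
def Sp {R : Type*} [CommRing R] {n : Type*} [Fintype n] [DecidableEq n] (J : Matrix n n R) :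
    Subgroup (GL n R) where
  carrier := {g | (g : Matrix n n R) * J * (g : Matrix n n R)ᵀ = J}
  one_mem' := by simp
  mul_mem' := by
    intro a b ha hb
    simp only [Set.mem_ofPred_eq, Units.val_mul, Matrix.transpose_mul] at *
    calc (a : Matrix n n R) * b * J * ((b : Matrix n n R)ᵀ * (a : Matrix n n R)ᵀ)
        = a * (b * J * (b : Matrix n n R)ᵀ) * (a : Matrix n n R)ᵀ := by
          simp only [Matrix.mul_assoc]
      _ = J := by rw [hb, ha]
  inv_mem' := by
    intro a ha
    simp only [Set.mem_ofPred_eq] at *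
    have h : ((a : Matrix n n R))ᵀ * ((a⁻¹ : GL n R) : Matrix n n R)ᵀ = 1 := by
      rw [← Matrix.transpose_mul, Units.inv_mul, Matrix.transpose_one]
    calc ((a⁻¹ : GL n R) : Matrix n n R) * J * ((a⁻¹ : GL n R) : Matrix n n R)ᵀ
        = ((a⁻¹ : GL n R) : Matrix n n R) * (a * J * (a : Matrix n n R)ᵀ)
            * ((a⁻¹ : GL n R) : Matrix n n R)ᵀ := by rw [ha]
      _ = (((a⁻¹ : GL n R) : Matrix n n R) * a) * J
            * ((a : Matrix n n R)ᵀ * ((a⁻¹ : GL n R) : Matrix n n R)ᵀ) := by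
          simp only [Matrix.mul_assoc]
      _ = J := by rw [h, Units.inv_mul, Matrix.one_mul, Matrix.mul_one]

/-- `G(1)`: the elements of `G = Sp(J'_{p,q})` fixed by the involution
`θ(g) = I_{p,q} g I_{p,q}⁻¹`. -/
def G1 (R : Type*) [CommRing R] (p q : ℕ) : Subgroup (GL (Fin p ⊕ Fin q) R) :=
  Sp (J'pq R p q) ⊓ (MulAut.conj (Ipq R p q)).toMonoidHom.eqLocus (MonoidHom.id _)

/-- The involution `θ(X) = I_{p,q} X I_{p,q}⁻¹` on matrices. -/
def theta (R : Type*) [CommRing R] (p q : ℕ) :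
    Module.End R (Matrix (Fin p ⊕ Fin q) (Fin p ⊕ Fin q) R) where
  toFun X := (Ipq R p q : Matrix (Fin p ⊕ Fin q) (Fin p ⊕ Fin q) R) * X
    * ((Ipq R p q)⁻¹ : GL (Fin p ⊕ Fin q) R)
  map_add' X Y := by rw [Matrix.mul_add, Matrix.add_mul]
  map_smul' c X := by simp

/-- The Lie algebra `𝔤 = 𝔰𝔭(J'_{p,q})`: matrices `X` with `Xᵗ J'_{p,q} + J'_{p,q} X = 0`. -/
def sp (R : Type*) [CommRing R] (p q : ℕ) :
    LieSubalgebra R (Matrix (Fin p ⊕ Fin q) (Fin p ⊕ Fin q) R) :=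
  skewAdjointMatricesLieSubalgebra (J'pq R p q)

/-- `𝔤(-1)`: the `-1`-eigenspace of `θ` on `𝔤`. -/
def gMinus (R : Type*) [CommRing R] (p q : ℕ) :
    Submodule R (Matrix (Fin p ⊕ Fin q) (Fin p ⊕ Fin q) R) :=
  (sp R p q).toSubmodule ⊓ Module.End.eigenspace (theta R p q) (-1)

/-- `𝔤(-1)^X`: the centralizer of `X` in `𝔤(-1)`. -/
noncomputable def gMinusCentralizer {R : Type*} [CommRing R] {p q : ℕ}
    (X : Matrix (Fin p ⊕ Fin q) (Fin p ⊕ Fin q) R) :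
    Submodule R (Matrix (Fin p ⊕ Fin q) (Fin p ⊕ Fin q) R) :=
  gMinus R p q ⊓ LinearMap.ker (LieAlgebra.ad R (Matrix (Fin p ⊕ Fin q) (Fin p ⊕ Fin q) R) X)

/-- A Cartan subspace of `𝔤(-1)`: a maximal commutative subspace consisting of
semisimple elements. -/
def IsCartanSubspace {F : Type*} [Field F] {p q : ℕ}
    (T : Submodule F (Matrix (Fin p ⊕ Fin q) (Fin p ⊕ Fin q) F)) : Prop :=
  Maximal (fun S : Submodule F (Matrix (Fin p ⊕ Fin q) (Fin p ⊕ Fin q) F) =>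
    S ≤ gMinus F p q ∧ (∀ X ∈ S, ∀ Y ∈ S, ⁅X, Y⁆ = 0) ∧
      ∀ X ∈ S, Module.End.IsSemisimple (Matrix.toLin' X)) T

/-- `rank θ = d`: Cartan subspaces of `𝔤(-1)` exist, and all of them have dimension `d`. -/
def ThetaHasRank (F : Type*) [Field F] (p q d : ℕ) : Prop :=
  (∃ T : Submodule F (Matrix (Fin p ⊕ Fin q) (Fin p ⊕ Fin q) F), IsCartanSubspace T) ∧
    ∀ T : Submodule F (Matrix (Fin p ⊕ Fin q) (Fin p ⊕ Fin q) F),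
      IsCartanSubspace T → Module.finrank F T = d

/-- The dimension of (the Zariski closure of) a set `V` of points of affine space over an
algebraically closed field: the transcendence degree over `K` of the coordinate ring
`K[x] / I(V)`, that is, the largest number of algebraically independent polynomial
functions on `V`. -/
noncomputable def zariskiDim (K : Type*) [Field K] {σ : Type*} (V : Set (σ → K)) : Cardinal :=
  Algebra.trdeg K (MvPolynomial σ K ⧸ MvPolynomial.vanishingIdeal K V)

/-- The orbit `G(1)(K) · X` under conjugation, in the affine space of all matrices, where the
coordinates of a matrix are its entries. -/
def orbit {K : Type*} [Field K] {p q : ℕ} (X : Matrix (Fin p ⊕ Fin q) (Fin p ⊕ Fin q) K) :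
    Set ((Fin p ⊕ Fin q) × (Fin p ⊕ Fin q) → K) :=
  {v | ∃ g ∈ G1 K p q, ∀ ij, v ij =
    ((g : Matrix (Fin p ⊕ Fin q) (Fin p ⊕ Fin q) K) * X
      * (g⁻¹ : GL (Fin p ⊕ Fin q) K)) ij.1 ij.2}

/-- `X` is relatively regular: it lies in `𝔤(-1)(K)`, and its `G(1)(K)`-orbit has maximal
dimension among the `G(1)(K)`-orbits in `𝔤(-1)(K)`.  Used for `K` algebraically closed. -/
def IsRelativelyRegular {K : Type*} [Field K] {p q : ℕ}
    (X : Matrix (Fin p ⊕ Fin q) (Fin p ⊕ Fin q) K) : Prop :=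
  X ∈ gMinus K p q ∧ ∀ Y ∈ gMinus K p q, zariskiDim K (orbit Y) ≤ zariskiDim K (orbit X)

/-- The matrix with ones on the superdiagonal and zeros elsewhere; for `m = n` it is the regular
nilpotent `ε_n`. -/
def eps (R : Type*) [Ring R] (m n : ℕ) : Matrix (Fin m) (Fin n) R :=
  Matrix.of fun i j => if i.val + 1 = j.val then 1 else 0

/-- The `m × n` matrix whose entries are `1` at the places `(a + k, b + k)`, `k = 0, 1, …`
(counted from `0`), and `0` elsewhere.  For `n ≤ m` and `a ≤ m - n`, the matrix
`shiftedOne R m n a 0` is the column of blocks `0_{a,n}, 1_n, 0_{m-n-a,n}`; for `m ≤ n` and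
`b ≤ n - m`, the matrix `shiftedOne R m n 0 b` is the row of blocks
`0_{m,b}, 1_m, 0_{m,n-m-b}`. -/
def shiftedOne (R : Type*) [Ring R] (m n a b : ℕ) : Matrix (Fin m) (Fin n) R :=
  Matrix.of fun i j => if a ≤ i.val ∧ b ≤ j.val ∧ i.val + b = j.val + a then 1 else 0

/-- The explicit element `e`, where `r = (p - q) / 2`.  For `p ≠ q` its upper right block is the
column of blocks `0_{r-1,q}, 1_q, 0_{r+1,q}` and its lower left block is the row of blocks
`0_{q,r+1}, (-1)^r 1_q, 0_{q,r-1}`; for `p = q` both blocks are `ε_q`. -/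
def e (R : Type*) [Ring R] (p q : ℕ) : Matrix (Fin p ⊕ Fin q) (Fin p ⊕ Fin q) R :=
  let r := (p - q) / 2
  if p = q then
    Matrix.fromBlocks 0 (eps R p q) (eps R q p) 0
  else
    Matrix.fromBlocks 0 (shiftedOne R p q (r - 1) 0)
      ((-1 : R) ^ r • shiftedOne R q p 0 (r + 1)) 0

end SympSym

/-! Write A* = J'_q Aᵗ J'_p. The elements of 𝔤(-1) are the block matrices X_A with off-diagonal
blocks A and A*, and X_A commutes with X_C exactly when AC* = CA* and A*C = C*A. The matrix S = A*A
is self-adjoint for the symplectic form J'_q, and A f(S) commutes with A in this sense for every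
polynomial f.

Centralizer of e. With p = q + 2r, the blocks of e are a shift and, up to sign, another shift. The
two commutation equations become two signed reflections of the array of entries of C. Their
composite is translation by (2,2), so C is determined by the q/2 odd entries of its row r
(`eq_zero_of_reflections`). The matrices A Sᵗ realise these entries, so the dimension is q/2
(`finrank_blockCentralizer_eBlock`).

Rank. A Cartan subspace T contains X such that anything commuting with X commutes with all of T. By
the Jordan decomposition and maximality, an element of 𝔤(-1) commuting with X is an element of T
plus a nilpotent one. The trace form is nondegenerate on this centralizer and kills the nilpotents,
so T is the whole centralizer (`exists_isMinus_centralizer_eq`). Over the algebraic closure X = X_A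
has a centralizer made of semisimple elements. Absence of nilpotents makes A injective and every
eigenspace of S a symplectic plane, so S has q/2 eigenvalues, and the centralizer consists of the A
f(S) (`finrank_blockCentralizer_of_semisimple`).

Regularity. Two bounds meet at pq - q/2. From below, tangent directions [N, X_A] with N² = 0 span a
space whose annihilator under the trace form lies in the centralizer; the Jacobian criterion turns
them into independent functions on the orbit (`le_zariskiDim_orbit_offDiag`). From above, for every
orbit in 𝔤(-1), the coordinate functions are integral over pq - q/2 linear forms: all entries of A
off the central diagonal, and differences of mirror entries on it. If a valuation were nonnegative
on these forms but negative on some entry, rescaling and reducing would give a nonzero nilpotent X_D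
with D symmetric and supported on the central diagonal. But then D*D is diagonal with entries ±
squares, so D = 0 (`zariskiDim_orbit_le`). -/

set_option linter.unusedSectionVars false

namespace SympSym

attribute [local instance] LieRing.ofAssociativeRing

/-! ### Symplectic adjoints and commutation in block form -/

section Alternating

variable {R : Type*} [CommRing R] {m n : Type*} [Fintype m] [DecidableEq m] [Fintype n]
  [DecidableEq n]

/-- A skew-symmetric matrix with square `-1`, the Gram matrix of a symplectic form. -/
structure IsSympl (J : Matrix m m R) : Prop where
  transpose : Jᵀ = -J
  mul_self : J * J = -1

/-- The upper right and lower left blocks of an element of `𝔤(-1)` are related by `adj`. -/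
def adj (J₁ : Matrix m m R) (J₂ : Matrix n n R) (A : Matrix m n R) : Matrix n m R :=
  J₂ * Aᵀ * J₁

/-- The element of `𝔤(-1)` with upper right block `A`. -/
def offDiag (J₁ : Matrix m m R) (J₂ : Matrix n n R) (A : Matrix m n R) :
    Matrix (m ⊕ n) (m ⊕ n) R :=
  Matrix.fromBlocks 0 A (adj J₁ J₂ A) 0

/-- The off-diagonal blocks of the elements of `𝔤(-1)` commuting with `offDiag J₁ J₂ A`. -/
def blockCentralizer (J₁ : Matrix m m R) (J₂ : Matrix n n R) (A : Matrix m n R) :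
    Submodule R (Matrix m n R) where
  carrier := {C | A * adj J₁ J₂ C = C * adj J₁ J₂ A ∧ adj J₁ J₂ A * C = adj J₁ J₂ C * A}
  zero_mem' := by simp [adj]
  add_mem' := by
    rintro C D ⟨h1, h2⟩ ⟨h3, h4⟩
    simp only [adj, Set.mem_ofPred_eq, Matrix.transpose_add, Matrix.mul_add, Matrix.add_mul] at *
    exact ⟨by rw [h1, h3], by rw [h2, h4]⟩
  smul_mem' := by
    rintro c C ⟨h1, h2⟩
    simp only [adj, Set.mem_ofPred_eq, Matrix.transpose_smul, Matrix.mul_smul,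
      Matrix.smul_mul] at *
    exact ⟨by rw [h1], by rw [h2]⟩

end Alternating

section AdjLemmas

variable {R : Type*} [CommRing R] {m n : Type*} [Fintype m] [DecidableEq m] [Fintype n]
  [DecidableEq n] {J₁ : Matrix m m R} {J₂ : Matrix n n R}

theorem IsSympl.mul_transpose {J : Matrix m m R} (h : IsSympl J) : J * Jᵀ = 1 := by
  rw [h.transpose, Matrix.mul_neg, h.mul_self, neg_neg]

theorem IsSympl.transpose_mul {J : Matrix m m R} (h : IsSympl J) : Jᵀ * J = 1 := by
  rw [h.transpose, Matrix.neg_mul, h.mul_self, neg_neg]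

theorem mem_blockCentralizer {A C : Matrix m n R} :
    C ∈ blockCentralizer J₁ J₂ A ↔
      A * adj J₁ J₂ C = C * adj J₁ J₂ A ∧ adj J₁ J₂ A * C = adj J₁ J₂ C * A := Iff.rfl

theorem adj_adj (h₁ : IsSympl J₁) (h₂ : IsSympl J₂) (A : Matrix m n R) :
    adj J₂ J₁ (adj J₁ J₂ A) = A := by
  simp only [adj, Matrix.transpose_mul, Matrix.transpose_transpose]
  calc J₁ * (J₁ᵀ * (A * J₂ᵀ)) * J₂ = (J₁ * J₁ᵀ) * A * (J₂ᵀ * J₂) := by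
        simp only [Matrix.mul_assoc]
    _ = A := by rw [h₁.mul_transpose, h₂.transpose_mul, Matrix.one_mul, Matrix.mul_one]

/-- The adjoint of an endomorphism of a symplectic space. -/
def dag (J : Matrix n n R) (S : Matrix n n R) : Matrix n n R := -(J * Sᵀ * J)

/-- With C = A this makes A*A self-adjoint; for C in the centralizer of A it makes A*C self-adjoint.
-/
theorem dag_adj_mul (h₁ : IsSympl J₁) (h₂ : IsSympl J₂) (A C : Matrix m n R) :
    dag J₂ (adj J₁ J₂ A * C) = adj J₁ J₂ C * A := by
  simp only [adj, dag, Matrix.transpose_mul, Matrix.transpose_transpose, h₁.transpose]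
  calc -(J₂ * (Cᵀ * (-J₁ * (A * J₂ᵀ))) * J₂) = J₂ * Cᵀ * J₁ * A * (J₂ᵀ * J₂) := by
        simp only [Matrix.mul_assoc, Matrix.neg_mul, Matrix.mul_neg, neg_neg]
    _ = _ := by rw [h₂.transpose_mul, Matrix.mul_one]

theorem adj_mul_right (h₂ : IsSympl J₂) (A : Matrix m n R) (S : Matrix n n R) :
    adj J₁ J₂ (A * S) = dag J₂ S * adj J₁ J₂ A := by
  simp only [adj, dag, Matrix.transpose_mul]
  calc J₂ * (Sᵀ * Aᵀ) * J₁ = J₂ * Sᵀ * (-(J₂ * J₂)) * Aᵀ * J₁ := by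
        rw [h₂.mul_self, neg_neg, Matrix.mul_one]; simp only [Matrix.mul_assoc]
    _ = _ := by simp only [Matrix.mul_assoc, Matrix.neg_mul, Matrix.mul_neg]

theorem dag_mul (h : IsSympl J₂) (S T : Matrix n n R) :
    dag J₂ (S * T) = dag J₂ T * dag J₂ S := by
  simp only [dag, Matrix.transpose_mul]
  calc -(J₂ * (Tᵀ * Sᵀ) * J₂) = J₂ * Tᵀ * (J₂ * J₂) * Sᵀ * J₂ := by
        rw [h.mul_self]; simp only [Matrix.mul_assoc, Matrix.neg_mul, Matrix.mul_neg,
          Matrix.one_mul]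
    _ = _ := by simp only [Matrix.mul_assoc, Matrix.neg_mul, Matrix.mul_neg, neg_neg]

theorem dag_one (h : IsSympl J₂) : dag J₂ 1 = 1 := by
  simp [dag, h.mul_self]

theorem dag_pow (h : IsSympl J₂) (S : Matrix n n R) (k : ℕ) :
    dag J₂ (S ^ k) = dag J₂ S ^ k := by
  induction k with
  | zero => simpa using dag_one h
  | succ k ih => rw [pow_succ, dag_mul h, ih, (Commute.refl (dag J₂ S)).pow_right k, pow_succ]

theorem dag_dag (h : IsSympl J₂) (S : Matrix n n R) : dag J₂ (dag J₂ S) = S := by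
  have := adj_adj h h S
  simp only [dag, adj, Matrix.transpose_neg, Matrix.mul_neg, Matrix.neg_mul, neg_neg] at this ⊢
  exact this

/-- `dag` as a linear map. -/
def dagL (J : Matrix n n R) : Matrix n n R →ₗ[R] Matrix n n R where
  toFun := dag J
  map_add' S T := by simp [dag, Matrix.mul_add, Matrix.add_mul, add_comm]
  map_smul' c S := by simp [dag]

theorem dag_aeval (h : IsSympl J₂) (S : Matrix n n R) (f : Polynomial R) :
    dag J₂ (Polynomial.aeval S f) = Polynomial.aeval (dag J₂ S) f := by
  have : dagL J₂ ∘ₗ (Polynomial.aeval S).toLinearMap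
      = (Polynomial.aeval (dag J₂ S)).toLinearMap := by
    apply Polynomial.lhom_ext'
    intro k
    ext1
    rw [LinearMap.comp_apply, LinearMap.comp_apply, LinearMap.comp_apply]
    simp only [Polynomial.monomial_one_right_eq_X_pow, AlgHom.toLinearMap_apply, map_pow,
      Polynomial.aeval_X]
    exact dag_pow h S k
  exact LinearMap.congr_fun this f

/-- Multiplying by a self-adjoint commuting matrix stays in the centralizer. -/
theorem mul_mem_blockCentralizer (h₂ : IsSympl J₂) {A : Matrix m n R}
    {T : Matrix n n R} (hT : dag J₂ T = T) (hc : Commute (adj J₁ J₂ A * A) T) :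
    A * T ∈ blockCentralizer J₁ J₂ A := by
  rw [mem_blockCentralizer, adj_mul_right h₂, hT]
  refine ⟨by simp only [Matrix.mul_assoc], ?_⟩
  rw [← Matrix.mul_assoc, hc.eq, Matrix.mul_assoc]

theorem commute_offDiag_iff {A C : Matrix m n R} :
    offDiag J₁ J₂ A * offDiag J₁ J₂ C = offDiag J₁ J₂ C * offDiag J₁ J₂ A ↔
      C ∈ blockCentralizer J₁ J₂ A := by
  simp only [offDiag, Matrix.fromBlocks_multiply, mem_blockCentralizer, Matrix.fromBlocks_inj]
  simp

/-- `offDiag` as a linear map. -/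
def offDiagL (J₁ : Matrix m m R) (J₂ : Matrix n n R) :
    Matrix m n R →ₗ[R] Matrix (m ⊕ n) (m ⊕ n) R where
  toFun := offDiag J₁ J₂
  map_add' A C := by
    simp [offDiag, adj, Matrix.fromBlocks_add, Matrix.mul_add, Matrix.add_mul]
  map_smul' c A := by simp [offDiag, adj, Matrix.fromBlocks_smul]

theorem offDiagL_injective : Function.Injective (offDiagL J₁ J₂) := by
  intro A C h
  exact (Matrix.fromBlocks_inj.1 h).2.1

theorem offDiag_mul_offDiag (A C : Matrix m n R) :
    offDiag J₁ J₂ A * offDiag J₁ J₂ C =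
      Matrix.fromBlocks (A * adj J₁ J₂ C) 0 0 (adj J₁ J₂ A * C) := by
  simp [offDiag, Matrix.fromBlocks_multiply]

end AdjLemmas

/-! ### The blocks of 𝔤(-1) for the forms `J'` -/

section Concrete

variable {R : Type*} [CommRing R] {p q : ℕ}

theorem isSympl_J' (h : Even p) : IsSympl (J' R p) := by
  constructor
  · ext i j
    simp only [J', Matrix.transpose_apply, Matrix.of_apply, Matrix.neg_apply]
    by_cases hij : i.val + j.val + 1 = p
    · rw [if_pos hij, if_pos (by omega)]
      obtain ⟨k, hk⟩ := h
      have : j.val + i.val = 2 * (k - 1) + 1 := by omega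
      have h1 : ((-1 : R)) ^ j.val * (-1) ^ i.val = -1 := by
        rw [← pow_add, this, pow_succ, pow_mul]; simp
      rcases neg_one_pow_eq_or R i.val with h2 | h2 <;> rw [h2] at h1 ⊢ <;> simp_all
    · rw [if_neg hij, if_neg (by omega), neg_zero]
  · ext i j
    rw [Matrix.mul_apply, Finset.sum_eq_single (Fin.rev i)]
    · simp only [J', Matrix.of_apply, Fin.val_rev, Matrix.neg_apply, Matrix.one_apply]
      rw [if_pos (by omega)]
      by_cases hij : i = j
      · subst hij
        rw [if_pos (by omega), if_pos rfl, ← pow_add,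
          show i.val + (p - (i.val + 1)) = p - 1 by omega]
        exact (Nat.Even.sub_odd (by have := i.isLt; omega) h odd_one).neg_one_pow
      · rw [if_neg, if_neg hij]
        · simp
        · intro h'; apply hij; ext; omega
    · intro k _ hk
      simp only [J', Matrix.of_apply]
      rw [if_neg, zero_mul]
      intro h'; apply hk; ext; simp; omega
    · simp

theorem adj_J'_apply (hp : Even p) (A : Matrix (Fin p) (Fin q) R) (i : Fin q) (j : Fin p) :
    adj (J' R p) (J' R q) A i j = -((-1) ^ (i.val + j.val) * A j.rev i.rev) := by
  rw [adj, Matrix.mul_apply, Finset.sum_eq_single j.rev]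
  · rw [Matrix.mul_apply, Finset.sum_eq_single i.rev]
    · simp only [J', Matrix.of_apply, Fin.val_rev, Matrix.transpose_apply]
      rw [if_pos (by omega), if_pos (by omega)]
      have : (-1 : R) ^ (p - (j.val + 1)) * (-1) ^ j.val = -1 := by
        rw [← pow_add, show p - (j.val + 1) + j.val = p - 1 by omega]
        exact (Nat.Even.sub_odd (by have := j.isLt; omega) hp odd_one).neg_one_pow
      have h2 : (-1 : R) ^ j.val * (-1) ^ j.val = 1 := by
        rw [← pow_add]; exact (Even.add_self _).neg_one_pow
      rw [pow_add]
      linear_combination ((-1 : R) ^ i.val * (-1) ^ j.val * A j.rev i.rev) * this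
        - (-1 : R) ^ i.val * (-1) ^ (p - (j.val + 1)) * A j.rev i.rev * h2
    · intro k _ hk
      simp only [J', Matrix.of_apply]
      rw [if_neg, zero_mul]
      intro h'; apply hk; ext; simp; omega
    · simp
  · intro k _ hk
    simp only [J', Matrix.of_apply]
    rw [if_neg, mul_zero]
    intro h'; apply hk; ext; simp; omega
  · simp

theorem mem_gMinus_iff_blocks {K : Type*} [Field K] [CharZero K]
    {X : Matrix (Fin p ⊕ Fin q) (Fin p ⊕ Fin q) K} :
    X ∈ gMinus K p q ↔ Xᵀ * J'pq K p q = -(J'pq K p q * X) ∧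
      Matrix.fromBlocks 1 0 0 (-1) * X * Matrix.fromBlocks 1 0 0 (-1) = -X := by
  rw [gMinus, Submodule.mem_inf, Module.End.mem_eigenspace_iff, neg_one_smul, sp]
  change (X ∈ skewAdjointMatricesSubmodule _) ∧ _ ↔ _
  rw [mem_skewAdjointMatricesSubmodule, Matrix.IsSkewAdjoint, Matrix.IsAdjointPair,
    Matrix.mul_neg]
  rfl

/-- Anti-invariance under θ kills the diagonal blocks since 2 is invertible, and skewness then
recovers the lower left block from the upper right one. -/
theorem mem_gMinus_iff {K : Type*} [Field K] [CharZero K] (hp : Even p) (hq : Even q)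
    {X : Matrix (Fin p ⊕ Fin q) (Fin p ⊕ Fin q) K} :
    X ∈ gMinus K p q ↔ ∃ A, offDiag (J' K p) (J' K q) A = X := by
  have h₁ := isSympl_J' (R := K) hp
  have h₂ := isSympl_J' (R := K) hq
  rw [mem_gMinus_iff_blocks]
  constructor
  · rintro ⟨h1, h2⟩
    obtain ⟨a, b, c, d, rfl⟩ : ∃ a b c d, X = Matrix.fromBlocks a b c d :=
      ⟨_, _, _, _, (Matrix.fromBlocks_toBlocks X).symm⟩
    simp only [Matrix.fromBlocks_multiply, Matrix.fromBlocks_neg, Matrix.fromBlocks_inj,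
      J'pq, Matrix.fromBlocks_transpose] at h1 h2
    simp only [Matrix.one_mul, Matrix.mul_one, Matrix.zero_mul, Matrix.mul_zero, add_zero,
      Matrix.neg_mul, Matrix.mul_neg, neg_neg, zero_add] at h1 h2
    obtain ⟨ha, -, -, hd⟩ := h2
    obtain ⟨-, -, hc, -⟩ := h1
    have ha' : a = 0 := by
      ext i j; exact self_eq_neg.1 (congrFun (congrFun ha i) j)
    have hd' : d = 0 := by
      ext i j; exact self_eq_neg.1 (congrFun (congrFun hd i) j)
    refine ⟨b, ?_⟩
    subst ha' hd'
    rw [offDiag, adj, Matrix.mul_assoc, hc, Matrix.mul_neg, ← Matrix.mul_assoc, h₂.mul_self]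
    simp
  · rintro ⟨A, rfl⟩
    simp only [offDiag, Matrix.fromBlocks_multiply, Matrix.fromBlocks_neg, Matrix.fromBlocks_inj,
      J'pq, Matrix.fromBlocks_transpose]
    simp only [Matrix.one_mul, Matrix.mul_one, Matrix.zero_mul, Matrix.mul_zero, add_zero,
      Matrix.neg_mul, Matrix.mul_neg, zero_add, neg_zero, and_true, adj,
      Matrix.transpose_mul, Matrix.transpose_transpose]
    refine ⟨by simp, ?_, ?_, by simp⟩
    · rw [h₂.transpose, h₁.transpose]
      simp only [Matrix.mul_assoc, Matrix.mul_neg, Matrix.neg_mul, neg_neg, h₂.mul_self]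
      simp
    · rw [← Matrix.mul_assoc, ← Matrix.mul_assoc, h₂.mul_self]
      simp

theorem mem_gMinusCentralizer {X Y : Matrix (Fin p ⊕ Fin q) (Fin p ⊕ Fin q) R} :
    Y ∈ gMinusCentralizer X ↔ Y ∈ gMinus R p q ∧ X * Y = Y * X := by
  rw [gMinusCentralizer, Submodule.mem_inf, LinearMap.mem_ker, LieAlgebra.ad_apply,
    LieRing.of_associative_ring_bracket, sub_eq_zero]

theorem gMinusCentralizer_offDiag {K : Type*} [Field K] [CharZero K] (hp : Even p) (hq : Even q)
    (A : Matrix (Fin p) (Fin q) K) :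
    gMinusCentralizer (offDiag (J' K p) (J' K q) A) =
      (blockCentralizer (J' K p) (J' K q) A).map (offDiagL (J' K p) (J' K q)) := by
  ext Y
  rw [mem_gMinusCentralizer, mem_gMinus_iff hp hq, Submodule.mem_map]
  constructor
  · rintro ⟨⟨C, rfl⟩, h⟩
    exact ⟨C, commute_offDiag_iff.1 h, rfl⟩
  · rintro ⟨C, hC, rfl⟩
    exact ⟨⟨C, rfl⟩, commute_offDiag_iff.2 hC⟩

theorem finrank_gMinusCentralizer_offDiag {K : Type*} [Field K] [CharZero K] (hp : Even p)
    (hq : Even q) (A : Matrix (Fin p) (Fin q) K) :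
    Module.finrank K (gMinusCentralizer (offDiag (J' K p) (J' K q) A)) =
      Module.finrank K (blockCentralizer (J' K p) (J' K q) A) := by
  rw [gMinusCentralizer_offDiag hp hq]
  exact (Submodule.equivMapOfInjective _ offDiagL_injective _).finrank_eq.symm

end Concrete

/-! ### Arrays with two signed reflections -/

section Recursion

variable {K : Type*} [Field K] [CharZero K]

/-- An array that is periodic along diagonals in steps of two, and symmetric up to sign under
two reflections, is determined by the odd entries of one row. -/
theorem eq_zero_of_reflections {q r : ℕ} (hq : Even q) (c : ℕ → ℕ → K)
    (H1 : ∀ i b, r + 1 ≤ i → i ≤ r + q → 1 ≤ b → b < q →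
      c i b = -((-1) ^ (i + r + b) * c (r + q - b) (q + r - i)))
    (H2 : ∀ i b, r ≤ i + 1 → i + 2 ≤ r + q → b < q → b + 2 ≤ q + r →
      c i b = -((-1) ^ (i + r + b) * c (r + q - 2 - b) (q + r - 2 - i)))
    (Z : ∀ i b, r + q ≤ i + 1 → b < q → b + 2 ≤ q + r ∨ q + 2 * r ≤ i → c i b = 0)
    (Z' : ∀ i b, i + 2 ≤ r → b < q → c i b = 0)
    (h0 : ∀ b, Odd b → b < q → c r b = 0) :
    ∀ i b, i < q + 2 * r → b < q → c i b = 0 := by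
  -- The two reflections compose to translation by (2,2), and their signs cancel.
  have T : ∀ i b, r ≤ i + 1 → i + 2 ≤ r + q → b + 2 < q → c (i + 2) (b + 2) = c i b := by
    intro i b h1 h2 h3
    rw [H1 (i + 2) (b + 2) (by omega) (by omega) (by omega) h3,
      H2 (r + q - (b + 2)) (q + r - (i + 2)) (by omega) (by omega) (by omega) (by omega)]
    have e1 : r + q - 2 - (q + r - (i + 2)) = i := by omega
    have e2 : q + r - 2 - (r + q - (b + 2)) = b := by omega
    rw [e1, e2]
    have e3 : (-1 : K) ^ (i + 2 + r + (b + 2))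
        * (-1) ^ (r + q - (b + 2) + r + (q + r - (i + 2))) = 1 := by
      rw [← pow_add]
      apply Even.neg_one_pow
      rw [show i + 2 + r + (b + 2) + (r + q - (b + 2) + r + (q + r - (i + 2)))
        = 2 * (2 * r + q) by omega]
      exact even_two_mul _
    linear_combination (c i b) * e3
  have Tt : ∀ t i b, r ≤ i + 1 → i + 2 * t ≤ r + q → b + 2 * t < q →
      c (i + 2 * t) (b + 2 * t) = c i b := by
    intro t
    induction t with
    | zero => intros; rfl
    | succ t ih =>
      intro i b h1 h2 h3
      have := T (i + 2 * t) (b + 2 * t) (by omega) (by omega) (by omega)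
      rw [show i + 2 * (t + 1) = i + 2 * t + 2 by ring,
        show b + 2 * (t + 1) = b + 2 * t + 2 by ring, this]
      exact ih i b h1 (by omega) (by omega)
  -- two entries of the same diagonal at even distance agree
  have TT : ∀ i b i' b', r ≤ i + 1 → r ≤ i' + 1 → i ≤ r + q → i' ≤ r + q → b < q → b' < q →
      i + b' = i' + b → Even (i + i') → c i b = c i' b' := by
    intro i b i' b' h1 h2 h3 h4 h5 h6 h7 h8
    rcases le_total i i' with h | h
    · obtain ⟨t, ht⟩ : ∃ t, i' = i + 2 * t := by
        obtain ⟨k, hk⟩ := h8; exact ⟨k - i, by omega⟩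
      subst ht
      obtain rfl : b' = b + 2 * t := by omega
      exact (Tt t i b h1 h4 h6).symm
    · obtain ⟨t, ht⟩ : ∃ t, i = i' + 2 * t := by
        obtain ⟨k, hk⟩ := h8; exact ⟨k - i', by omega⟩
      subst ht
      obtain rfl : b = b' + 2 * t := by omega
      exact Tt t i' b' h2 h3 h5
  intro i b hi hb
  obtain ⟨m, hm⟩ := hq
  -- Below the central diagonal, translation leads down to row r + q - 1 or r + q, where the
  -- boundary condition `Z` applies. On and above it the parity of i + b + r decides.
  by_cases hir : i + 2 ≤ r
  · exact Z' i b hir hb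
  by_cases hlt : b + r < i
  · by_cases hbig : r + q ≤ i + 1
    · exact Z i b hbig hb (by omega)
    rcases Nat.even_or_odd' (r + q - i) with ⟨t, ht | ht⟩
    · rw [← Tt t i b (by omega) (by omega) (by omega)]
      exact Z _ _ (by omega) (by omega) (by omega)
    · rw [← Tt t i b (by omega) (by omega) (by omega)]
      exact Z _ _ (by omega) (by omega) (by omega)
  rcases Nat.even_or_odd (b + r + i) with hpar | hpar
  -- For even parity, one reflection lands on the same diagonal at even distance, with sign -1.
  · have key : c i b = -c i b := by
      by_cases h1 : r + 1 ≤ i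
      · conv_lhs => rw [H1 i b h1 (by omega) (by omega) hb]
        rw [show i + r + b = b + r + i by ring, hpar.neg_one_pow, one_mul,
          TT i b (r + q - b) (q + r - i) (by omega) (by omega) (by omega) (by omega) hb
          (by omega) (by omega) ?_]
        obtain ⟨k, hk⟩ := hpar
        exact ⟨k + m - b, by omega⟩
      · conv_lhs => rw [H2 i b (by omega) (by omega) hb
          (by obtain ⟨k, hk⟩ := hpar; rcases Nat.lt_or_ge i r with h | h <;> omega)]
        rw [show i + r + b = b + r + i by ring, hpar.neg_one_pow, one_mul,
          TT i b (r + q - 2 - b) (q + r - 2 - i) (by omega)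
          (by obtain ⟨k, hk⟩ := hpar; rcases Nat.lt_or_ge i r with h | h <;> omega) (by omega) (by omega) hb
          (by omega) (by obtain ⟨k, hk⟩ := hpar; rcases Nat.lt_or_ge i r with h | h <;> omega) ?_]
        obtain ⟨k, hk⟩ := hpar
        exact ⟨k + m - 1 - b, by omega⟩
    exact self_eq_neg.1 key
  -- For odd parity, rows congruent to r mod 2 translate up to an odd entry of row r; the other rows
  -- are reflected into such rows.
  · have main : ∀ i b, r ≤ i → b < q → i < b + r → Even (i + r) → Odd (b + r + i) →
        c i b = 0 := by
      intro i b h1 h2 h3 h4 h5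
      rw [TT i b r (b + r - i) (by omega) (by omega) (by omega) (by omega) h2 (by omega)
        (by omega) h4]
      refine h0 _ ?_ (by omega)
      rw [Nat.odd_iff] at h5 ⊢; omega
    by_cases he : Even (i + r)
    · by_cases h' : r ≤ i
      · refine main i b h' hb ?_ he hpar
        rw [Nat.odd_iff] at hpar; omega
      · rw [Nat.even_iff] at he; omega
    · rw [Nat.not_even_iff] at he
      rw [Nat.odd_iff] at hpar
      rw [H2 i b (by omega) (by omega) hb (by omega),
        main _ _ (by omega) (by omega) (by omega) (by rw [Nat.even_iff]; omega)
        (by rw [Nat.odd_iff]; omega)]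
      simp

end Recursion

/-! ### The nilpotent element e and its centralizer -/

section NilpotentElement

variable {K : Type*} [Field K] [CharZero K] {p q r : ℕ}

/-- The upper right block of `e`, where `p = q + 2 r`. -/
def eBlock (R : Type*) [Ring R] (p q r : ℕ) : Matrix (Fin p) (Fin q) R :=
  Matrix.of fun i j => if i.val + 1 = j.val + r then 1 else 0

theorem adj_eBlock (hp : Even p) (hr : p = q + 2 * r) (i : Fin q) (j : Fin p) :
    adj (J' K p) (J' K q) (eBlock K p q r) i j =
      if i.val + 1 + r = j.val then (-1) ^ r else 0 := by
  rw [adj_J'_apply hp]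
  simp only [eBlock, Matrix.of_apply, Fin.val_rev]
  have := i.isLt
  by_cases h : i.val + 1 + r = j.val
  · rw [if_pos h, if_pos (by omega), ← h, show i.val + (i.val + 1 + r) = r + 1 + 2 * i.val by ring,
      pow_add, pow_mul]
    simp [pow_succ]
  · rw [if_neg h, if_neg (by omega)]; simp

/-- One shift formula covers both cases of the definition: r = 0 gives the superdiagonal, and for r
≥ 1 the inequalities in `shiftedOne` hold automatically. -/
theorem e_eq_offDiag (hp : Even p) (hr : p = q + 2 * r) :
    e K p q = offDiag (J' K p) (J' K q) (eBlock K p q r) := by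
  have hadj := adj_eBlock (K := K) hp hr
  have hr' : (p - q) / 2 = r := by omega
  simp only [e, hr']
  split_ifs with h
  · obtain rfl : r = 0 := by omega
    rw [offDiag, Matrix.fromBlocks_inj]
    refine ⟨rfl, rfl, ?_, rfl⟩
    ext i j
    rw [hadj]; simp [eps]
  · rw [offDiag, Matrix.fromBlocks_inj]
    refine ⟨rfl, ?_, ?_, rfl⟩
    · ext i j
      simp only [shiftedOne, eBlock, Matrix.of_apply]
      congr 1
      apply propext; omega
    · ext i j
      rw [hadj]
      simp only [shiftedOne, Matrix.smul_apply, Matrix.of_apply, smul_eq_mul, mul_ite, mul_one,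
        mul_zero]
      congr 1
      apply propext; omega

theorem eps_pow (n k : ℕ) :
    (eps K n n) ^ k = Matrix.of fun i j => if i.val + k = j.val then 1 else 0 := by
  induction k with
  | zero => ext i j; simp [Matrix.one_apply, Fin.ext_iff]
  | succ k ih =>
    ext i j
    rw [pow_succ, ih, Matrix.mul_apply]
    simp only [eps, Matrix.of_apply]
    by_cases h : i.val + (k + 1) = j.val
    · rw [if_pos h, Finset.sum_eq_single ⟨i.val + k, by omega⟩]
      · simp only [if_true, one_mul]; rw [if_pos (by omega)]
      · intro l _ hl
        rw [if_neg, zero_mul]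
        intro h'; apply hl; ext; exact h'.symm
      · simp
    · rw [if_neg h]
      refine Finset.sum_eq_zero fun l _ => ?_
      by_cases h1 : i.val + k = l.val
      · rw [if_neg (by omega : ¬ l.val + 1 = j.val), mul_zero]
      · rw [if_neg h1, zero_mul]

theorem adj_eBlock_mul_eBlock (hp : Even p) (hr : p = q + 2 * r) :
    adj (J' K p) (J' K q) (eBlock K p q r) * eBlock K p q r
      = (-1 : K) ^ r • (eps K q q) ^ 2 := by
  ext i j
  rw [Matrix.mul_apply, eps_pow]
  simp only [adj_eBlock hp hr, Matrix.smul_apply, Matrix.of_apply, smul_eq_mul, mul_ite, mul_one,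
    mul_zero]
  by_cases h : i.val + 2 = j.val
  · rw [if_pos h, Finset.sum_eq_single ⟨i.val + 1 + r, by omega⟩]
    · rw [if_pos rfl]; simp only [eBlock, Matrix.of_apply]
      rw [if_pos (by omega), mul_one]
    · intro l _ hl
      rw [if_neg, zero_mul]
      intro h'; apply hl; ext; exact h'.symm
    · simp
  · rw [if_neg h]
    refine Finset.sum_eq_zero fun l _ => ?_
    by_cases h1 : i.val + 1 + r = l.val
    · simp only [eBlock, Matrix.of_apply]
      rw [if_neg (by omega : ¬ l.val + 1 = j.val + r), mul_zero]
    · rw [if_neg h1, zero_mul]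

/-- The square of X_A is block diagonal with blocks AA* and A*A, and (AA*)^(k+1) = A (A*A)^k A*. -/
theorem isNilpotent_offDiag {m n : Type*} [Fintype m] [DecidableEq m] [Fintype n]
    [DecidableEq n] {J₁ : Matrix m m K} {J₂ : Matrix n n K} {A : Matrix m n K}
    (h : IsNilpotent (adj J₁ J₂ A * A)) : IsNilpotent (offDiag J₁ J₂ A) := by
  obtain ⟨k, hk⟩ := h
  refine ⟨2 * (k + 1), ?_⟩
  have h1 : ∀ k, (A * adj J₁ J₂ A) ^ (k + 1) = A * (adj J₁ J₂ A * A) ^ k * adj J₁ J₂ A := by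
    intro k
    induction k with
    | zero => simp
    | succ k ih => rw [pow_succ, ih, pow_succ]; simp only [Matrix.mul_assoc]
  have h2 : ∀ (U : Matrix m m K) (W : Matrix n n K) k,
      (Matrix.fromBlocks U 0 0 W) ^ k = Matrix.fromBlocks (U ^ k) 0 0 (W ^ k) := by
    intro U W k
    induction k with
    | zero => simp
    | succ k ih => rw [pow_succ, ih, Matrix.fromBlocks_multiply]; simp [pow_succ]
  rw [pow_mul, pow_two, offDiag_mul_offDiag, h2, h1, hk, pow_succ, hk]
  simp

theorem isNilpotent_adj_eBlock_mul_eBlock (hp : Even p) (hr : p = q + 2 * r) :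
    IsNilpotent (adj (J' K p) (J' K q) (eBlock K p q r) * eBlock K p q r) := by
  rw [adj_eBlock_mul_eBlock hp hr]
  refine ⟨q, ?_⟩
  have : ((eps K q q) ^ 2) ^ q = 0 := by
    rw [← pow_mul, eps_pow]
    ext i j
    have := j.isLt
    rw [Matrix.of_apply, if_neg (by omega), Matrix.zero_apply]
  rw [smul_pow, this, smul_zero]

/-- The array of entries of a matrix, extended by zero. -/
def entryNat (C : Matrix (Fin p) (Fin q) K) (i j : ℕ) : K :=
  if h : i < p ∧ j < q then C ⟨i, h.1⟩ ⟨j, h.2⟩ else 0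

theorem entryNat_of_lt (C : Matrix (Fin p) (Fin q) K) {i j : ℕ} (hi : i < p) (hj : j < q) :
    entryNat C i j = C ⟨i, hi⟩ ⟨j, hj⟩ := dif_pos ⟨hi, hj⟩

theorem eBlock_mul_apply {n : Type*} (D : Matrix (Fin q) n K) (i : Fin p) (k : n)
    (j : Fin q) (h : i.val + 1 = j.val + r) : (eBlock K p q r * D) i k = D j k := by
  rw [Matrix.mul_apply, Finset.sum_eq_single j]
  · simp only [eBlock, Matrix.of_apply]; rw [if_pos h, one_mul]
  · intro l _ hl
    simp only [eBlock, Matrix.of_apply]; rw [if_neg, zero_mul]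
    intro h'; apply hl; ext; omega
  · simp

theorem mul_eBlock_apply {n : Type*} (D : Matrix n (Fin p) K) (k : n) (i : Fin p)
    (j : Fin q) (h : i.val + 1 = j.val + r) : (D * eBlock K p q r) k j = D k i := by
  rw [Matrix.mul_apply, Finset.sum_eq_single i]
  · simp only [eBlock, Matrix.of_apply]; rw [if_pos h, mul_one]
  · intro l _ hl
    simp only [eBlock, Matrix.of_apply]; rw [if_neg, mul_zero]
    intro h'; apply hl; ext; omega
  · simp

theorem adj_eBlock_mul_apply {n : Type*} (hp : Even p) (hr : p = q + 2 * r)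
    (D : Matrix (Fin p) n K) (j : Fin q) (k : n) (i : Fin p) (h : j.val + 1 + r = i.val) :
    (adj (J' K p) (J' K q) (eBlock K p q r) * D) j k = (-1) ^ r * D i k := by
  rw [Matrix.mul_apply, Finset.sum_eq_single i]
  · rw [adj_eBlock hp hr, if_pos h]
  · intro l _ hl
    rw [adj_eBlock hp hr, if_neg, zero_mul]
    intro h'; apply hl; ext; omega
  · simp

theorem mul_adj_eBlock_apply {n : Type*} (hp : Even p) (hr : p = q + 2 * r)
    (D : Matrix n (Fin q) K) (k : n) (j : Fin q) (i : Fin p) (h : j.val + 1 + r = i.val) :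
    (D * adj (J' K p) (J' K q) (eBlock K p q r)) k i = (-1) ^ r * D k j := by
  rw [Matrix.mul_apply, Finset.sum_eq_single j]
  · rw [adj_eBlock hp hr, if_pos h, mul_comm]
  · intro l _ hl
    rw [adj_eBlock hp hr, if_neg, mul_zero]
    intro h'; apply hl; ext; omega
  · simp

theorem mul_adj_eBlock_apply_eq_zero {n : Type*} (hp : Even p) (hr : p = q + 2 * r)
    (D : Matrix n (Fin q) K) (k : n) (i : Fin p) (h : i.val ≤ r ∨ r + q < i.val) :
    (D * adj (J' K p) (J' K q) (eBlock K p q r)) k i = 0 := by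
  rw [Matrix.mul_apply]
  refine Finset.sum_eq_zero fun l _ => ?_
  rw [adj_eBlock hp hr, if_neg (by omega), mul_zero]

/-- Since both blocks of e are shifts up to sign, entries of A*C = C*A give the first reflection and
entries of AC* = CA* the second. The zero columns of A* in the latter give the boundary conditions.
-/
theorem eq_zero_of_mem_blockCentralizer_eBlock (hp : Even p) (hq : Even q) (hr : p = q + 2 * r)
    {C : Matrix (Fin p) (Fin q) K}
    (hC : C ∈ blockCentralizer (J' K p) (J' K q) (eBlock K p q r))
    (h0 : ∀ b, Odd b → b < q → entryNat C r b = 0) : C = 0 := by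
  obtain ⟨hC1, hC2⟩ := hC
  have hs : (-1 : K) ^ r * (-1) ^ r = 1 := by
    rw [← pow_add]; exact (Even.add_self _).neg_one_pow
  have main : ∀ i b, i < q + 2 * r → b < q → entryNat C i b = 0 := by
    refine eq_zero_of_reflections hq _ ?_ ?_ ?_ ?_ h0
    · intro i b h1 h2 h3 h4
      by_cases hip : i < p
      · rw [entryNat_of_lt C hip h4, entryNat_of_lt C (by omega) (by omega)]
        have := congrFun (congrFun hC2 ⟨i - r - 1, by omega⟩) ⟨b, h4⟩
        rw [adj_eBlock_mul_apply hp hr _ _ _ ⟨i, hip⟩ (by simp; omega),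
          mul_eBlock_apply _ _ ⟨b + r - 1, by omega⟩ _ (by simp; omega), adj_J'_apply hp] at this
        have e1 : Fin.rev (⟨b + r - 1, by omega⟩ : Fin p) = ⟨r + q - b, by omega⟩ := by
          ext; simp; omega
        have e2 : Fin.rev (⟨i - r - 1, by omega⟩ : Fin q) = ⟨q + r - i, by omega⟩ := by
          ext; simp; omega
        rw [e1, e2] at this
        simp only at this
        have e3 : (-1 : K) ^ (i + r + b) = (-1) ^ r * (-1) ^ (i - r - 1 + (b + r - 1)) := by
          rw [← pow_add, show i + r + b = r + (i - r - 1 + (b + r - 1)) + 2 by omega, pow_add]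
          simp
        rw [e3]
        linear_combination (-1) ^ r * this - C ⟨i, hip⟩ ⟨b, h4⟩ * hs
      -- Only for r = 0 does the range of the first reflection reach the row i = q = p just outside
      -- the matrix. The relation still holds there because the last row of A* is zero.
      · obtain rfl : r = 0 := by omega
        rw [entryNat, dif_neg (by omega)]
        have := congrFun (congrFun hC2 ⟨q - 1, by omega⟩) ⟨b, h4⟩
        rw [mul_eBlock_apply _ _ ⟨b - 1, by omega⟩ _ (by simp; omega), adj_J'_apply hp,
          Matrix.mul_apply, Finset.sum_eq_zero] at this
        · have e1 : Fin.rev (⟨b - 1, by omega⟩ : Fin p) = ⟨q - b, by omega⟩ := by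
            ext; simp; omega
          have e2 : Fin.rev (⟨q - 1, by omega⟩ : Fin q) = ⟨0, by omega⟩ := by
            ext; simp; omega
          rw [e1, e2] at this
          obtain rfl : i = q := by omega
          simp only [add_zero, zero_add, Nat.sub_self]
          rw [entryNat_of_lt C (by omega) (by omega)]
          have h' := neg_eq_zero.1 this.symm
          rcases mul_eq_zero.1 h' with h'' | h''
          · exact absurd h'' (pow_ne_zero _ (by simp))
          · rw [h'']; simp
        · intro l _
          have := l.isLt
          rw [adj_eBlock hp hr, if_neg (by simp; omega), zero_mul]
    · intro i b h1 h2 h3 h4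
      rw [entryNat_of_lt C (by omega) h3, entryNat_of_lt C (by omega) (by omega)]
      have := congrFun (congrFun hC1 ⟨i, by omega⟩) ⟨r + 1 + b, by omega⟩
      rw [eBlock_mul_apply _ _ _ ⟨i + 1 - r, by omega⟩ (by simp; omega),
        mul_adj_eBlock_apply hp hr _ _ ⟨b, h3⟩ _ (by simp; omega), adj_J'_apply hp] at this
      have e1 : Fin.rev (⟨r + 1 + b, by omega⟩ : Fin p) = ⟨r + q - 2 - b, by omega⟩ := by
        ext; simp; omega
      have e2 : Fin.rev (⟨i + 1 - r, by omega⟩ : Fin q) = ⟨q + r - 2 - i, by omega⟩ := by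
        ext; simp; omega
      rw [e1, e2] at this
      simp only at this
      have e3 : (-1 : K) ^ (i + r + b) = (-1) ^ r * (-1) ^ (i + 1 - r + (r + 1 + b)) := by
        rw [← pow_add, show r + (i + 1 - r + (r + 1 + b)) = i + r + b + 2 by omega, pow_add _ _ 2]
        simp
      rw [e3]
      linear_combination -(-1) ^ r * this - C ⟨i, by omega⟩ ⟨b, h3⟩ * hs
    · intro i b h1 h2 h3
      by_cases hip : i < p
      · rw [entryNat_of_lt C hip h2]
        have := congrFun (congrFun hC1 ⟨q - 1 - b + r - 1, by omega⟩) (Fin.rev ⟨i, hip⟩)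
        rw [eBlock_mul_apply _ _ _ (Fin.rev ⟨b, h2⟩) (by simp; omega),
          mul_adj_eBlock_apply_eq_zero hp hr _ _ _ (by simp; omega), adj_J'_apply hp] at this
        simpa using this
      · rw [entryNat, dif_neg (by omega)]
    · intro i b h1 h2
      rw [entryNat_of_lt C (by omega) h2]
      have := congrFun (congrFun hC1 ⟨q - 1 - b + r - 1, by omega⟩) (Fin.rev ⟨i, by omega⟩)
      rw [eBlock_mul_apply _ _ _ (Fin.rev ⟨b, h2⟩) (by simp; omega),
        mul_adj_eBlock_apply_eq_zero hp hr _ _ _ (by simp; omega), adj_J'_apply hp] at this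
      simpa using this
  ext i j
  have := main i.val j.val (by omega) j.isLt
  rwa [entryNat_of_lt C i.isLt j.isLt] at this

/-- The odd entries of the row `r`. -/
def oddRow (r : ℕ) : Matrix (Fin p) (Fin q) K →ₗ[K] (Fin (q / 2) → K) where
  toFun C t := entryNat C r (2 * t.val + 1)
  map_add' C D := by
    ext t; simp only [entryNat, Pi.add_apply]; split_ifs <;> simp
  map_smul' c C := by
    ext t; simp only [entryNat, Pi.smul_apply, RingHom.id_apply]; split_ifs <;> simp

theorem finrank_blockCentralizer_eBlock (hp : Even p) (hq : Even q) (hr : p = q + 2 * r) :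
    Module.finrank K (blockCentralizer (J' K p) (J' K q) (eBlock K p q r)) = q / 2 := by
  have hs := isSympl_J' (R := K) hq
  have hs1 := isSympl_J' (R := K) hp
  set f := (oddRow (K := K) (p := p) (q := q) r).domRestrict
    (blockCentralizer (J' K p) (J' K q) (eBlock K p q r)) with hf
  have hinj : Function.Injective f := by
    rw [← LinearMap.ker_eq_bot, LinearMap.ker_eq_bot']
    rintro ⟨C, hC⟩ h
    rw [Subtype.ext_iff]
    refine eq_zero_of_mem_blockCentralizer_eBlock hp hq hr hC ?_
    rintro b ⟨t, rfl⟩ hb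
    exact congrFun h ⟨t, by omega⟩
  have hsurj : Function.Surjective f := by
    rw [← LinearMap.range_eq_top, eq_top_iff, ← (Pi.basisFun K (Fin (q / 2))).span_eq,
      Submodule.span_le]
    rintro _ ⟨t, rfl⟩
    -- Row r of A Sᵗ is row 1 of Sᵗ, and S is ± the square of the shift, so its only nonzero entry
    -- is ±1 in column 2t + 1.
    set S := adj (J' K p) (J' K q) (eBlock K p q r) * eBlock K p q r with hS
    have hdag : dag (J' K q) S = S := dag_adj_mul hs1 hs _ _
    have hmem : eBlock K p q r * S ^ t.val ∈
        blockCentralizer (J' K p) (J' K q) (eBlock K p q r) :=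
      mul_mem_blockCentralizer hs ((dag_pow hs S _).trans (by rw [hdag])) ((Commute.refl S).pow_right _)
    refine ⟨((-1 : K) ^ r) ^ t.val • ⟨_, hmem⟩, ?_⟩
    rw [map_smul]
    ext u
    have := u.isLt
    have h1 : f ⟨_, hmem⟩ u = entryNat (eBlock K p q r * S ^ t.val) r (2 * u.val + 1) := rfl
    rw [Pi.smul_apply, h1, entryNat_of_lt _ (by omega) (by omega),
      eBlock_mul_apply _ _ _ ⟨1, by omega⟩ (by simp; omega), hS, adj_eBlock_mul_eBlock hp hr,
      smul_pow, ← pow_mul (eps K q q), eps_pow, Pi.basisFun_apply, Pi.single_apply, Matrix.smul_apply,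
      smul_smul, ← mul_pow, ← pow_add, (Even.add_self r).neg_one_pow, one_pow, one_smul,
      Matrix.of_apply]
    congr 1
    apply propext
    rw [Fin.ext_iff]
    simp only
    omega
  rw [(LinearEquiv.ofBijective f ⟨hinj, hsurj⟩).finrank_eq]
  simp

end NilpotentElement

/-! ### Commuting spaces of semisimple endomorphisms -/

section Generic

variable {F : Type*} [Field F] {V : Type*} [AddCommGroup V] [Module F V] [FiniteDimensional F V]

/-- An invariant complement of the kernel contains the image, since f only sees the component in the
complement. -/
theorem disjoint_ker_range_of_isSemisimple {f : Module.End F V} (hf : f.IsSemisimple) :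
    Disjoint (LinearMap.ker f) (LinearMap.range f) := by
  rw [Submodule.disjoint_def]
  rintro _ h ⟨v, rfl⟩
  rw [LinearMap.mem_ker] at h
  obtain ⟨W, hW, hc⟩ := Module.End.isSemisimple_iff.1 hf (LinearMap.ker f) (by
    intro v hv
    simp only [Submodule.mem_comap, LinearMap.mem_ker] at hv ⊢
    rw [hv, map_zero])
  obtain ⟨a, ha, b, hb, rfl⟩ := Submodule.mem_sup.1 (hc.sup_eq_top.ge (Submodule.mem_top (x := v)))
  rw [LinearMap.mem_ker] at ha
  rw [map_add, ha, zero_add] at h ⊢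
  exact (Submodule.disjoint_def.1 hc.disjoint) _ h (hW hb)

theorem ker_sup_range_of_isSemisimple {f : Module.End F V} (hf : f.IsSemisimple) :
    LinearMap.ker f ⊔ LinearMap.range f = ⊤ := by
  apply Submodule.eq_top_of_disjoint
  · rw [add_comm]; exact (LinearMap.finrank_range_add_finrank_ker f).ge
  · exact disjoint_ker_range_of_isSemisimple hf

/-- A commuting space of semisimple endomorphisms contains an element whose kernel is the common
kernel. -/
theorem exists_ker_le_of_isSemisimple [Infinite F] (T : Submodule F (Module.End F V))
    (hcomm : ∀ x ∈ T, ∀ y ∈ T, x * y = y * x) (hss : ∀ x ∈ T, x.IsSemisimple) :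
    ∃ x ∈ T, ∀ t ∈ T, LinearMap.ker x ≤ LinearMap.ker t := by
  -- The element with the smallest kernel works: otherwise a suitable x - μ⁻¹t would have a smaller
  -- one.
  obtain ⟨x, hx, hmin⟩ : ∃ x ∈ T, ∀ y ∈ T,
      Module.finrank F (LinearMap.ker x) ≤ Module.finrank F (LinearMap.ker y) := by
    obtain ⟨x, hx, h⟩ := (measure fun y : Module.End F V =>
      Module.finrank F (LinearMap.ker y)).wf.has_min (T : Set (Module.End F V)) ⟨0, T.zero_mem⟩
    exact ⟨x, hx, fun y hy => not_lt.1 (h y hy)⟩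
  refine ⟨x, hx, fun t ht => ?_⟩
  have hdis := Submodule.disjoint_def.1 (disjoint_ker_range_of_isSemisimple (hss x hx))
  have hxt : ∀ v, x (t v) = t (x v) := fun v => LinearMap.congr_fun (hcomm x hx t ht) v
  have hrx : ∀ v ∈ LinearMap.range x, x v ∈ LinearMap.range x := fun v _ => ⟨v, rfl⟩
  have hrt : ∀ v ∈ LinearMap.range x, t v ∈ LinearMap.range x := by
    rintro _ ⟨v, rfl⟩; exact ⟨t v, hxt v⟩
  have hinj : Function.Injective (x.restrict hrx) := by
    rw [← LinearMap.ker_eq_bot, LinearMap.ker_eq_bot']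
    rintro ⟨v, hv⟩ h
    rw [Subtype.ext_iff] at h ⊢
    exact hdis v h hv
  let e := LinearEquiv.ofInjectiveEndo _ hinj
  let u : Module.End F (LinearMap.range x) := e.symm.toLinearMap ∘ₗ t.restrict hrt
  -- Here u is x⁻¹t on the image of x. If μ is nonzero and not an eigenvalue of u, then x - μ⁻¹t is
  -- injective on that image, so its kernel is ker x ∩ ker t.
  obtain ⟨μ, hμ⟩ := ((Module.End.finite_hasEigenvalue u).union (Set.finite_singleton 0)).exists_notMem
  simp only [Set.mem_union, Set.mem_ofPred_eq, Set.mem_singleton_iff, not_or] at hμ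
  obtain ⟨hμ1, hμ0⟩ := hμ
  have hc0 : (-μ⁻¹) ≠ 0 := neg_ne_zero.2 (inv_ne_zero hμ0)
  have hker : ∀ v, v ∈ LinearMap.ker (x + (-μ⁻¹) • t) → x v = 0 ∧ t v = 0 := by
    intro v hv
    obtain ⟨a, ha, b, hb, rfl⟩ := Submodule.mem_sup.1
      ((ker_sup_range_of_isSemisimple (hss x hx)).ge (Submodule.mem_top (x := v)))
    rw [LinearMap.mem_ker] at ha
    simp only [LinearMap.mem_ker, LinearMap.add_apply, LinearMap.smul_apply, map_add, ha,
      zero_add] at hv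
    have h1 : x b + (-μ⁻¹) • t b ∈ LinearMap.range x :=
      Submodule.add_mem _ (hrx b hb) (Submodule.smul_mem _ _ (hrt b hb))
    have h2 : (-μ⁻¹) • t a ∈ LinearMap.ker x := by
      rw [LinearMap.mem_ker, map_smul, hxt, ha, map_zero, smul_zero]
    have h3 : x b + (-μ⁻¹) • t b = 0 := by
      refine hdis _ ?_ h1
      have : x b + (-μ⁻¹) • t b = -((-μ⁻¹) • t a) := by
        rw [eq_neg_iff_add_eq_zero, ← hv]; abel
      rw [this]; exact Submodule.neg_mem _ h2
    have hb0 : b = 0 := by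
      by_contra hb0
      apply hμ1
      refine Module.End.hasEigenvalue_of_hasEigenvector (x := ⟨b, hb⟩) ⟨?_, ?_⟩
      · rw [Module.End.mem_eigenspace_iff]
        change e.symm _ = _
        rw [LinearEquiv.symm_apply_eq]
        rw [Subtype.ext_iff]
        change t b = x (μ • b)
        rw [map_smul, eq_neg_of_add_eq_zero_left h3, smul_neg, neg_smul, smul_neg, neg_neg,
          smul_smul, mul_inv_cancel₀ hμ0, one_smul]
      · simpa [Subtype.ext_iff] using hb0
    subst hb0
    have : t a = 0 := by
      rw [map_zero t, map_zero x, smul_zero, add_zero, add_zero] at hv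
      exact (smul_eq_zero.1 hv).resolve_left hc0
    simp [ha, this]
  have hle : LinearMap.ker (x + (-μ⁻¹) • t) ≤ LinearMap.ker x := fun v hv => (hker v hv).1
  have heq := Submodule.eq_of_le_of_finrank_le hle
    (hmin _ (T.add_mem hx (T.smul_mem _ ht)))
  intro v hv
  rw [← heq] at hv
  exact (hker v hv).2

end Generic

/-! ### Semisimple matrices, commutators and the trace form -/

section MatrixSemisimple

variable {F : Type*} [Field F] {n : Type*} [Fintype n] [DecidableEq n]

/-- This form of semisimplicity passes along algebra homomorphisms, to blocks and to field
extensions. -/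
theorem isSemisimple_toLin'_iff {X : Matrix n n F} :
    Module.End.IsSemisimple (Matrix.toLin' X) ↔ ∃ f : Polynomial F, Squarefree f ∧ Polynomial.aeval X f = 0 := by
  have key : ∀ f : Polynomial F, Polynomial.aeval (Matrix.toLin' X) f
      = Matrix.toLin' (Polynomial.aeval X f) := by
    intro f
    exact Polynomial.aeval_algHom_apply (Matrix.toLinAlgEquiv' (R := F) (n := n)).toAlgHom X f
  constructor
  · intro h
    refine ⟨_, h.minpoly_squarefree, ?_⟩
    have := minpoly.aeval F (Matrix.toLin' X)
    rw [key] at this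
    exact (map_eq_zero_iff _ (Matrix.toLin').injective).1 this
  · rintro ⟨f, hf, h0⟩
    refine Module.End.isSemisimple_of_squarefree_aeval_eq_zero hf ?_
    rw [key, h0, map_zero]

/-- The commutator with a matrix. -/
def commL : Matrix n n F →ₗ[F] Module.End F (Matrix n n F) :=
  LinearMap.mul F _ - (LinearMap.mul F _).flip

theorem commL_apply (X Y : Matrix n n F) : commL X Y = X * Y - Y * X := rfl

/-- Left and right multiplication by X commute and are killed by the same squarefree polynomial as
X; over a perfect field their difference is again semisimple. -/
theorem isSemisimple_commL [PerfectField F] {X : Matrix n n F}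
    (hX : Module.End.IsSemisimple (Matrix.toLin' X)) : Module.End.IsSemisimple (commL X) := by
  obtain ⟨f, hf, h0⟩ := isSemisimple_toLin'_iff.1 hX
  have h1 : Module.End.IsSemisimple (LinearMap.mulLeft F X) := by
    refine Module.End.isSemisimple_of_squarefree_aeval_eq_zero hf ?_
    have := Polynomial.aeval_algHom_apply (Algebra.lmul F (Matrix n n F)) X f
    rw [h0, map_zero] at this
    exact this
  have h2 : Module.End.IsSemisimple (LinearMap.mulRight F X) := by
    refine Module.End.isSemisimple_of_squarefree_aeval_eq_zero hf ?_
    have : ∀ f : Polynomial F, Polynomial.aeval (LinearMap.mulRight F X) f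
        = LinearMap.mulRight F (Polynomial.aeval X f) := by
      intro f
      induction f using Polynomial.induction_on' with
      | add f g hf hg =>
        rw [map_add, map_add, hf, hg]
        ext1 Y
        simp [Matrix.mul_add]
      | monomial k a =>
        ext1 Y
        rw [Polynomial.aeval_monomial, Polynomial.aeval_monomial, LinearMap.pow_mulRight]
        simp [Algebra.algebraMap_eq_smul_one]
    rw [this, h0, LinearMap.mulRight_zero_eq_zero]
  exact h1.sub_of_commute (LinearMap.commute_mulLeft_right X X) h2

theorem trace_eq_zero_of_isNilpotent {N : Matrix n n F} (h : IsNilpotent N) : N.trace = 0 :=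
  (Matrix.isNilpotent_trace_of_isNilpotent h).eq_zero

/-- The trace form is nondegenerate on the centralizer of a semisimple matrix. -/
theorem eq_zero_of_trace_mul_eq_zero [PerfectField F] {X Z : Matrix n n F}
    (hX : Module.End.IsSemisimple (Matrix.toLin' X)) (hZ : X * Z = Z * X)
    (h : ∀ W, X * W = W * X → (Z * W).trace = 0) : Z = 0 := by
  have hall : ∀ W, (Z * W).trace = 0 := by
    intro W
    -- Split W into a part commuting with X and a commutator [X, U]; the trace of Z[X, U] vanishes
    -- because Z commutes with X.
    obtain ⟨a, ha, b, ⟨U, rfl⟩, rfl⟩ := Submodule.mem_sup.1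
      ((ker_sup_range_of_isSemisimple (isSemisimple_commL hX)).ge
        (Submodule.mem_top (x := W)))
    rw [LinearMap.mem_ker, commL_apply, sub_eq_zero] at ha
    rw [Matrix.mul_add, Matrix.trace_add, h a ha, commL_apply, Matrix.mul_sub, Matrix.trace_sub,
      ← Matrix.mul_assoc, ← hZ, ← Matrix.mul_assoc, Matrix.trace_mul_comm (Z * U) X,
      ← Matrix.mul_assoc]
    simp
  ext i j
  have := hall (Matrix.single j i 1)
  rwa [Matrix.trace_mul_single, MulOpposite.op_one, one_smul] at this

end MatrixSemisimple

/-! ### Jordan decomposition of matrices -/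

section Jordan

theorem commute_aeval {R A : Type*} [CommRing R] [Ring A] [Algebra R A] {x y : A}
    (h : x * y = y * x) (f : Polynomial R) :
    x * Polynomial.aeval y f = Polynomial.aeval y f * x := by
  induction f using Polynomial.induction_on' with
  | add f g hf hg => rw [map_add, mul_add, add_mul, hf, hg]
  | monomial k a =>
    rw [Polynomial.aeval_monomial, ← Algebra.smul_def, mul_smul_comm, smul_mul_assoc,
      (show Commute x y from h).pow_right k]

variable {F : Type*} [Field F] [PerfectField F] {n : Type*} [Fintype n] [DecidableEq n]

theorem exists_aeval_isSemisimple_isNilpotent (Y : Matrix n n F) :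
    ∃ f : Polynomial F, Module.End.IsSemisimple (Matrix.toLin' (Polynomial.aeval Y f)) ∧
      IsNilpotent (Y - Polynomial.aeval Y f) := by
  obtain ⟨m, hm, s, hs, hmn, hss, hY⟩ := 
    Module.End.exists_isNilpotent_isSemisimple (f := Matrix.toLin' Y)
  obtain ⟨f, rfl⟩ := (AlgHom.mem_range _).1 ((Algebra.adjoin_singleton_eq_range_aeval F _).le hs)
  have key : Polynomial.aeval (Matrix.toLin' Y) f = Matrix.toLin' (Polynomial.aeval Y f) :=
    Polynomial.aeval_algHom_apply (Matrix.toLinAlgEquiv' (R := F) (n := n)).toAlgHom Y f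
  rw [key] at hss hY
  refine ⟨f, hss, ?_⟩
  have h2 : Matrix.toLin' (Y - Polynomial.aeval Y f) = m := by
    rw [map_sub, hY, add_sub_cancel_right]
  obtain ⟨k, hk⟩ := hmn
  refine ⟨k, (Matrix.toLin').injective ?_⟩
  rw [map_zero, ← hk, ← h2]
  exact map_pow (Matrix.toLinAlgEquiv' (R := F) (n := n)) _ _

theorem isSemisimple_isNilpotent_unique {s s' m m' : Matrix n n F}
    (hs : Module.End.IsSemisimple (Matrix.toLin' s))
    (hs' : Module.End.IsSemisimple (Matrix.toLin' s')) (hm : IsNilpotent m)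
    (hm' : IsNilpotent m') (hc : m * s = s * m) (hc' : m' * s' = s' * m')
    (h : m + s = m' + s') : s = s' := by
  let φ := (Matrix.toLinAlgEquiv' (R := F) (n := n))
  have := Module.End.isNilpotent_isSemisimple_unique (n₁ := φ m) (s₁ := φ s)
    (n₂ := φ m') (s₂ := φ s') (hm.map φ) hs (hm'.map φ) hs'
    (by rw [Commute, SemiconjBy, ← map_mul, ← map_mul, hc])
    (by rw [Commute, SemiconjBy, ← map_mul, ← map_mul, hc'])
    (by rw [← map_add, ← map_add, h])
  exact φ.injective this.2

theorem isSemisimple_add {X Y : Matrix n n F} (hX : Module.End.IsSemisimple (Matrix.toLin' X))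
    (hY : Module.End.IsSemisimple (Matrix.toLin' Y)) (h : X * Y = Y * X) :
    Module.End.IsSemisimple (Matrix.toLin' (X + Y)) := by
  rw [map_add]
  refine hX.add_of_commute ?_ hY
  have := congrArg (Matrix.toLin') h
  rwa [Matrix.toLin'_mul, Matrix.toLin'_mul] at this

theorem isSemisimple_smul {X : Matrix n n F} (hX : Module.End.IsSemisimple (Matrix.toLin' X))
    (c : F) : Module.End.IsSemisimple (Matrix.toLin' (c • X)) := by
  rw [map_smul]
  exact Module.End.IsSemisimple_smul c hX

end Jordan

/-! ### Cartan subspaces are centralizers -/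

section Involutions

variable {F : Type*} [Field F] [CharZero F] {n : Type*} [Fintype n] [DecidableEq n]

/-- The `-1`-part for the commuting involutions `X ↦ I X I` and `dag J`. -/
structure IsMinus (I J X : Matrix n n F) : Prop where
  conj : I * X * I = -X
  dag : dag J X = -X

variable {I J : Matrix n n F}

theorem IsMinus.add {X Y : Matrix n n F} (hX : IsMinus I J X) (hY : IsMinus I J Y) :
    IsMinus I J (X + Y) where
  conj := by rw [Matrix.mul_add, Matrix.add_mul, hX.conj, hY.conj, neg_add]
  dag := by
    have := map_add (dagL J) X Y
    change SympSym.dag J (X + Y) = SympSym.dag J X + SympSym.dag J Y at this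
    rw [this, hX.dag, hY.dag, neg_add]

theorem IsMinus.smul {X : Matrix n n F} (hX : IsMinus I J X) (c : F) : IsMinus I J (c • X) where
  conj := by rw [Matrix.mul_smul, Matrix.smul_mul, hX.conj, smul_neg]
  dag := by
    have := map_smul (dagL J) c X
    change SympSym.dag J (c • X) = c • SympSym.dag J X at this
    rw [this, hX.dag, smul_neg]

theorem IsMinus.sub {X Y : Matrix n n F} (hX : IsMinus I J X) (hY : IsMinus I J Y) :
    IsMinus I J (X - Y) := by
  rw [sub_eq_add_neg, ← neg_one_smul F Y]
  exact hX.add (hY.smul _)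

theorem trace_dag (hJ : IsSympl J) (X : Matrix n n F) : (dag J X).trace = X.trace := by
  rw [dag, Matrix.trace_neg, Matrix.mul_assoc, Matrix.trace_mul_comm, Matrix.mul_assoc, hJ.mul_self]
  simp

/-- Conjugation by a matrix with square one. -/
def conjHom (hI : I * I = 1) : Matrix n n F →ₐ[F] Matrix n n F :=
  AlgHom.ofLinearMap
    { toFun X := I * X * I
      map_add' X Y := by rw [Matrix.mul_add, Matrix.add_mul]
      map_smul' c X := by simp }
    (by simpa using hI)
    (by
      intro X Y
      change I * (X * Y) * I = I * X * I * (I * Y * I)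
      calc I * (X * Y) * I = I * X * (1 * Y) * I := by
            rw [Matrix.one_mul]; simp only [Matrix.mul_assoc]
        _ = _ := by rw [← hI]; simp only [Matrix.mul_assoc])

theorem conjHom_apply (hI : I * I = 1) (X : Matrix n n F) : conjHom hI X = I * X * I := rfl

theorem dag_conj (hIt : Iᵀ = I) (hIJ : I * J = J * I) (X : Matrix n n F) :
    dag J (I * X * I) = I * dag J X * I := by
  simp only [dag, Matrix.transpose_mul, hIt, Matrix.mul_neg, Matrix.neg_mul, neg_inj]
  calc J * (I * (Xᵀ * I)) * J = (J * I) * Xᵀ * (I * J) := by simp only [Matrix.mul_assoc]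
    _ = (I * J) * Xᵀ * (J * I) := by rw [hIJ]
    _ = _ := by simp only [Matrix.mul_assoc]

/-- The trace form is nondegenerate on the centralizer of a semisimple element in the `-1`-part. -/
theorem eq_zero_of_trace_isMinus (hJ : IsSympl J) (hI : I * I = 1) (hIt : Iᵀ = I)
    (hIJ : I * J = J * I) {X Z : Matrix n n F} (hX : IsMinus I J X)
    (hXs : Module.End.IsSemisimple (Matrix.toLin' X)) (hZ : IsMinus I J Z)
    (hXZ : X * Z = Z * X)
    (h : ∀ W, IsMinus I J W → X * W = W * X → (Z * W).trace = 0) : Z = 0 := by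
  refine eq_zero_of_trace_mul_eq_zero hXs hXZ fun W hW => ?_
  have hII : ∀ U : Matrix n n F, I * (I * U * I) * I = U := by
    intro U
    calc I * (I * U * I) * I = (I * I) * U * (I * I) := by simp only [Matrix.mul_assoc]
      _ = U := by rw [hI, Matrix.one_mul, Matrix.mul_one]
  have hsub : ∀ U V : Matrix n n F, dag J (U - V) = dag J U - dag J V := map_sub (dagL J)
  -- averaging preserves the trace pairing with `Z`
  have t1 : ∀ U, (Z * (I * U * I)).trace = -(Z * U).trace := by
    intro U
    have : Z * (I * U * I) = conjHom hI (-Z * U) := by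
      rw [map_mul, conjHom_apply, conjHom_apply, Matrix.mul_neg, Matrix.neg_mul, hZ.conj, neg_neg]
    rw [this, conjHom_apply, Matrix.trace_mul_comm, ← Matrix.mul_assoc, hI, Matrix.one_mul,
      Matrix.neg_mul, Matrix.trace_neg]
  have t2 : ∀ U, (Z * dag J U).trace = -(Z * U).trace := by
    intro U
    have : Z * dag J U = dag J (U * -Z) := by
      have h3 : dag J (-Z) = Z := by
        have := map_neg (dagL J) Z
        change dag J (-Z) = -dag J Z at this
        rw [this, hZ.dag, neg_neg]
      rw [dag_mul hJ, h3]
    rw [this, trace_dag hJ, Matrix.trace_mul_comm, Matrix.neg_mul, Matrix.trace_neg]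
  have c1 : ∀ U, X * U = U * X → X * (I * U * I) = (I * U * I) * X := by
    intro U hU
    have := congrArg (conjHom hI) hU
    rw [map_mul, map_mul, conjHom_apply, conjHom_apply, hX.conj] at this
    simpa using this
  have c2 : ∀ U, X * U = U * X → X * dag J U = dag J U * X := by
    intro U hU
    have := congrArg (dag J) hU
    rw [dag_mul hJ, dag_mul hJ, hX.dag] at this
    simpa using this.symm
  -- Antisymmetrising under both involutions projects W to the -1-part, up to the factor 4 that
  -- appears below.
  set W' := W - I * W * I with hW'
  have e1 : I * W' * I = -W' := by
    rw [hW', Matrix.mul_sub, Matrix.sub_mul, hII, neg_sub]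
  have e2 : X * W' = W' * X := by
    rw [hW', Matrix.mul_sub, Matrix.sub_mul, c1 W hW, hW]
  have hmin : IsMinus I J (W' - dag J W') := by
    constructor
    · rw [Matrix.mul_sub, Matrix.sub_mul, e1, ← dag_conj hIt hIJ, e1]
      have := map_neg (dagL J) W'
      change dag J (-W') = -dag J W' at this
      rw [this]; abel
    · rw [hsub, dag_dag hJ, neg_sub]
  have h4 := h _ hmin (by rw [Matrix.mul_sub, Matrix.sub_mul, c2 W' e2, e2])
  rw [Matrix.mul_sub, Matrix.trace_sub, t2, hW', Matrix.mul_sub, Matrix.trace_sub, t1] at h4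
  have : (4 : F) * (Z * W).trace = 0 := by linear_combination h4
  exact (mul_eq_zero.1 this).resolve_left (by norm_num)

/-- Conjugating the Jordan decomposition of Y by I gives one of -Y, so uniqueness gives IsI = -s for
s = f(Y). The anti-automorphism needs no second appeal to uniqueness: it sends f(Y) to f(-Y) =
f(IYI) = I f(Y) I. -/
theorem IsMinus.semisimple_part (hJ : IsSympl J) (hI : I * I = 1) {Y : Matrix n n F}
    (hY : IsMinus I J Y) {f : Polynomial F}
    (hs : Module.End.IsSemisimple (Matrix.toLin' (Polynomial.aeval Y f)))
    (hn : IsNilpotent (Y - Polynomial.aeval Y f)) : IsMinus I J (Polynomial.aeval Y f) := by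
  have hc : Y * Polynomial.aeval Y f = Polynomial.aeval Y f * Y := by
    have := Polynomial.aeval_mul (p := Polynomial.X) (q := f) Y
    rw [mul_comm, Polynomial.aeval_mul, Polynomial.aeval_X] at this
    exact this.symm
  have key : conjHom hI (Polynomial.aeval Y f) = -Polynomial.aeval Y f := by
    obtain ⟨g, hg, hg0⟩ := isSemisimple_toLin'_iff.1 hs
    refine isSemisimple_isNilpotent_unique (m := conjHom hI (Y - Polynomial.aeval Y f))
      (m' := -(Y - Polynomial.aeval Y f)) ?_ ?_ (hn.map _) hn.neg ?_ ?_ ?_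
    · refine isSemisimple_toLin'_iff.2 ⟨g, hg, ?_⟩
      rw [Polynomial.aeval_algHom_apply, hg0, map_zero]
    · rw [map_neg]; exact Module.End.isSemisimple_neg.2 hs
    · rw [← map_mul, ← map_mul, Matrix.sub_mul, Matrix.mul_sub, hc]
    · rw [neg_mul_neg, neg_mul_neg, Matrix.sub_mul, Matrix.mul_sub, hc]
    · rw [map_sub, sub_add_cancel, conjHom_apply, hY.conj]; abel
  refine ⟨key, ?_⟩
  rw [dag_aeval hJ, hY.dag, ← key, ← Polynomial.aeval_algHom_apply, conjHom_apply, hY.conj]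

/-- In a maximal commutative space `T` of semisimple elements of the `-1`-part there is an element
whose centralizer in the `-1`-part is `T`. -/
theorem exists_isMinus_centralizer_eq (hJ : IsSympl J) (hI : I * I = 1) (hIt : Iᵀ = I)
    (hIJ : I * J = J * I) {T : Submodule F (Matrix n n F)}
    (hT : Maximal (fun S : Submodule F (Matrix n n F) => (∀ X ∈ S, IsMinus I J X) ∧
      (∀ X ∈ S, ∀ Y ∈ S, X * Y = Y * X) ∧
      ∀ X ∈ S, Module.End.IsSemisimple (Matrix.toLin' X)) T) :
    ∃ X ∈ T, ∀ Y, Y ∈ T ↔ IsMinus I J Y ∧ X * Y = Y * X := by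
  obtain ⟨⟨hT1, hT2, hT3⟩, hmax⟩ := hT
  obtain ⟨_, ⟨X, hX, rfl⟩, hXker⟩ := exists_ker_le_of_isSemisimple (T.map commL)
    (by
      rintro _ ⟨X, hX, rfl⟩ _ ⟨Y, hY, rfl⟩
      have h := hT2 X hX Y hY
      ext1 W
      simp only [Module.End.mul_apply, commL_apply, Matrix.mul_sub, Matrix.sub_mul]
      have e1 : X * (Y * W) = Y * (X * W) := by
        rw [← Matrix.mul_assoc, h, Matrix.mul_assoc]
      have e2 : W * Y * X = W * X * Y := by
        rw [Matrix.mul_assoc, ← h, ← Matrix.mul_assoc]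
      rw [e1, e2, ← Matrix.mul_assoc X W Y, ← Matrix.mul_assoc Y W X, Matrix.mul_assoc X W Y,
        Matrix.mul_assoc Y W X]
      abel)
    (by rintro _ ⟨X, hX, rfl⟩; exact isSemisimple_commL (hT3 X hX))
  have hcent : ∀ Y, X * Y = Y * X → ∀ t ∈ T, t * Y = Y * t := by
    intro Y hY t ht
    have := hXker _ ⟨t, ht, rfl⟩ (show Y ∈ LinearMap.ker (commL X) by
      rw [LinearMap.mem_ker, commL_apply, hY, sub_self])
    rwa [LinearMap.mem_ker, commL_apply, sub_eq_zero] at this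
  -- Such an s commutes with all of T, so T + Fs is admissible and maximality puts s in T.
  have hmem : ∀ s, IsMinus I J s → X * s = s * X →
      Module.End.IsSemisimple (Matrix.toLin' s) → s ∈ T := by
    intro s hs hXs hss
    have hc := hcent s hXs
    refine hmax (y := T ⊔ Submodule.span F {s}) ⟨?_, ?_, ?_⟩ le_sup_left
      (Submodule.mem_sup_right (Submodule.mem_span_singleton_self s))
    · intro Y hY
      obtain ⟨a, ha, b, hb, rfl⟩ := Submodule.mem_sup.1 hY
      obtain ⟨c, rfl⟩ := Submodule.mem_span_singleton.1 hb
      exact (hT1 a ha).add (hs.smul c)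
    · intro Y hY Z hZ
      obtain ⟨a, ha, b, hb, rfl⟩ := Submodule.mem_sup.1 hY
      obtain ⟨c, rfl⟩ := Submodule.mem_span_singleton.1 hb
      obtain ⟨a', ha', b', hb', rfl⟩ := Submodule.mem_sup.1 hZ
      obtain ⟨c', rfl⟩ := Submodule.mem_span_singleton.1 hb'
      simp only [Matrix.mul_add, Matrix.add_mul, Matrix.mul_smul, Matrix.smul_mul,
        hT2 a ha a' ha', hc a ha, hc a' ha']
      rw [smul_add, smul_add, smul_comm c c']; abel
    · intro Y hY
      obtain ⟨a, ha, b, hb, rfl⟩ := Submodule.mem_sup.1 hY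
      obtain ⟨c, rfl⟩ := Submodule.mem_span_singleton.1 hb
      exact isSemisimple_add (hT3 a ha) (isSemisimple_smul hss c)
        (by rw [Matrix.mul_smul, Matrix.smul_mul, hc a ha])
  have hdec : ∀ Y, IsMinus I J Y → X * Y = Y * X → ∃ s ∈ T, ∃ m, IsMinus I J m ∧
      X * m = m * X ∧ IsNilpotent m ∧ Y = s + m := by
    intro Y hY hXY
    obtain ⟨f, hs, hm⟩ := exists_aeval_isSemisimple_isNilpotent Y
    have h1 := hY.semisimple_part hJ hI hs hm
    have h2 : X * Polynomial.aeval Y f = Polynomial.aeval Y f * X :=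
      commute_aeval hXY f
    exact ⟨_, hmem _ h1 h2 hs, _, hY.sub h1, by
      rw [Matrix.mul_sub, Matrix.sub_mul, hXY, h2], hm, by abel⟩
  -- The product of commuting elements, one of them nilpotent, is nilpotent.
  have htn : ∀ t ∈ T, ∀ m, X * m = m * X → IsNilpotent m → (t * m).trace = 0 := by
    intro t ht m hXm hm
    exact trace_eq_zero_of_isNilpotent ((show Commute t m from hcent m hXm t ht).isNilpotent_mul_left hm)
  have hnondeg := fun Z => eq_zero_of_trace_isMinus (Z := Z) hJ hI hIt hIJ (hT1 X hX) (hT3 X hX)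
  have hnil : ∀ m, IsMinus I J m → X * m = m * X → IsNilpotent m → m = 0 := by
    intro m hm hXm hmn
    -- The semisimple part t of m + m' is orthogonal to the whole centralizer, hence zero. Thus m +
    -- m' is nilpotent, and polarising the trace of its square gives the claim.
    have htr : ∀ m', IsMinus I J m' → X * m' = m' * X → IsNilpotent m' →
        (m * m').trace = 0 := by
      intro m' hm' hXm' hmn'
      obtain ⟨t, ht, k, hk, hXk, hkn, hsum⟩ := hdec (m + m') (hm.add hm')
        (by rw [Matrix.mul_add, Matrix.add_mul, hXm, hXm'])
      have ht0 : t = 0 := by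
        refine hnondeg t (hT1 t ht) (hT2 X hX t ht) fun W hW hXW => ?_
        obtain ⟨u, hu, l, hl, hXl, hln, rfl⟩ := hdec W hW hXW
        have : t = m + m' - k := by rw [hsum, add_sub_cancel_right]
        rw [Matrix.mul_add, Matrix.trace_add, htn t ht l hXl hln, Matrix.trace_mul_comm, this,
          Matrix.mul_sub, Matrix.mul_add, Matrix.trace_sub, Matrix.trace_add, htn u hu m hXm hmn,
          htn u hu m' hXm' hmn', htn u hu k hXk hkn]
        simp
      rw [ht0, zero_add] at hsum
      have h2 : ((m + m') * (m + m')).trace = 0 := by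
        rw [hsum]
        exact trace_eq_zero_of_isNilpotent ((Commute.refl k).isNilpotent_mul_left hkn)
      have h3 := trace_eq_zero_of_isNilpotent ((Commute.refl m).isNilpotent_mul_left hmn)
      have h4 := trace_eq_zero_of_isNilpotent ((Commute.refl m').isNilpotent_mul_left hmn')
      rw [Matrix.mul_add, Matrix.add_mul, Matrix.add_mul, Matrix.trace_add, Matrix.trace_add,
        Matrix.trace_add, h3, h4, Matrix.trace_mul_comm m' m] at h2
      have : (2 : F) * (m * m').trace = 0 := by linear_combination h2
      exact (mul_eq_zero.1 this).resolve_left (by norm_num)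
    refine hnondeg m hm hXm fun W hW hXW => ?_
    obtain ⟨u, hu, l, hl, hXl, hln, rfl⟩ := hdec W hW hXW
    rw [Matrix.mul_add, Matrix.trace_add, htr l hl hXl hln, Matrix.trace_mul_comm,
      htn u hu m hXm hmn, add_zero]
  refine ⟨X, hX, fun Y => ⟨fun hY => ⟨hT1 Y hY, hT2 X hX Y hY⟩, fun ⟨hY, hXY⟩ => ?_⟩⟩
  obtain ⟨s, hs, m, hm, hXm, hmn, rfl⟩ := hdec Y hY hXY
  rw [hnil m hm hXm hmn, add_zero]
  exact hs

end Involutions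

/-! ### The symplectic form on vectors -/

section SymplecticForm

variable {K : Type*} [Field K] [CharZero K] {n : Type*} [Fintype n] [DecidableEq n]
  {J : Matrix n n K}

theorem IsSympl.dotProduct_swap (h : IsSympl J) (u v : n → K) :
    u ⬝ᵥ J *ᵥ v = -(v ⬝ᵥ J *ᵥ u) := by
  rw [Matrix.dotProduct_mulVec, ← Matrix.mulVec_transpose, h.transpose, Matrix.neg_mulVec,
    neg_dotProduct, dotProduct_comm]

theorem IsSympl.dotProduct_self (h : IsSympl J) (v : n → K) : v ⬝ᵥ J *ᵥ v = 0 :=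
  self_eq_neg.1 (h.dotProduct_swap v v)

theorem IsSympl.transpose_mul_of_dag_eq (h : IsSympl J) {S : Matrix n n K} (hS : dag J S = S) :
    Sᵀ * J = J * S := by
  conv_rhs => rw [← hS, dag, Matrix.mul_neg, Matrix.mul_assoc, ← Matrix.mul_assoc, h.mul_self]
  simp

theorem IsSympl.dotProduct_mulVec_of_dag_eq (h : IsSympl J) {S : Matrix n n K}
    (hS : dag J S = S) (u v : n → K) : (S *ᵥ u) ⬝ᵥ J *ᵥ v = u ⬝ᵥ J *ᵥ (S *ᵥ v) := by
  rw [Matrix.mulVec_mulVec, ← h.transpose_mul_of_dag_eq hS, ← Matrix.mulVec_mulVec,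
    Matrix.dotProduct_mulVec u, Matrix.vecMul_transpose]

theorem IsSympl.mulVec_eq_zero (h : IsSympl J) {v : n → K} (hv : J *ᵥ v = 0) : v = 0 := by
  have : (J * J) *ᵥ v = 0 := by rw [← Matrix.mulVec_mulVec, hv, Matrix.mulVec_zero]
  rw [h.mul_self, Matrix.neg_mulVec, Matrix.one_mulVec] at this
  exact neg_eq_zero.1 this

theorem exists_smul_of_vecMulVec_eq {v w : n → K} (hv : v ≠ 0)
    (h : Matrix.vecMulVec v w = Matrix.vecMulVec w v) : ∃ c : K, w = c • v := by
  obtain ⟨i, hi⟩ := Function.ne_iff.1 hv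
  refine ⟨w i / v i, ?_⟩
  ext j
  have := congrFun (congrFun h i) j
  simp only [Matrix.vecMulVec_apply] at this
  rw [Pi.smul_apply, smul_eq_mul, div_mul_eq_mul_div, eq_div_iff hi, ← this, mul_comm]

end SymplecticForm

/-! ### Centralizers consisting of semisimple elements -/

section SplitCount

variable {K : Type*} [Field K] [CharZero K] {m n : Type*} [Fintype m] [DecidableEq m]
  [Fintype n] [DecidableEq n] {J₁ : Matrix m m K} {J₂ : Matrix n n K} {A : Matrix m n K}

theorem eq_zero_of_isNilpotent_offDiag {C : Matrix m n K}
    (hs : Module.End.IsSemisimple (Matrix.toLin' (offDiag J₁ J₂ C)))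
    (hn : IsNilpotent (offDiag J₁ J₂ C)) : C = 0 := by
  have h1 : IsNilpotent (Matrix.toLin' (offDiag J₁ J₂ C)) :=
    hn.map (Matrix.toLinAlgEquiv' (R := K) (n := m ⊕ n))
  have h2 := Module.End.eq_zero_of_isNilpotent_isSemisimple h1 hs
  have h3 : offDiagL J₁ J₂ C = 0 := (Matrix.toLin').injective (by rw [map_zero]; exact h2)
  exact offDiagL_injective (by rw [h3, map_zero])

/-- If Av = 0 with v ≠ 0, a rank count gives w ≠ 0 with A*w = 0. The rank-one block C = w vᵗ J₂ then
lies in the centralizer, and X_C squares to zero because both forms are alternating; semisimplicity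
forces C = 0. -/
theorem mulVec_injective_of_semisimple_centralizer (h₁ : IsSympl J₁) (h₂ : IsSympl J₂)
    (hcard : Fintype.card n ≤ Fintype.card m)
    (hss : ∀ C ∈ blockCentralizer J₁ J₂ A,
      Module.End.IsSemisimple (Matrix.toLin' (offDiag J₁ J₂ C)))
    {v : n → K} (hv : A *ᵥ v = 0) : v = 0 := by
  by_contra hv0
  have hr1 : A.rank < Fintype.card n := by
    have h := LinearMap.finrank_range_add_finrank_ker A.mulVecLin
    have h2 : 0 < Module.finrank K (LinearMap.ker A.mulVecLin) := by
      rw [Module.finrank_pos_iff, Submodule.nontrivial_iff_ne_bot, Submodule.ne_bot_iff]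
      exact ⟨v, hv, hv0⟩
    rw [Module.finrank_fintype_fun_eq_card] at h
    change Module.finrank K (LinearMap.range A.mulVecLin) < _
    omega
  have hr2 : (adj J₁ J₂ A).rank < Fintype.card m :=
    calc (adj J₁ J₂ A).rank ≤ (J₂ * Aᵀ).rank := Matrix.rank_mul_le_left _ _
      _ ≤ Aᵀ.rank := Matrix.rank_mul_le_right _ _
      _ = A.rank := Matrix.rank_transpose _
      _ < _ := hr1.trans_le hcard
  obtain ⟨w, hw, hw0⟩ : ∃ w, adj J₁ J₂ A *ᵥ w = 0 ∧ w ≠ 0 := by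
    have h := LinearMap.finrank_range_add_finrank_ker (adj J₁ J₂ A).mulVecLin
    rw [Module.finrank_fintype_fun_eq_card] at h
    change (adj J₁ J₂ A).rank + _ = _ at h
    have h2 : 0 < Module.finrank K (LinearMap.ker (adj J₁ J₂ A).mulVecLin) := by omega
    rw [Module.finrank_pos_iff, Submodule.nontrivial_iff_ne_bot, Submodule.ne_bot_iff] at h2
    exact h2
  set C := Matrix.vecMulVec w v * J₂ with hC
  have hadj : adj J₁ J₂ C = Matrix.vecMulVec v w * J₁ := by
    rw [adj, hC, Matrix.transpose_mul, Matrix.transpose_vecMulVec, ← Matrix.mul_assoc,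
      h₂.mul_transpose, Matrix.one_mul]
  have hw' : Aᵀ *ᵥ (J₁ *ᵥ w) = 0 := by
    apply h₂.mulVec_eq_zero
    rw [Matrix.mulVec_mulVec, Matrix.mulVec_mulVec]
    exact hw
  have hwA : (w ᵥ* J₁) ᵥ* A = 0 := by
    rw [← Matrix.mulVec_transpose, ← Matrix.mulVec_transpose, h₁.transpose, Matrix.neg_mulVec,
      Matrix.mulVec_neg, hw', neg_zero]
  have hmem : C ∈ blockCentralizer J₁ J₂ A := by
    rw [mem_blockCentralizer, hadj, hC]
    constructor
    · rw [← Matrix.mul_assoc, Matrix.mul_vecMulVec, hv, adj, Matrix.mul_assoc _ J₂,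
        ← Matrix.mul_assoc J₂, ← Matrix.mul_assoc J₂, h₂.mul_self, Matrix.neg_mul, Matrix.neg_mul,
        Matrix.one_mul, Matrix.mul_neg, ← Matrix.mul_assoc,
        Matrix.vecMulVec_mul w v Aᵀ, Matrix.vecMul_transpose, hv]
      simp
    · rw [← Matrix.mul_assoc, Matrix.mul_vecMulVec, hw, Matrix.vecMulVec_mul v w,
        Matrix.vecMulVec_mul v, hwA]
      simp
  have hC0 : C = 0 := by
    refine eq_zero_of_isNilpotent_offDiag (hss C hmem) ⟨2, ?_⟩
    have e1 : (v ᵥ* J₂) ⬝ᵥ v = 0 := by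
      rw [← Matrix.dotProduct_mulVec]; exact h₂.dotProduct_self v
    have e2 : (w ᵥ* J₁) ⬝ᵥ w = 0 := by
      rw [← Matrix.dotProduct_mulVec]; exact h₁.dotProduct_self w
    rw [pow_two, offDiag_mul_offDiag, hadj, hC, Matrix.vecMulVec_mul w v, Matrix.vecMulVec_mul v w,
      Matrix.vecMulVec_mul_vecMulVec, Matrix.vecMulVec_mul_vecMulVec, e1, e2]
    simp
  have : Matrix.vecMulVec w v = 0 := by
    have h := congrArg (· * J₂ᵀ) hC0
    simp only [hC, Matrix.zero_mul, Matrix.mul_assoc, h₂.mul_transpose, Matrix.mul_one] at h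
    exact h
  obtain ⟨i, hi⟩ := Function.ne_iff.1 hw0
  apply hv0
  ext j
  exact (mul_eq_zero.1 (congrFun (congrFun this i) j)).resolve_left hi

/-- For orthogonal v, w in one eigenspace of S, the matrix R = (v wᵗ - w vᵗ)J₂ is self-adjoint,
commutes with S and squares to zero. So AR gives a nilpotent element of the centralizer, which must
vanish; as A is injective, v wᵗ = w vᵗ. -/
theorem exists_smul_of_isotropic (h₁ : IsSympl J₁) (h₂ : IsSympl J₂)
    (hss : ∀ C ∈ blockCentralizer J₁ J₂ A,
      Module.End.IsSemisimple (Matrix.toLin' (offDiag J₁ J₂ C)))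
    (hA : ∀ v, A *ᵥ v = 0 → v = 0) {μ : K} {v w : n → K}
    (hv : (adj J₁ J₂ A * A) *ᵥ v = μ • v) (hw : (adj J₁ J₂ A * A) *ᵥ w = μ • w)
    (hvw : v ⬝ᵥ J₂ *ᵥ w = 0) (hv0 : v ≠ 0) : ∃ c : K, w = c • v := by
  set S := adj J₁ J₂ A * A with hS
  have hdag : dag J₂ S = S := dag_adj_mul h₁ h₂ _ _
  set R := (Matrix.vecMulVec v w - Matrix.vecMulVec w v) * J₂ with hR
  have hRdag : dag J₂ R = R := by
    rw [dag, hR, Matrix.transpose_mul, Matrix.transpose_sub, Matrix.transpose_vecMulVec,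
      Matrix.transpose_vecMulVec, ← Matrix.mul_assoc, h₂.mul_transpose, Matrix.one_mul,
      ← Matrix.neg_mul, neg_sub]
  have hx : ∀ x, S *ᵥ x = μ • x → (x ᵥ* J₂) ᵥ* S = μ • (x ᵥ* J₂) := by
    intro x hx
    rw [Matrix.vecMul_vecMul, ← h₂.transpose_mul_of_dag_eq hdag, ← Matrix.vecMul_vecMul,
      Matrix.vecMul_transpose, hx, Matrix.smul_vecMul]
  have hcomm : Commute S R := by
    rw [Commute, SemiconjBy, hR, Matrix.sub_mul, Matrix.mul_sub, Matrix.sub_mul,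
      Matrix.vecMulVec_mul, Matrix.vecMulVec_mul, Matrix.mul_vecMulVec, Matrix.mul_vecMulVec,
      Matrix.vecMulVec_mul, Matrix.vecMulVec_mul, hx v hv, hx w hw, hv, hw]
    simp only [Matrix.smul_vecMulVec, Matrix.vecMulVec_smul]
  have e0 : ∀ x : n → K, (x ᵥ* J₂) ⬝ᵥ x = 0 := fun x => by
    rw [← Matrix.dotProduct_mulVec]; exact h₂.dotProduct_self x
  have e1 : (v ᵥ* J₂) ⬝ᵥ w = 0 := by rw [← Matrix.dotProduct_mulVec]; exact hvw
  have e2 : (w ᵥ* J₂) ⬝ᵥ v = 0 := by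
    rw [← Matrix.dotProduct_mulVec, h₂.dotProduct_swap, hvw, neg_zero]
  have hRR : R * R = 0 := by
    rw [hR, Matrix.sub_mul, Matrix.vecMulVec_mul, Matrix.vecMulVec_mul, Matrix.sub_mul,
      Matrix.mul_sub, Matrix.mul_sub, Matrix.vecMulVec_mul_vecMulVec,
      Matrix.vecMulVec_mul_vecMulVec, Matrix.vecMulVec_mul_vecMulVec,
      Matrix.vecMulVec_mul_vecMulVec, e0, e0, e1, e2]
    simp
  have hmem := mul_mem_blockCentralizer (J₁ := J₁) h₂ hRdag hcomm
  have hAR : A * R = 0 := by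
    refine eq_zero_of_isNilpotent_offDiag (hss _ hmem) ⟨2, ?_⟩
    rw [pow_two, offDiag_mul_offDiag, adj_mul_right h₂, hRdag]
    have f1 : A * R * (R * adj J₁ J₂ A) = 0 := by
      rw [Matrix.mul_assoc, ← Matrix.mul_assoc R, hRR]; simp
    have f2 : R * adj J₁ J₂ A * (A * R) = 0 := by
      rw [Matrix.mul_assoc, ← Matrix.mul_assoc _ A, ← hS, hcomm.eq, ← Matrix.mul_assoc, hRR,
        Matrix.zero_mul]
    rw [f1, f2, Matrix.fromBlocks_zero]
  have hR0 : R = 0 := by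
    apply Matrix.ext_of_mulVec_single
    intro j
    rw [Matrix.zero_mulVec]
    apply hA
    rw [Matrix.mulVec_mulVec, hAR, Matrix.zero_mulVec]
  refine exists_smul_of_vecMulVec_eq hv0 ?_
  have h := congrArg (· * J₂ᵀ) hR0
  simp only [hR, Matrix.zero_mul, Matrix.mul_assoc, h₂.mul_transpose, Matrix.mul_one] at h
  exact sub_eq_zero.1 h

/-- If all elements of `𝔤(-1)` commuting with `offDiag A` are semisimple, then their space has
dimension `n / 2`. -/
theorem finrank_blockCentralizer_of_semisimple [IsAlgClosed K] (h₁ : IsSympl J₁) (h₂ : IsSympl J₂)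
    (hcard : Fintype.card n ≤ Fintype.card m)
    (hss : ∀ C ∈ blockCentralizer J₁ J₂ A,
      Module.End.IsSemisimple (Matrix.toLin' (offDiag J₁ J₂ C))) :
    Module.finrank K (blockCentralizer J₁ J₂ A) = Fintype.card n / 2 := by
  classical
  have hA : ∀ v, A *ᵥ v = 0 → v = 0 :=
    fun v => mulVec_injective_of_semisimple_centralizer h₁ h₂ hcard hss
  have hiso := fun {μ : K} {v w : n → K} =>
    exists_smul_of_isotropic (μ := μ) (v := v) (w := w) h₁ h₂ hss hA
  have hAmem : A ∈ blockCentralizer J₁ J₂ A := ⟨rfl, rfl⟩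
  set S := adj J₁ J₂ A * A with hS
  have hdag : dag J₂ S = S := dag_adj_mul h₁ h₂ _ _
  have hXX : offDiag J₁ J₂ A * offDiag J₁ J₂ A =
      Matrix.fromBlocks (A * adj J₁ J₂ A) 0 0 S := offDiag_mul_offDiag A A
  have hXs := hss A hAmem
  -- If Sv = 0, then X_A(0, v) lies in both kernel and image of the semisimple X_A, so it vanishes
  -- and Av = 0.
  have hSinj : ∀ v, S *ᵥ v = 0 → v = 0 := by
    intro v hv
    have hd := Submodule.disjoint_def.1 (disjoint_ker_range_of_isSemisimple hXs)
    have h0 := hd (offDiag J₁ J₂ A *ᵥ Sum.elim 0 v) (by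
      rw [LinearMap.mem_ker, Matrix.toLin'_apply, Matrix.mulVec_mulVec, hXX,
        Matrix.fromBlocks_mulVec]
      ext (i | i)
      · simp
      · simp [hv]) ⟨_, Matrix.toLin'_apply _ _⟩
    apply hA
    ext i
    have := congrFun h0 (Sum.inl i)
    simpa [offDiag, Matrix.fromBlocks_mulVec] using this
  have hSs : Module.End.IsSemisimple (Matrix.toLin' S) := by
    have h2 : Module.End.IsSemisimple
        (Matrix.toLin' (offDiag J₁ J₂ A * offDiag J₁ J₂ A)) := by
      rw [Matrix.toLin'_mul]
      exact hXs.mul_of_commute (Commute.refl _) hXs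
    obtain ⟨f, hf, hf0⟩ := isSemisimple_toLin'_iff.1 h2
    refine isSemisimple_toLin'_iff.2 ⟨f, hf, ?_⟩
    rw [hXX] at hf0
    have : ∀ g : Polynomial K, Polynomial.aeval (Matrix.fromBlocks (A * adj J₁ J₂ A) 0 0 S) g =
        Matrix.fromBlocks (Polynomial.aeval (A * adj J₁ J₂ A) g) 0 0 (Polynomial.aeval S g) := by
      intro g
      induction g using Polynomial.induction_on' with
      | add f g hf hg => rw [map_add, map_add, map_add, hf, hg, Matrix.fromBlocks_add]; simp
      | monomial k a =>
        have hpow : ∀ (U : Matrix m m K) (W : Matrix n n K) k,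
            (Matrix.fromBlocks U 0 0 W) ^ k = Matrix.fromBlocks (U ^ k) 0 0 (W ^ k) := by
          intro U W k
          induction k with
          | zero => simp
          | succ k ih => rw [pow_succ, ih, Matrix.fromBlocks_multiply]; simp [pow_succ]
        simp only [Polynomial.aeval_monomial, ← Algebra.smul_def, hpow, Matrix.fromBlocks_smul,
          smul_zero]
    rw [this, ← Matrix.fromBlocks_zero, Matrix.fromBlocks_inj] at hf0
    exact hf0.2.2.2
  let f : Module.End K (n → K) := Matrix.toLin' S
  have hmem : ∀ {μ : K} {v}, v ∈ f.eigenspace μ ↔ S *ᵥ v = μ • v := by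
    intro μ v
    rw [Module.End.mem_eigenspace_iff]; rfl
  have htop : ⨆ μ, f.eigenspace μ = ⊤ :=
    (hSs.isFinitelySemisimple.iSup_maxGenEigenspace_eq_top_iff).1
      (Module.End.iSup_maxGenEigenspace_eq_top f)
  have hext : ∀ g : (n → K) →ₗ[K] K, (∀ (μ : K) v, S *ᵥ v = μ • v → g v = 0) → g = 0 := by
    intro g hg
    rw [← LinearMap.ker_eq_top, eq_top_iff, ← htop]
    exact iSup_le fun μ v hv => hg μ v (hmem.1 hv)
  -- Distinct eigenspaces of the self-adjoint S are orthogonal, so the form stays nondegenerate on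
  -- each one.
  have hpair : ∀ {μ : K} {v : n → K}, v ≠ 0 → S *ᵥ v = μ • v →
      ∃ u, S *ᵥ u = μ • u ∧ v ⬝ᵥ J₂ *ᵥ u ≠ 0 := by
    intro μ v hv0 hv
    by_contra hcon
    push Not at hcon
    apply hv0
    apply h₂.mulVec_eq_zero
    have hz : ∀ u, v ⬝ᵥ J₂ *ᵥ u = 0 := by
      let g : (n → K) →ₗ[K] K :=
        { toFun u := v ⬝ᵥ J₂ *ᵥ u
          map_add' u w := by rw [Matrix.mulVec_add, dotProduct_add]
          map_smul' c u := by rw [Matrix.mulVec_smul, dotProduct_smul]; rfl }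
      have hg : g = 0 := by
        refine hext g fun ν u hu => ?_
        change v ⬝ᵥ J₂ *ᵥ u = 0
        by_cases hνμ : ν = μ
        · subst hνμ; exact hcon u hu
        have h3 := h₂.dotProduct_mulVec_of_dag_eq hdag v u
        rw [hv, hu, Matrix.mulVec_smul, smul_dotProduct, dotProduct_smul, smul_eq_mul,
          smul_eq_mul, ← sub_eq_zero, ← sub_mul] at h3
        exact (mul_eq_zero.1 h3).resolve_left (sub_ne_zero.2 (Ne.symm hνμ))
      intro u
      exact LinearMap.congr_fun hg u
    ext i
    have := hz (Pi.single i 1)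
    rw [h₂.dotProduct_swap, neg_eq_zero] at this
    simpa using this
  -- Take v, u in the eigenspace with nonzero pairing. Subtracting a multiple of u makes any w
  -- orthogonal to v, hence a multiple of v.
  have hdim : ∀ μ : f.Eigenvalues, Module.finrank K (f.eigenspace μ) = 2 := by
    rintro ⟨μ, hμ⟩
    obtain ⟨v, hv, hv0⟩ := Module.End.HasEigenvalue.exists_hasEigenvector (f := f) (μ := μ) hμ
    rw [hmem] at hv
    obtain ⟨u, hu, hvu⟩ := hpair hv0 hv
    have hli : LinearIndependent K ![v, u] := by
      rw [LinearIndependent.pair_iff]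
      intro s t hst
      have ht : t = 0 := by
        have h4 : v ⬝ᵥ J₂ *ᵥ (s • v + t • u) = 0 := by rw [hst]; simp
        rw [Matrix.mulVec_add, dotProduct_add, Matrix.mulVec_smul, Matrix.mulVec_smul,
          dotProduct_smul, dotProduct_smul, h₂.dotProduct_self, smul_zero, zero_add,
          smul_eq_mul] at h4
        exact (mul_eq_zero.1 h4).resolve_right hvu
      rw [ht, zero_smul, add_zero] at hst
      exact ⟨(smul_eq_zero.1 hst).resolve_right hv0, ht⟩
    have hspan : f.eigenspace μ = Submodule.span K (Set.range ![v, u]) := by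
      apply le_antisymm
      · intro w hw
        rw [hmem] at hw
        set c := (v ⬝ᵥ J₂ *ᵥ w) / (v ⬝ᵥ J₂ *ᵥ u)
        obtain ⟨d, hd⟩ := hiso hv (w := w - c • u)
          (by rw [Matrix.mulVec_sub, Matrix.mulVec_smul, hw, hu, smul_sub, smul_comm])
          (by
            rw [Matrix.mulVec_sub, dotProduct_sub, Matrix.mulVec_smul, dotProduct_smul,
              smul_eq_mul, div_mul_cancel₀ _ hvu, sub_self]) hv0
        rw [Matrix.range_cons, Matrix.range_cons, Matrix.range_empty, Set.union_empty]
        have : w = d • v + c • u := by rw [← hd]; abel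
        rw [this]
        exact Submodule.add_mem _
          (Submodule.smul_mem _ _ (Submodule.subset_span (Or.inl rfl)))
          (Submodule.smul_mem _ _ (Submodule.subset_span (Or.inr rfl)))
      · rw [Submodule.span_le, Matrix.range_cons, Matrix.range_cons, Matrix.range_empty,
          Set.union_empty]
        rintro _ (rfl | rfl)
        · exact hmem.2 hv
        · exact hmem.2 hu
    change Module.finrank K (f.eigenspace μ) = 2
    rw [hspan, finrank_span_eq_card hli, Fintype.card_fin]
  have hcount : Fintype.card f.Eigenvalues * 2 = Fintype.card n := by
    have hint : DirectSum.IsInternal (fun μ : f.Eigenvalues => f.eigenspace μ) := by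
      refine DirectSum.isInternal_submodule_of_iSupIndep_of_iSup_eq_top
        (f.eigenspaces_iSupIndep.comp Subtype.val_injective) ?_
      rw [eq_top_iff, ← htop]
      refine iSup_le fun μ => ?_
      by_cases hμ : f.HasEigenvalue μ
      · exact le_iSup (fun μ : f.Eigenvalues => f.eigenspace μ) ⟨μ, hμ⟩
      · have hμ' : f.eigenspace μ = ⊥ := not_not.1 hμ
        rw [hμ']; exact bot_le
    let b := hint.collectedBasis (fun μ => Module.finBasisOfFinrankEq K _ (hdim μ))
    have := Module.finrank_eq_card_basis b
    rw [Module.finrank_fintype_fun_eq_card, Fintype.card_sigma] at this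
    simpa using this.symm
  have hhalf : Fintype.card n / 2 = Fintype.card f.Eigenvalues := by omega
  -- the finite set of eigenvalues
  let M : Finset K := Finset.univ.image (fun μ : f.Eigenvalues => (μ : K))
  have hMcard : M.card = Fintype.card f.Eigenvalues :=
    Finset.card_image_of_injective _ Subtype.val_injective
  have hM : ∀ {μ : K} {v : n → K}, v ≠ 0 → S *ᵥ v = μ • v → μ ∈ M := by
    intro μ v hv0 hv
    refine Finset.mem_image.2 ⟨⟨μ, Module.End.hasEigenvalue_of_hasEigenvector ⟨hmem.2 hv, hv0⟩⟩,
      Finset.mem_univ _, rfl⟩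
  have hM' : ∀ μ ∈ M, ∃ v : n → K, v ≠ 0 ∧ S *ᵥ v = μ • v := by
    intro μ hμ
    obtain ⟨⟨ν, hν⟩, -, rfl⟩ := Finset.mem_image.1 hμ
    obtain ⟨v, hv, hv0⟩ := Module.End.HasEigenvalue.exists_hasEigenvector (f := f) (μ := ν) hν
    exact ⟨v, hv0, hmem.1 hv⟩
  have haeval : ∀ (g : Polynomial K) {μ : K} {v : n → K}, S *ᵥ v = μ • v →
      Matrix.mulVec (Polynomial.aeval S g) v = Polynomial.eval μ g • v := by
    intro g μ v hv
    induction g using Polynomial.induction_on' with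
    | add f g hf hg => rw [map_add, Matrix.add_mulVec, hf, hg, Polynomial.eval_add, add_smul]
    | monomial k a =>
      have hk : ∀ k, (S ^ k) *ᵥ v = (μ ^ k) • v := by
        intro k
        induction k with
        | zero => simp
        | succ k ih => rw [pow_succ, ← Matrix.mulVec_mulVec, hv, Matrix.mulVec_smul, ih, smul_smul,
            pow_succ, mul_comm]
      rw [Polynomial.aeval_monomial, ← Algebra.smul_def, Matrix.smul_mulVec, hk,
        Polynomial.eval_monomial, smul_smul]
  -- The centralizer is parametrised by g ↦ A g(S), with deg g less than the number of eigenvalues.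
  let Φ : Polynomial.degreeLT K M.card →ₗ[K] blockCentralizer J₁ J₂ A :=
    { toFun g := ⟨A * Polynomial.aeval S (g : Polynomial K),
        mul_mem_blockCentralizer h₂ (by rw [dag_aeval h₂, hdag])
          (commute_aeval rfl (g : Polynomial K))⟩
      map_add' g h := by
        ext1; simp [Matrix.mul_add]
      map_smul' c g := by
        ext1; simp }
  have hΦinj : Function.Injective Φ := by
    rw [← LinearMap.ker_eq_bot, LinearMap.ker_eq_bot']
    rintro ⟨g, hg⟩ h
    have h' : A * Polynomial.aeval S g = 0 := congrArg Subtype.val h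
    rw [Subtype.ext_iff]
    refine Polynomial.eq_zero_of_degree_lt_of_eval_finset_eq_zero M
      (Polynomial.mem_degreeLT.1 hg) fun μ hμ => ?_
    obtain ⟨v, hv0, hv⟩ := hM' μ hμ
    have h5 : Polynomial.aeval S g *ᵥ v = 0 := by
      apply hA
      rw [Matrix.mulVec_mulVec, h', Matrix.zero_mulVec]
    rw [haeval g hv] at h5
    exact (smul_eq_zero.1 h5).resolve_right hv0
  have hΦsurj : Function.Surjective Φ := by
    rintro ⟨C, hC⟩
    have hRdag : dag J₂ (adj J₁ J₂ A * C) = adj J₁ J₂ A * C := by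
      rw [dag_adj_mul h₁ h₂, hC.2]
    have hRS : S * (adj J₁ J₂ A * C) = (adj J₁ J₂ A * C) * S := by
      rw [hS]
      calc adj J₁ J₂ A * A * (adj J₁ J₂ A * C)
          = adj J₁ J₂ A * (A * adj J₁ J₂ C) * A := by
            rw [hC.2]; simp only [Matrix.mul_assoc]
        _ = _ := by rw [hC.1]; simp only [Matrix.mul_assoc]
    -- With R = A*C self-adjoint, v pairs to zero with Rv; both lie in the same eigenspace of S, so
    -- Rv is a multiple of v. Every eigenvector of S being one of R, R is scalar on each eigenspace.
    have hRv : ∀ {μ : K} {v : n → K}, v ≠ 0 → S *ᵥ v = μ • v →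
        ∃ c : K, (adj J₁ J₂ A * C) *ᵥ v = c • v := by
      intro μ v hv0 hv
      refine hiso hv (w := (adj J₁ J₂ A * C) *ᵥ v) ?_ ?_ hv0
      · rw [Matrix.mulVec_mulVec, hRS, ← Matrix.mulVec_mulVec, hv, Matrix.mulVec_smul]
      · have h6 := h₂.dotProduct_mulVec_of_dag_eq hRdag v v
        rw [h₂.dotProduct_swap, neg_eq_iff_add_eq_zero, ← two_mul] at h6
        exact (mul_eq_zero.1 h6).resolve_left two_ne_zero
    have hscal : ∀ μ : K, ∃ c : K, ∀ v, S *ᵥ v = μ • v → (adj J₁ J₂ A * C) *ᵥ v = c • v := by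
      intro μ
      by_cases hex : ∃ v : n → K, v ≠ 0 ∧ S *ᵥ v = μ • v
      · obtain ⟨v, hv0, hv⟩ := hex
        obtain ⟨c, hc⟩ := hRv hv0 hv
        refine ⟨c, fun w hw => ?_⟩
        by_cases hwv : ∃ d : K, w = d • v
        · obtain ⟨d, rfl⟩ := hwv
          rw [Matrix.mulVec_smul, hc, smul_comm]
        have hw0 : w ≠ 0 := by
          rintro rfl; exact hwv ⟨0, by simp⟩
        have hvw0 : v + w ≠ 0 := by
          intro h; exact hwv ⟨-1, by rw [neg_one_smul]; exact eq_neg_of_add_eq_zero_right h⟩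
        obtain ⟨d, hd⟩ := hRv hw0 hw
        obtain ⟨e, he⟩ := hRv hvw0 (μ := μ) (by rw [Matrix.mulVec_add, hv, hw, smul_add])
        rw [Matrix.mulVec_add, hc, hd] at he
        have hde : d = e := by
          by_contra hne
          apply hwv
          refine ⟨(d - e)⁻¹ * (e - c), ?_⟩
          rw [mul_smul, eq_inv_smul_iff₀ (sub_ne_zero.2 hne)]
          rw [sub_smul, sub_smul, sub_eq_sub_iff_add_eq_add, add_comm, he, smul_add]
        subst hde
        have hce : c = d := by
          rw [smul_add, add_left_inj, ← sub_eq_zero, ← sub_smul] at he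
          exact sub_eq_zero.1 ((smul_eq_zero.1 he).resolve_right hv0)
        rw [hd, hce]
      · push Not at hex
        refine ⟨0, fun v hv => ?_⟩
        by_cases hv0 : v = 0
        · simp [hv0]
        · exact absurd hv (hex v hv0)
    choose c hc using hscal
    -- On the μ-eigenspace, c(μ) A v = AA*C v = CA*A v = μ C v, so C agrees there with (c(μ)/μ) A.
    let g := Lagrange.interpolate M id (fun μ => c μ / μ)
    have hgdeg : g.degree < M.card := Lagrange.degree_interpolate_lt _ (Set.injOn_id _)
    refine ⟨⟨g, Polynomial.mem_degreeLT.2 hgdeg⟩, ?_⟩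
    rw [Subtype.ext_iff]
    change A * Polynomial.aeval S g = C
    have key : Matrix.toLin' (A * Polynomial.aeval S g - C) = 0 := by
      rw [← LinearMap.ker_eq_top, eq_top_iff, ← htop]
      refine iSup_le fun μ v hv => ?_
      rw [hmem] at hv
      rw [LinearMap.mem_ker, Matrix.toLin'_apply, Matrix.sub_mulVec, sub_eq_zero]
      by_cases hv0 : v = 0
      · simp [hv0]
      have hμ0 : μ ≠ 0 := by
        rintro rfl
        exact hv0 (hSinj v (by simpa using hv))
      have hg : g.eval μ = c μ / μ :=
        Lagrange.eval_interpolate_at_node (v := id) _ (Set.injOn_id _) (hM hv0 hv)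
      rw [← Matrix.mulVec_mulVec, haeval g hv, hg, Matrix.mulVec_smul]
      have h7 : c μ • A *ᵥ v = μ • C *ᵥ v := by
        rw [← Matrix.mulVec_smul, ← hc μ v hv, Matrix.mulVec_mulVec, hC.2, ← Matrix.mul_assoc,
          hC.1, Matrix.mul_assoc, ← hS, ← Matrix.mulVec_mulVec, hv, Matrix.mulVec_smul]
      rw [div_eq_inv_mul, mul_smul, h7, smul_smul, inv_mul_cancel₀ hμ0, one_smul]
    exact sub_eq_zero.1 ((Matrix.toLin').injective (by rw [key, map_zero]))
  rw [← (LinearEquiv.ofBijective Φ ⟨hΦinj, hΦsurj⟩).finrank_eq,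
    (Polynomial.degreeLTEquiv K M.card).finrank_eq, Module.finrank_fintype_fun_eq_card,
    Fintype.card_fin, hMcard, hhalf]

end SplitCount

/-! ### Extension of scalars -/

section BaseChange

variable {F K : Type*} [Field F] [CharZero F] [Field K] [CharZero K] [Algebra F K]
  {m n : Type*} [Fintype m] [DecidableEq m] [Fintype n] [DecidableEq n]

theorem isSemisimple_map {X : Matrix n n F} (hX : Module.End.IsSemisimple (Matrix.toLin' X)) :
    Module.End.IsSemisimple (Matrix.toLin' (X.map (algebraMap F K))) := by
  obtain ⟨f, hf, hf0⟩ := isSemisimple_toLin'_iff.1 hX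
  refine isSemisimple_toLin'_iff.2 ⟨f.map (algebraMap F K), ?_, ?_⟩
  · exact ((PerfectField.separable_iff_squarefree.2 hf).map (f := algebraMap F K)).squarefree
  · rw [Polynomial.aeval_map_algebraMap]
    have := Polynomial.aeval_algHom_apply
      ((Algebra.ofId F K).mapMatrix : Matrix n n F →ₐ[F] Matrix n n K) X f
    rw [hf0, map_zero] at this
    exact this

theorem adj_map {R S : Type*} [CommRing R] [CommRing S] (g : R →+* S) (J₁ : Matrix m m R)
    (J₂ : Matrix n n R) (A : Matrix m n R) :
    adj (J₁.map g) (J₂.map g) (A.map g) = (adj J₁ J₂ A).map g := by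
  rw [adj, adj, Matrix.map_mul, Matrix.map_mul, Matrix.transpose_map]

theorem offDiag_map {R S : Type*} [CommRing R] [CommRing S] (g : R →+* S) (J₁ : Matrix m m R)
    (J₂ : Matrix n n R) (A : Matrix m n R) :
    offDiag (J₁.map g) (J₂.map g) (A.map g) = (offDiag J₁ J₂ A).map g := by
  rw [offDiag, offDiag, adj_map, Matrix.fromBlocks_map]
  simp [Matrix.map_zero]

theorem map_linear_mul {l : Type*} (φ : K →ₗ[F] F) (M : Matrix l m F) (N : Matrix m n K) :
    (M.map (algebraMap F K) * N).map φ = M * N.map φ := by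
  ext i j
  simp [Matrix.mul_apply, ← Algebra.smul_def]

theorem map_mul_linear {l : Type*} (φ : K →ₗ[F] F) (M : Matrix l m K) (N : Matrix m n F) :
    (M * N.map (algebraMap F K)).map φ = M.map φ * N := by
  ext i j
  rw [Matrix.map_apply, Matrix.mul_apply, Matrix.mul_apply, map_sum]
  refine Finset.sum_congr rfl fun k _ => ?_
  rw [Matrix.map_apply, mul_comm, ← Algebra.smul_def, map_smul, smul_eq_mul, mul_comm,
    Matrix.map_apply]

variable {J₁ : Matrix m m F} {J₂ : Matrix n n F} {A : Matrix m n F}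

theorem map_mem_blockCentralizer {C : Matrix m n F} (hC : C ∈ blockCentralizer J₁ J₂ A) :
    C.map (algebraMap F K) ∈ blockCentralizer (J₁.map (algebraMap F K))
      (J₂.map (algebraMap F K)) (A.map (algebraMap F K)) := by
  rw [mem_blockCentralizer, adj_map, adj_map, ← Matrix.map_mul, ← Matrix.map_mul,
    ← Matrix.map_mul, ← Matrix.map_mul, hC.1, hC.2]
  exact ⟨rfl, rfl⟩

/-- The equations for C are linear with coefficients in F, so an F-linear functional applied
entrywise preserves them. -/
theorem linear_map_mem_blockCentralizer {C : Matrix m n K} (φ : K →ₗ[F] F)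
    (hC : C ∈ blockCentralizer (J₁.map (algebraMap F K))
      (J₂.map (algebraMap F K)) (A.map (algebraMap F K))) :
    C.map φ ∈ blockCentralizer J₁ J₂ A := by
  have hadj : adj J₁ J₂ (C.map φ)
      = (adj (J₁.map (algebraMap F K)) (J₂.map (algebraMap F K)) C).map φ := by
    rw [adj, adj, map_mul_linear, map_linear_mul, Matrix.transpose_map]
  rw [mem_blockCentralizer, adj_map] at hC
  rw [mem_blockCentralizer, hadj, ← map_linear_mul, ← map_linear_mul, ← map_mul_linear,
    ← map_mul_linear, hC.1, hC.2]
  exact ⟨rfl, rfl⟩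

/-- Expanding the entries in an F-basis of K, each coordinate matrix solves the equations over F. -/
theorem blockCentralizer_map_le_span :
    blockCentralizer (J₁.map (algebraMap F K)) (J₂.map (algebraMap F K))
        (A.map (algebraMap F K)) ≤
      Submodule.span K ((fun C : Matrix m n F => C.map (algebraMap F K)) ''
        blockCentralizer J₁ J₂ A) := by
  classical
  intro C hC
  let b := Module.Free.chooseBasis F K
  let s := Finset.univ.biUnion fun ij : m × n => (b.repr (C ij.1 ij.2)).support
  have hsum : C = ∑ k ∈ s, b k • (C.map (b.coord k)).map (algebraMap F K) := by
    ext i j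
    rw [Matrix.sum_apply]
    simp only [Matrix.smul_apply, Matrix.map_apply, Module.Basis.coord_apply, smul_eq_mul]
    conv_lhs => rw [← b.linearCombination_repr (C i j), Finsupp.linearCombination_apply,
      Finsupp.sum]
    rw [Finset.sum_subset (s₂ := s)]
    · refine Finset.sum_congr rfl fun k _ => ?_
      rw [Algebra.smul_def, mul_comm]
    · intro k hk
      exact Finset.mem_biUnion.2 ⟨(i, j), Finset.mem_univ _, hk⟩
    · intro k _ hk
      rw [Finsupp.notMem_support_iff.1 hk, zero_smul]
  rw [hsum]
  exact Submodule.sum_mem _ fun k _ => Submodule.smul_mem _ _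
    (Submodule.subset_span ⟨_, linear_map_mem_blockCentralizer _ hC, rfl⟩)

theorem finrank_blockCentralizer_map :
    Module.finrank K (blockCentralizer (J₁.map (algebraMap F K)) (J₂.map (algebraMap F K))
        (A.map (algebraMap F K))) = Module.finrank F (blockCentralizer J₁ J₂ A) := by
  let c := Module.finBasis F (blockCentralizer J₁ J₂ A)
  let v := fun i => (c i : Matrix m n F).map (algebraMap F K)
  have hli : LinearIndependent K v := by
    rw [Fintype.linearIndependent_iff]
    intro g hg i
    let b := Module.Free.chooseBasis F K
    apply b.repr.injective
    rw [map_zero]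
    ext k
    have hc := Fintype.linearIndependent_iff.1 c.linearIndependent (fun i => b.repr (g i) k) ?_ i
    · exact hc
    · rw [Subtype.ext_iff]
      ext i' j'
      have h1 := congrArg (b.coord k) (congrFun (congrFun hg i') j')
      simp only [v, Matrix.sum_apply, Matrix.smul_apply, Matrix.map_apply, Matrix.zero_apply,
        map_zero, map_sum, smul_eq_mul] at h1
      simp only [Submodule.coe_sum, Submodule.coe_smul, Matrix.sum_apply, Matrix.smul_apply,
        smul_eq_mul, Submodule.coe_zero, Matrix.zero_apply]
      rw [← h1]
      refine Finset.sum_congr rfl fun i _ => ?_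
      rw [mul_comm (g i), ← Algebra.smul_def, map_smul, smul_eq_mul, mul_comm]
      rfl
  have hspan : blockCentralizer (J₁.map (algebraMap F K)) (J₂.map (algebraMap F K))
        (A.map (algebraMap F K)) = Submodule.span K (Set.range v) := by
    apply le_antisymm
    · refine blockCentralizer_map_le_span.trans (Submodule.span_le.2 ?_)
      rintro _ ⟨C, hC, rfl⟩
      have : C.map (algebraMap F K) = ∑ i, algebraMap F K (c.repr ⟨C, hC⟩ i) • v i := by
        have h := congrArg Subtype.val (c.sum_repr ⟨C, hC⟩)
        simp only [Submodule.coe_sum, Submodule.coe_smul] at h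
        conv_lhs => rw [← h]
        ext i j
        simp [v, Matrix.sum_apply, Algebra.smul_def]
      change C.map (algebraMap F K) ∈ _
      rw [this]
      exact Submodule.sum_mem _ fun i _ => Submodule.smul_mem _ _
        (Submodule.subset_span ⟨i, rfl⟩)
    · rw [Submodule.span_le]
      rintro _ ⟨i, rfl⟩
      exact map_mem_blockCentralizer (c i).2
  rw [hspan, finrank_span_eq_card hli, Fintype.card_fin]

/-- Commutativity is needed besides semisimplicity: the extended centralizer is spanned by commuting
semisimple elements, and sums of such elements are semisimple in characteristic zero. -/
theorem isSemisimple_of_mem_blockCentralizer_map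
    (hss : ∀ C ∈ blockCentralizer J₁ J₂ A,
      Module.End.IsSemisimple (Matrix.toLin' (offDiag J₁ J₂ C)))
    (hcomm : ∀ C ∈ blockCentralizer J₁ J₂ A, ∀ D ∈ blockCentralizer J₁ J₂ A,
      offDiag J₁ J₂ C * offDiag J₁ J₂ D = offDiag J₁ J₂ D * offDiag J₁ J₂ C)
    {C : Matrix m n K} (hC : C ∈ blockCentralizer (J₁.map (algebraMap F K))
      (J₂.map (algebraMap F K)) (A.map (algebraMap F K))) :
    Module.End.IsSemisimple (Matrix.toLin'
      (offDiag (J₁.map (algebraMap F K)) (J₂.map (algebraMap F K)) C)) := by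
  set s := (fun C : Matrix m n F => C.map (algebraMap F K)) '' blockCentralizer J₁ J₂ A
  set Φ := offDiagL (J₁.map (algebraMap F K)) (J₂.map (algebraMap F K))
  have hΦ : ∀ C : Matrix m n F, Φ (C.map (algebraMap F K))
      = (offDiag J₁ J₂ C).map (algebraMap F K) := fun C => offDiag_map _ _ _ _
  have h1 : ∀ C ∈ s, ∀ D ∈ s, Φ C * Φ D = Φ D * Φ C := by
    rintro _ ⟨C, hC, rfl⟩ _ ⟨D, hD, rfl⟩
    simp only [hΦ]
    rw [← Matrix.map_mul, ← Matrix.map_mul, hcomm C hC D hD]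
  have h2 : ∀ C ∈ s, ∀ D ∈ Submodule.span K s, Φ C * Φ D = Φ D * Φ C := by
    intro C hC D hD
    induction hD using Submodule.span_induction with
    | mem D hD => exact h1 C hC D hD
    | zero => simp
    | add D E _ _ hD hE => rw [map_add, Matrix.mul_add, Matrix.add_mul, hD, hE]
    | smul c D _ hD => rw [map_smul, Matrix.mul_smul, Matrix.smul_mul, hD]
  have h3 : ∀ C ∈ Submodule.span K s, ∀ D ∈ Submodule.span K s, Φ C * Φ D = Φ D * Φ C := by
    intro C hC D hD
    induction hC using Submodule.span_induction with
    | mem C hC => exact h2 C hC D hD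
    | zero => simp
    | add C E _ _ hC hE => rw [map_add, Matrix.mul_add, Matrix.add_mul, hC, hE]
    | smul c C _ hC => rw [map_smul, Matrix.mul_smul, Matrix.smul_mul, hC]
  change Module.End.IsSemisimple (Matrix.toLin' (Φ C))
  have hC' := blockCentralizer_map_le_span hC
  clear hC
  induction hC' using Submodule.span_induction with
  | mem C hC =>
    obtain ⟨C, hC, rfl⟩ := hC
    rw [hΦ]
    exact isSemisimple_map (hss C hC)
  | zero => rw [map_zero, map_zero]; exact Module.End.isSemisimple_zero
  | add C E hC hE ihC ihE => rw [map_add]; exact isSemisimple_add ihC ihE (h3 C hC E hE)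
  | smul c C _ ih => rw [map_smul]; exact isSemisimple_smul ih c

end BaseChange

/-! ### The rank of θ -/

section Rank

variable {F : Type*} [Field F] [CharZero F] {p q : ℕ}

theorem isSympl_J'pq (hp : Even p) (hq : Even q) : IsSympl (J'pq F p q) := by
  have h₁ := isSympl_J' (R := F) hp
  have h₂ := isSympl_J' (R := F) hq
  constructor
  · rw [J'pq, Matrix.fromBlocks_transpose, h₁.transpose, h₂.transpose, Matrix.fromBlocks_neg]
    simp
  · rw [J'pq, Matrix.fromBlocks_multiply, h₁.mul_self, h₂.mul_self, ← Matrix.fromBlocks_one,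
      Matrix.fromBlocks_neg]
    simp

theorem mem_gMinus_iff_isMinus (hp : Even p) (hq : Even q)
    {X : Matrix (Fin p ⊕ Fin q) (Fin p ⊕ Fin q) F} :
    X ∈ gMinus F p q ↔ IsMinus (Matrix.fromBlocks 1 0 0 (-1)) (J'pq F p q) X := by
  have hJ := isSympl_J'pq (F := F) hp hq
  rw [mem_gMinus_iff_blocks]
  constructor
  · rintro ⟨h1, h2⟩
    refine ⟨h2, ?_⟩
    rw [dag, Matrix.mul_assoc, h1, Matrix.mul_neg, ← Matrix.mul_assoc, hJ.mul_self]
    simp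
  · rintro ⟨h2, h1⟩
    refine ⟨?_, h2⟩
    rw [dag, neg_inj, Matrix.mul_assoc] at h1
    conv_rhs => rw [← h1, ← Matrix.mul_assoc, hJ.mul_self]
    simp

theorem J'_map {R S : Type*} [CommRing R] [CommRing S] (g : R →+* S) (r : ℕ) :
    (J' R r).map g = J' S r := by
  ext i j
  simp only [J', Matrix.map_apply, Matrix.of_apply]
  split_ifs <;> simp

theorem isCartanSubspace_iff (hp : Even p) (hq : Even q)
    {T : Submodule F (Matrix (Fin p ⊕ Fin q) (Fin p ⊕ Fin q) F)} :
    IsCartanSubspace T ↔ Maximal (fun S : Submodule F (Matrix (Fin p ⊕ Fin q) (Fin p ⊕ Fin q) F) =>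
      (∀ X ∈ S, IsMinus (Matrix.fromBlocks 1 0 0 (-1)) (J'pq F p q) X) ∧
      (∀ X ∈ S, ∀ Y ∈ S, X * Y = Y * X) ∧
      ∀ X ∈ S, Module.End.IsSemisimple (Matrix.toLin' X)) T := by
  rw [IsCartanSubspace]
  have : (fun S : Submodule F (Matrix (Fin p ⊕ Fin q) (Fin p ⊕ Fin q) F) =>
      S ≤ gMinus F p q ∧ (∀ X ∈ S, ∀ Y ∈ S, ⁅X, Y⁆ = 0) ∧
      ∀ X ∈ S, Module.End.IsSemisimple (Matrix.toLin' X)) =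
      fun S : Submodule F (Matrix (Fin p ⊕ Fin q) (Fin p ⊕ Fin q) F) =>
      (∀ X ∈ S, IsMinus (Matrix.fromBlocks 1 0 0 (-1)) (J'pq F p q) X) ∧
      (∀ X ∈ S, ∀ Y ∈ S, X * Y = Y * X) ∧
      ∀ X ∈ S, Module.End.IsSemisimple (Matrix.toLin' X) := by
    funext S
    simp only [LieRing.of_associative_ring_bracket, sub_eq_zero, SetLike.le_def,
      mem_gMinus_iff_isMinus hp hq]
  rw [this]

theorem thetaHasRank (hqp : q ≤ p) (hp : Even p) (hq : Even q) : ThetaHasRank F p q (q / 2) := by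
  constructor
  · obtain ⟨T, hT, hmax⟩ := (wellFounded_gt (α := Submodule F
      (Matrix (Fin p ⊕ Fin q) (Fin p ⊕ Fin q) F))).has_min
      {S | S ≤ gMinus F p q ∧ (∀ X ∈ S, ∀ Y ∈ S, ⁅X, Y⁆ = 0) ∧
        ∀ X ∈ S, Module.End.IsSemisimple (Matrix.toLin' X)} ⟨⊥, bot_le, by simp, by
          simp only [Submodule.mem_bot, forall_eq, map_zero]
          exact Module.End.isSemisimple_zero⟩
    refine ⟨T, hT, fun S hS hTS => ?_⟩
    by_contra h
    exact hmax S hS (lt_of_le_not_ge hTS h)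
  · intro T hT
    have hJ := isSympl_J'pq (F := F) hp hq
    rw [isCartanSubspace_iff hp hq] at hT
    obtain ⟨X, hX, hTX⟩ := exists_isMinus_centralizer_eq hJ
      (by rw [Matrix.fromBlocks_multiply, ← Matrix.fromBlocks_one]; simp)
      (by rw [Matrix.fromBlocks_transpose]; simp)
      (by rw [J'pq, Matrix.fromBlocks_multiply, Matrix.fromBlocks_multiply]; simp) hT
    have hTeq : T = gMinusCentralizer X := by
      ext Y
      rw [hTX, mem_gMinusCentralizer, mem_gMinus_iff_isMinus hp hq]
    obtain ⟨A, rfl⟩ := (mem_gMinus_iff hp hq).1 ((mem_gMinus_iff_isMinus hp hq).2 (hT.prop.1 X hX))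
    have hmemT : ∀ C ∈ blockCentralizer (J' F p) (J' F q) A,
        offDiag (J' F p) (J' F q) C ∈ T := by
      intro C hC
      rw [hTeq, gMinusCentralizer_offDiag hp hq]
      exact ⟨C, hC, rfl⟩
    rw [hTeq, finrank_gMinusCentralizer_offDiag hp hq,
      ← finrank_blockCentralizer_map (K := AlgebraicClosure F)]
    rw [finrank_blockCentralizer_of_semisimple
      (by rw [J'_map]; exact isSympl_J' hp) (by rw [J'_map]; exact isSympl_J' hq) (by simpa)
      fun C hC => isSemisimple_of_mem_blockCentralizer_map
        (fun C hC => hT.prop.2.2 _ (hmemT C hC))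
        (fun C hC D hD => hT.prop.2.1 _ (hmemT C hC) _ (hmemT D hD)) hC, Fintype.card_fin]

end Rank

/-! ### Jacobian criterion -/

section Jacobian

variable {K : Type*} [Field K]

theorem derivation_aeval {σ A : Type*} [Fintype σ] [CommRing A] [Algebra K A]
    (D : Derivation K A A) (x : σ → A) (P : MvPolynomial σ K) :
    D (MvPolynomial.aeval x P) =
      ∑ a, MvPolynomial.aeval x (MvPolynomial.pderiv a P) * D (x a) := by
  classical
  induction P using MvPolynomial.induction_on with
  | C c => simp
  | add P Q hP hQ => simp [hP, hQ, add_mul, Finset.sum_add_distrib]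
  | mul_X P i hP =>
    rw [map_mul, MvPolynomial.aeval_X, Derivation.leibniz, hP, smul_eq_mul, smul_eq_mul,
      Finset.mul_sum]
    simp only [MvPolynomial.pderiv_mul, map_add, map_mul, MvPolynomial.aeval_X, add_mul,
      Finset.sum_add_distrib, MvPolynomial.pderiv_X]
    rw [add_comm]
    congr 1
    · refine Finset.sum_congr rfl fun a _ => by ring
    · rw [Finset.sum_eq_single i]
      · simp
      · intro a _ ha
        rw [Pi.single_eq_of_ne ha.symm]; simp
      · simp

/-- The Jacobian criterion for algebraic independence. -/
theorem algebraicIndependent_of_pderiv [CharZero K] {σ : Type*} [Fintype σ] [DecidableEq σ]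
    (f : σ → MvPolynomial σ K)
    (hf : ∀ a b, MvPolynomial.constantCoeff (MvPolynomial.pderiv b (f a))
      = if a = b then 1 else 0) : AlgebraicIndependent K f := by
  rw [algebraicIndependent_iff]
  have hconst : ∀ P : MvPolynomial σ K, P.totalDegree = 0 → MvPolynomial.aeval f P = 0 →
      P = 0 := by
    intro P hP h
    rw [MvPolynomial.totalDegree_eq_zero_iff_eq_C] at hP
    rw [hP] at h ⊢
    simpa using h
  -- Induction on the degree: by the chain rule, the partial derivatives of P evaluated at f form a
  -- vector killed by the Jacobian matrix, whose determinant has constant term 1. They are thus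
  -- relations of lower degree and vanish; in characteristic zero P is constant.
  suffices ∀ d, ∀ P : MvPolynomial σ K, P.totalDegree ≤ d → MvPolynomial.aeval f P = 0 → P = 0 from
    fun P hP => this _ P le_rfl hP
  intro d
  induction d with
  | zero => exact fun P hP => hconst P (Nat.le_zero.1 hP)
  | succ d ih =>
    intro P hP h0
    let M : Matrix σ σ (MvPolynomial σ K) :=
      Matrix.of fun a b => MvPolynomial.pderiv b (f a)
    have hdet : M.det ≠ 0 := by
      intro h
      have h1 : MvPolynomial.constantCoeff M.det = 1 := by
        rw [RingHom.map_det]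
        have : MvPolynomial.constantCoeff.mapMatrix M = 1 := by
          ext a b
          simp [M, hf, Matrix.one_apply]
        rw [this, Matrix.det_one]
      rw [h, map_zero] at h1
      exact zero_ne_one h1
    have hu : (fun a => MvPolynomial.aeval f (MvPolynomial.pderiv a P)) = 0 := by
      apply Matrix.eq_zero_of_vecMul_eq_zero hdet
      ext1 b
      have := derivation_aeval (MvPolynomial.pderiv b) f P
      rw [h0, map_zero] at this
      exact this.symm
    have hP' : ∀ a, MvPolynomial.pderiv a P = 0 := by
      intro a
      refine ih _ ?_ (congrFun hu a)
      refine Finset.sup_le fun m hm => ?_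
      rw [MvPolynomial.mem_support_iff, MvPolynomial.coeff_pderiv] at hm
      have h2 := (MvPolynomial.le_totalDegree
        (MvPolynomial.mem_support_iff.2 (left_ne_zero_of_mul hm))).trans hP
      rw [Finsupp.sum_add_index' (fun _ => rfl) (fun _ _ _ => rfl),
        Finsupp.sum_single_index rfl] at h2
      omega
    refine hconst P ?_ h0
    rw [MvPolynomial.totalDegree_eq_zero_iff]
    intro m hm a
    by_contra hma
    have h3 := congrArg (MvPolynomial.coeff (m - Finsupp.single a 1)) (hP' a)
    rw [MvPolynomial.coeff_pderiv, MvPolynomial.coeff_zero] at h3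
    have h4 : m - Finsupp.single a 1 + Finsupp.single a 1 = m := by
      apply tsub_add_cancel_of_le
      rw [Finsupp.single_le_iff]; omega
    rw [h4] at h3
    rcases mul_eq_zero.1 h3 with h5 | h5
    · exact MvPolynomial.mem_support_iff.1 hm h5
    · exact Nat.cast_add_one_ne_zero _ h5

/-- A partial derivative at the origin is read off by restricting to the coordinate axis. -/
theorem constantCoeff_pderiv {σ : Type*} [Fintype σ] [DecidableEq σ]
    (f : MvPolynomial σ K) (b : σ) :
    MvPolynomial.constantCoeff (MvPolynomial.pderiv b f) =
      (MvPolynomial.aeval (Pi.single b Polynomial.X : σ → Polynomial K) f).coeff 1 := by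
  have h1 := derivation_aeval (Polynomial.derivative' (R := K))
    (Pi.single b Polynomial.X : σ → Polynomial K) f
  rw [Finset.sum_eq_single b] at h1
  · have h2 := congrArg (Polynomial.eval 0) h1
    rw [Pi.single_eq_same] at h2
    have h3 : ∀ g : Polynomial K, Polynomial.derivative' g = Polynomial.derivative g :=
      fun _ => rfl
    rw [h3, h3, Polynomial.derivative_X, mul_one, ← Polynomial.coeff_zero_eq_eval_zero,
      Polynomial.coeff_derivative] at h2
    have h4 : ∀ g : MvPolynomial σ K, Polynomial.eval 0
        (MvPolynomial.aeval (Pi.single b Polynomial.X : σ → Polynomial K) g)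
        = MvPolynomial.constantCoeff g := by
      intro g
      have h5 := MvPolynomial.comp_aeval_apply (Pi.single b Polynomial.X : σ → Polynomial K)
        (Polynomial.aeval (0 : K)) g
      rw [Polynomial.coe_aeval_eq_eval] at h5
      have h6 : (fun i => Polynomial.eval 0 ((Pi.single b Polynomial.X : σ → Polynomial K) i))
          = 0 := by
        funext a
        by_cases ha : a = b
        · subst ha; simp
        · simp [Pi.single_eq_of_ne ha]
      rw [h5, h6, MvPolynomial.aeval_zero]
      rfl
    rw [h4] at h2
    simpa using h2.symm
  · intro a _ ha
    rw [Pi.single_eq_of_ne ha, map_zero, mul_zero]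
  · simp

end Jacobian

/-! ### Products of unipotent elements -/

section Transvection

variable {K : Type*} [Field K] {ι : Type*} [Fintype ι] [DecidableEq ι]

/-- The unipotent element `1 + t N` for `N² = 0`. -/
def transv {N : Matrix ι ι K} (hN : N * N = 0) (S : Type*) [CommRing S] [Algebra K S] (t : S) :
    GL ι S where
  val := 1 + t • N.map (algebraMap K S)
  inv := 1 - t • N.map (algebraMap K S)
  val_inv := by
    have hN' : N.map (algebraMap K S) * N.map (algebraMap K S) = 0 := by
      rw [← Matrix.map_mul, hN, Matrix.map_zero _ (map_zero _)]
    simp [Matrix.add_mul, Matrix.mul_sub, hN']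
  inv_val := by
    have hN' : N.map (algebraMap K S) * N.map (algebraMap K S) = 0 := by
      rw [← Matrix.map_mul, hN, Matrix.map_zero _ (map_zero _)]
    simp [Matrix.sub_mul, Matrix.mul_add, hN']

variable {k : ℕ} {N : Fin k → Matrix ι ι K} (hN : ∀ i, N i * N i = 0)

/-- The product of the elements `1 + z i N i`. -/
def transvProd (S : Type*) [CommRing S] [Algebra K S] (z : Fin k → S) : GL ι S :=
  (List.ofFn fun i => transv (hN i) S (z i)).prod

theorem map_transvProd {S S' : Type*} [CommRing S] [Algebra K S] [CommRing S'] [Algebra K S']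
    (h : S →ₐ[K] S') (z : Fin k → S) :
    Matrix.GeneralLinearGroup.map h.toRingHom (transvProd hN S z)
      = transvProd hN S' (fun i => h (z i)) := by
  rw [transvProd, transvProd, map_list_prod, List.map_ofFn]
  congr 2
  funext i
  ext a b
  simp only [Function.comp_apply, transv, Matrix.GeneralLinearGroup.map_apply, Matrix.add_apply,
    Matrix.smul_apply, Matrix.map_apply, smul_eq_mul, Matrix.one_apply]
  have : ∀ x, h.toRingHom x = h x := fun _ => rfl
  rw [this, map_add, map_mul, AlgHom.commutes]
  split_ifs <;> simp

theorem transvProd_single (S : Type*) [CommRing S] [Algebra K S] (b : Fin k) (t : S) :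
    transvProd hN S (Pi.single b t) = transv (hN b) S t := by
  have h0 : ∀ i, transv (hN i) S 0 = 1 := by
    intro i; ext; simp [transv]
  rw [transvProd, List.ofFn_eq_map, List.prod_map_eq_pow_single b,
    List.count_eq_one_of_mem (List.nodup_finRange k) (List.mem_finRange b), pow_one,
    Pi.single_eq_same]
  intro a ha _
  rw [Pi.single_eq_of_ne ha, h0]

/-- The linear functional `φ` on the conjugate of `X` by `transvProd`. -/
def transvOrbit (X : Matrix ι ι K) (φ : Matrix ι ι K →ₗ[K] K) (S : Type*) [CommRing S]
    [Algebra K S] (z : Fin k → S) : S :=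
  ∑ ij : ι × ι, algebraMap K S (φ (Matrix.single ij.1 ij.2 1)) *
    ((transvProd hN S z : Matrix ι ι S) * X.map (algebraMap K S)
      * ((transvProd hN S z)⁻¹ : GL ι S)) ij.1 ij.2

theorem linear_eq_sum_single (φ : Matrix ι ι K →ₗ[K] K) (X : Matrix ι ι K) :
    φ X = ∑ ij : ι × ι, φ (Matrix.single ij.1 ij.2 1) * X ij.1 ij.2 := by
  conv_lhs => rw [Matrix.matrix_eq_sum_single X]
  rw [map_sum, Fintype.sum_prod_type]
  refine Finset.sum_congr rfl fun i _ => ?_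
  rw [map_sum]
  refine Finset.sum_congr rfl fun j _ => ?_
  rw [← mul_one (X i j), ← smul_eq_mul, ← Matrix.smul_single, map_smul, smul_eq_mul, smul_eq_mul,
    mul_one, mul_comm]

/-- Naturality lets one expression be read as a polynomial in z, restricted to a coordinate axis,
and evaluated at points. -/
theorem map_transvOrbit (X : Matrix ι ι K) (φ : Matrix ι ι K →ₗ[K] K) {S S' : Type*}
    [CommRing S] [Algebra K S] [CommRing S'] [Algebra K S'] (h : S →ₐ[K] S') (z : Fin k → S) :
    h (transvOrbit hN X φ S z) = transvOrbit hN X φ S' (fun i => h (z i)) := by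
  have hmap : ∀ g : GL ι S, ((Matrix.GeneralLinearGroup.map h.toRingHom g : GL ι S') :
      Matrix ι ι S') = (g : Matrix ι ι S).map h := fun _ => rfl
  have hX : X.map (algebraMap K S') = (X.map (algebraMap K S)).map h := by
    ext i j; simp
  rw [transvOrbit, transvOrbit, map_sum, ← map_transvProd hN h z, ← map_inv, hmap, hmap, hX,
    ← Matrix.map_mul, ← Matrix.map_mul]
  simp

theorem transvOrbit_self (X : Matrix ι ι K) (φ : Matrix ι ι K →ₗ[K] K) (z : Fin k → K) :
    transvOrbit hN X φ K z =
      φ ((transvProd hN K z : Matrix ι ι K) * X * ((transvProd hN K z)⁻¹ : GL ι K)) := by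
  rw [linear_eq_sum_single φ, transvOrbit]
  simp

/-- The first-order term of (1 + tN)X(1 - tN) is the commutator [N, X]. -/
theorem coeff_one_transvOrbit (X : Matrix ι ι K) (φ : Matrix ι ι K →ₗ[K] K) (b : Fin k) :
    (transvOrbit hN X φ (Polynomial K) (Pi.single b Polynomial.X)).coeff 1
      = φ (N b * X - X * N b) := by
  rw [linear_eq_sum_single φ, transvOrbit, Polynomial.finsetSum_coeff]
  refine Finset.sum_congr rfl fun ij _ => ?_
  rw [Polynomial.algebraMap_eq, Polynomial.coeff_C_mul, transvProd_single]
  congr 1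
  change (((1 + (Polynomial.X : Polynomial K) • (N b).map Polynomial.C) * X.map Polynomial.C *
    (1 - (Polynomial.X : Polynomial K) • (N b).map Polynomial.C)) ij.1 ij.2).coeff 1 = _
  have h : (1 + (Polynomial.X : Polynomial K) • (N b).map Polynomial.C) * X.map Polynomial.C *
      (1 - (Polynomial.X : Polynomial K) • (N b).map Polynomial.C)
      = X.map Polynomial.C + (Polynomial.X : Polynomial K) •
        (N b * X - X * N b).map Polynomial.C
        - (Polynomial.X ^ 2 : Polynomial K) • (N b * X * N b).map Polynomial.C := by
    rw [Matrix.map_sub _ (map_sub _), Matrix.map_mul, Matrix.map_mul, Matrix.map_mul,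
      Matrix.map_mul]
    simp only [Matrix.add_mul, Matrix.mul_sub, Matrix.mul_one, Matrix.one_mul, Matrix.smul_mul,
      Matrix.mul_smul, smul_sub, smul_add, smul_smul, pow_two]
    abel
  rw [h]
  simp [Polynomial.coeff_X_pow_mul', Polynomial.coeff_C, Polynomial.coeff_X_mul]

end Transvection

/-! ### Lower bound for orbit dimensions -/

section OrbitDim

variable {K : Type*} [Field K] [CharZero K]

/-- A lower bound for the dimension of an orbit, from linear functionals dual to tangent
directions given by unipotent elements. -/
theorem le_zariskiDim_orbit {p q k : ℕ}
    {N : Fin k → Matrix (Fin p ⊕ Fin q) (Fin p ⊕ Fin q) K} (hN : ∀ i, N i * N i = 0)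
    (hG : ∀ i t, transv (hN i) K t ∈ G1 K p q) (X : Matrix (Fin p ⊕ Fin q) (Fin p ⊕ Fin q) K)
    (φ : Fin k → Matrix (Fin p ⊕ Fin q) (Fin p ⊕ Fin q) K →ₗ[K] K)
    (hφ : ∀ a b, φ a (N b * X - X * N b) = if a = b then 1 else 0) :
    (k : Cardinal) ≤ zariskiDim K (orbit X) := by
  have hf : AlgebraicIndependent K
      fun a => transvOrbit hN X (φ a) (MvPolynomial (Fin k) K) MvPolynomial.X := by
    refine algebraicIndependent_of_pderiv _ fun a b => ?_
    rw [constantCoeff_pderiv, map_transvOrbit]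
    simp only [MvPolynomial.aeval_X]
    rw [coeff_one_transvOrbit, hφ]
  have hprod : ∀ z : Fin k → K, transvProd hN K z ∈ G1 K p q := by
    intro z
    refine Subgroup.list_prod_mem _ fun g hg => ?_
    obtain ⟨i, rfl⟩ := (List.mem_ofFn' _ _).1 hg
    exact hG _ _
  let l : Fin k → MvPolynomial ((Fin p ⊕ Fin q) × (Fin p ⊕ Fin q)) K := fun a =>
    ∑ ij, MvPolynomial.C (φ a (Matrix.single ij.1 ij.2 1)) * MvPolynomial.X ij
  have hl : ∀ a v, MvPolynomial.eval v (l a) =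
      φ a (Matrix.of fun i j => v (i, j)) := by
    intro a v
    rw [linear_eq_sum_single]
    simp [l]
  -- Pulling back along z ↦ g(z) X g(z)⁻¹, whose values lie in the orbit, turns a relation among the
  -- linear forms into one among the independent polynomials of `hf`.
  have hind : AlgebraicIndependent K (fun a =>
      Ideal.Quotient.mkₐ K (MvPolynomial.vanishingIdeal K (orbit X)) (l a)) := by
    rw [algebraicIndependent_iff]
    intro P hP
    refine (algebraicIndependent_iff.1 hf) P ?_
    have h1 : MvPolynomial.aeval l P ∈ MvPolynomial.vanishingIdeal K (orbit X) := by
      rw [← Ideal.Quotient.eq_zero_iff_mem, ← hP]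
      exact MvPolynomial.comp_aeval_apply l (Ideal.Quotient.mkₐ K _) P
    apply MvPolynomial.funext
    intro z
    rw [map_zero]
    have h2 := (MvPolynomial.mem_vanishingIdeal_iff.1 h1)
      (fun ij => ((transvProd hN K z : Matrix (Fin p ⊕ Fin q) (Fin p ⊕ Fin q) K) * X
        * ((transvProd hN K z)⁻¹ : GL (Fin p ⊕ Fin q) K)) ij.1 ij.2) ⟨_, hprod z, fun _ => rfl⟩
    rw [← h2, ← MvPolynomial.aeval_eq_eval, MvPolynomial.comp_aeval_apply,
      MvPolynomial.comp_aeval_apply]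
    congr 2
    funext a
    rw [map_transvOrbit]
    simp only [MvPolynomial.aeval_X, MvPolynomial.aeval_eq_eval]
    rw [hl, transvOrbit_self]
    rfl
  have := hind.lift_cardinalMk_le_trdeg
  simpa [zariskiDim] using this

end OrbitDim

/-! ### Tangent directions and the trace pairing -/

section TangentSpace

variable {K : Type*} [Field K] [CharZero K] {m n : Type*} [Fintype m] [DecidableEq m] [Fintype n]
  [DecidableEq n] {J₁ : Matrix m m K} {J₂ : Matrix n n K}

theorem transpose_eq_neg_of_dotProduct (B : Matrix m m K) (h : ∀ v, v ⬝ᵥ B *ᵥ v = 0) :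
    Bᵀ = -B := by
  ext i j
  have h1 := h (Pi.single i 1 + Pi.single j 1)
  have h2 := h (Pi.single i 1)
  have h3 := h (Pi.single j 1)
  simp only [Matrix.mulVec_add, add_dotProduct, dotProduct_add, Matrix.mulVec_single_one,
    single_one_dotProduct, Matrix.col_apply] at h1 h2 h3
  rw [Matrix.transpose_apply, Matrix.neg_apply]
  linear_combination h1 - h2 - h3

/-- The upper right blocks of tangent vectors to the orbit of `offDiag J₁ J₂ A`, coming from
transvections. -/
def tangentSet (J₁ : Matrix m m K) (J₂ : Matrix n n K) (A : Matrix m n K) : Set (Matrix m n K) :=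
  Set.range (fun v : m → K => Matrix.vecMulVec v v * J₁ * A) ∪
    Set.range (fun w : n → K => -(A * (Matrix.vecMulVec w w * J₂)))

/-- The trace pairing. -/
def tracePairing (J₁ : Matrix m m K) (J₂ : Matrix n n K) :
    Matrix m n K →ₗ[K] Module.Dual K (Matrix m n K) :=
  LinearMap.mk₂ K (fun C M => (adj J₁ J₂ C * M).trace)
    (fun _ _ _ => by simp [adj, Matrix.mul_add, Matrix.add_mul])
    (fun _ _ _ => by simp [adj])
    (fun _ _ _ => by simp [Matrix.mul_add])
    (fun _ _ _ => by simp)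

theorem tracePairing_apply (C M : Matrix m n K) :
    tracePairing J₁ J₂ C M = (adj J₁ J₂ C * M).trace := rfl

theorem tracePairing_injective (h₁ : IsSympl J₁) (h₂ : IsSympl J₂) :
    Function.Injective (tracePairing J₁ J₂) := by
  rw [injective_iff_map_eq_zero]
  intro C hC
  have h0 : adj J₁ J₂ C = 0 := by
    ext j i
    have := LinearMap.congr_fun hC (Matrix.single i j 1)
    simpa [tracePairing_apply, Matrix.trace_mul_single] using this
  rw [← adj_adj h₁ h₂ C, h0]
  simp [adj]

/-- Pairing C with v vᵗ J₁ A gives the quadratic form vᵗ (J₁AC*) v. Its vanishing makes J₁AC* skew,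
which is AC* = CA*; the second family gives the other equation likewise. -/
theorem mem_blockCentralizer_of_tracePairing (h₁ : IsSympl J₁) (h₂ : IsSympl J₂)
    {A C : Matrix m n K} (h : ∀ M ∈ tangentSet J₁ J₂ A, tracePairing J₁ J₂ C M = 0) :
    C ∈ blockCentralizer J₁ J₂ A := by
  have hT : (adj J₁ J₂ C)ᵀ = J₁ * C * J₂ := by
    simp [adj, h₁.transpose, h₂.transpose, Matrix.mul_assoc]
  rw [mem_blockCentralizer]
  constructor
  · have h1 := transpose_eq_neg_of_dotProduct (J₁ * A * adj J₁ J₂ C) fun v => by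
      have h2 := h _ (Or.inl ⟨v, rfl⟩)
      simp only [tracePairing_apply, Matrix.vecMulVec_mul, Matrix.mul_vecMulVec,
        Matrix.trace_vecMulVec] at h2
      rw [dotProduct_comm] at h2
      rw [← Matrix.mulVec_mulVec, Matrix.dotProduct_mulVec, ← Matrix.vecMul_vecMul]
      exact h2
    rw [Matrix.transpose_mul, Matrix.transpose_mul, hT, h₁.transpose] at h1
    have h3 : J₁ * (A * adj J₁ J₂ C) = J₁ * (C * adj J₁ J₂ A) := by
      rw [← Matrix.mul_assoc, ← neg_eq_iff_eq_neg.2 h1]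
      simp [adj, Matrix.mul_assoc]
    have h4 := congrArg (J₁ * ·) h3
    simpa only [← Matrix.mul_assoc J₁, h₁.mul_self, Matrix.neg_mul, Matrix.one_mul,
      neg_inj] using h4
  · have h1 := transpose_eq_neg_of_dotProduct (J₂ * adj J₁ J₂ C * A) fun w => by
      have h2 := h _ (Or.inr ⟨w, rfl⟩)
      simp only [tracePairing_apply, Matrix.vecMulVec_mul, Matrix.mul_vecMulVec,
        Matrix.trace_vecMulVec, Matrix.mul_neg, Matrix.trace_neg, neg_eq_zero] at h2
      rw [dotProduct_comm] at h2
      rw [Matrix.mul_assoc, ← Matrix.mulVec_mulVec, Matrix.dotProduct_mulVec,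
        ← Matrix.mulVec_mulVec]
      exact h2
    rw [Matrix.transpose_mul, Matrix.transpose_mul, hT, h₂.transpose] at h1
    have h3 : Aᵀ * (J₁ * C) = -(J₂ * (adj J₁ J₂ C * A)) := by
      rw [← Matrix.mul_assoc J₂, ← h1]
      simp [Matrix.mul_assoc, h₂.mul_self]
    calc adj J₁ J₂ A * C = J₂ * (Aᵀ * (J₁ * C)) := by simp [adj, Matrix.mul_assoc]
      _ = _ := by rw [h3, Matrix.mul_neg, ← Matrix.mul_assoc, h₂.mul_self]; simp

/-- The trace pairing identifies the annihilator of the tangent directions with a subspace of the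
centralizer. -/
theorem card_le_finrank_span_tangentSet (h₁ : IsSympl J₁) (h₂ : IsSympl J₂) (A : Matrix m n K) :
    Fintype.card m * Fintype.card n ≤ Module.finrank K (Submodule.span K (tangentSet J₁ J₂ A)) +
      Module.finrank K (blockCentralizer J₁ J₂ A) := by
  have h3 := Subspace.finrank_add_finrank_dualAnnihilator_eq
    (Submodule.span K (tangentSet J₁ J₂ A))
  rw [Module.finrank_matrix, Module.finrank_self, mul_one] at h3
  rw [← h3, Nat.add_le_add_iff_left]
  let e := LinearEquiv.ofInjectiveOfFinrankEq (tracePairing J₁ J₂)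
    (tracePairing_injective h₁ h₂) (Subspace.dual_finrank_eq).symm
  rw [← LinearEquiv.finrank_map_eq e.symm]
  apply Submodule.finrank_mono
  rintro _ ⟨f, hf, rfl⟩
  apply mem_blockCentralizer_of_tracePairing h₁ h₂
  intro M hM
  have h5 : tracePairing J₁ J₂ (e.symm f) = f := e.apply_symm_apply f
  erw [h5]
  exact (Submodule.mem_dualAnnihilator _).1 hf M (Submodule.subset_span hM)

end TangentSpace

/-! ### Orbits in 𝔤(-1) -/

section ConcreteOrbit

variable {K : Type*} [Field K] [CharZero K] {p q : ℕ}

/-- The infinitesimal symplectic condition suffices, because the second-order term N J Nᵗ = -N²J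
vanishes. -/
theorem transv_mem_G1 {N : Matrix (Fin p ⊕ Fin q) (Fin p ⊕ Fin q) K} (hN : N * N = 0)
    (hJ : N * J'pq K p q + J'pq K p q * Nᵀ = 0)
    (hI : Matrix.fromBlocks 1 0 0 (-1) * N * Matrix.fromBlocks 1 0 0 (-1) = N) (t : K) :
    transv hN K t ∈ G1 K p q := by
  have hid : N.map (algebraMap K K) = N := by ext; simp
  refine ⟨?_, ?_⟩
  · change (1 + t • N.map (algebraMap K K)) * J'pq K p q * (1 + t • N.map (algebraMap K K))ᵀ = _
    rw [hid]
    have h1 : J'pq K p q * Nᵀ = -(N * J'pq K p q) := by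
      rw [eq_neg_iff_add_eq_zero, add_comm]; exact hJ
    have h2 : N * (N * J'pq K p q) = 0 := by
      rw [← Matrix.mul_assoc, hN, Matrix.zero_mul]
    simp [Matrix.add_mul, Matrix.mul_add, Matrix.mul_assoc, h2, h1]
  · change Ipq K p q * transv hN K t * (Ipq K p q)⁻¹ = transv hN K t
    apply Units.ext
    change Matrix.fromBlocks 1 0 0 (-1) * (1 + t • N.map (algebraMap K K)) *
      Matrix.fromBlocks 1 0 0 (-1) = 1 + t • N.map (algebraMap K K)
    rw [hid, Matrix.mul_add, Matrix.add_mul, Matrix.mul_smul, Matrix.smul_mul, hI]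
    simp [Matrix.fromBlocks_multiply]

theorem vecMulVec_mul_sq {J : Matrix (Fin p) (Fin p) K} (h : IsSympl J) (v : Fin p → K) :
    (Matrix.vecMulVec v v * J) * (Matrix.vecMulVec v v * J) = 0 := by
  have h1 : (v ᵥ* J) ⬝ᵥ v = 0 := by rw [← Matrix.dotProduct_mulVec, h.dotProduct_self]
  rw [Matrix.vecMulVec_mul, Matrix.vecMulVec_mul_vecMulVec, h1, zero_smul, Matrix.vecMulVec_zero]

theorem vecMulVec_mul_skew {J : Matrix (Fin p) (Fin p) K} (h : IsSympl J) (v : Fin p → K) :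
    (Matrix.vecMulVec v v * J) * J + J * (Matrix.vecMulVec v v * J)ᵀ = 0 := by
  rw [Matrix.transpose_mul, Matrix.transpose_vecMulVec, Matrix.mul_assoc, h.mul_self,
    ← Matrix.mul_assoc, h.mul_transpose]
  simp

theorem le_zariskiDim_orbit_offDiag (hp : Even p) (hq : Even q) (A : Matrix (Fin p) (Fin q) K) :
    ((p * q - Module.finrank K (blockCentralizer (J' K p) (J' K q) A) : ℕ) : Cardinal) ≤
      zariskiDim K (orbit (offDiag (J' K p) (J' K q) A)) := by
  have h₁ := isSympl_J' (R := K) hp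
  have h₂ := isSympl_J' (R := K) hq
  have hcard := card_le_finrank_span_tangentSet h₁ h₂ A
  rw [Fintype.card_fin, Fintype.card_fin] at hcard
  obtain ⟨f, hf, -, hli⟩ := Submodule.exists_fun_fin_finrank_span_eq K (tangentSet (J' K p) (J' K q) A)
  have hex : ∀ i, ∃ N : Matrix (Fin p ⊕ Fin q) (Fin p ⊕ Fin q) K, ∃ hN : N * N = 0,
      (∀ t, transv hN K t ∈ G1 K p q) ∧
      (N * offDiag (J' K p) (J' K q) A - offDiag (J' K p) (J' K q) A * N).toBlocks₁₂ = f i := by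
    intro i
    rcases hf i with ⟨v, hv⟩ | ⟨w, hw⟩
    · refine ⟨Matrix.fromBlocks (Matrix.vecMulVec v v * J' K p) 0 0 0, ?_, ?_, ?_⟩
      · simp [Matrix.fromBlocks_multiply, vecMulVec_mul_sq h₁]
      · refine transv_mem_G1 _ ?_ ?_
        · rw [J'pq, Matrix.fromBlocks_transpose, Matrix.fromBlocks_multiply,
            Matrix.fromBlocks_multiply, Matrix.fromBlocks_add]
          simp [-Matrix.transpose_mul, vecMulVec_mul_skew h₁]
        · simp [Matrix.fromBlocks_multiply]
      · rw [← hv]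
        simp [offDiag, Matrix.fromBlocks_multiply, sub_eq_add_neg, Matrix.fromBlocks_neg,
          Matrix.fromBlocks_add]
    · refine ⟨Matrix.fromBlocks 0 0 0 (Matrix.vecMulVec w w * J' K q), ?_, ?_, ?_⟩
      · simp [Matrix.fromBlocks_multiply, vecMulVec_mul_sq h₂]
      · refine transv_mem_G1 _ ?_ ?_
        · rw [J'pq, Matrix.fromBlocks_transpose, Matrix.fromBlocks_multiply,
            Matrix.fromBlocks_multiply, Matrix.fromBlocks_add]
          simp [-Matrix.transpose_mul, vecMulVec_mul_skew h₂]
        · simp [Matrix.fromBlocks_multiply]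
      · rw [← hw]
        simp [offDiag, Matrix.fromBlocks_multiply, sub_eq_add_neg, Matrix.fromBlocks_neg,
          Matrix.fromBlocks_add]
  choose N hN hG hφ using hex
  -- The chosen tangent directions are independent, so a left inverse of their linear combination
  -- map supplies the dual functionals.
  obtain ⟨g, hg⟩ := LinearMap.exists_leftInverse_of_injective (Fintype.linearCombination K f)
    (linearIndependent_iff_injective_fintypeLinearCombination.1 hli |> LinearMap.ker_eq_bot.2)
  let T : Matrix (Fin p ⊕ Fin q) (Fin p ⊕ Fin q) K →ₗ[K] Matrix (Fin p) (Fin q) K :=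
    { toFun := Matrix.toBlocks₁₂
      map_add' := fun _ _ => rfl
      map_smul' := fun _ _ => rfl }
  refine le_trans (Nat.cast_le.2 (by omega)) (le_zariskiDim_orbit hN hG
    (offDiag (J' K p) (J' K q) A) (fun a => LinearMap.proj a ∘ₗ g ∘ₗ T) ?_)
  intro a b
  have h6 : T (N b * offDiag (J' K p) (J' K q) A - offDiag (J' K p) (J' K q) A * N b) = f b :=
    hφ b
  have h7 := LinearMap.congr_fun hg (Pi.single b 1)
  rw [LinearMap.comp_apply, Fintype.linearCombination_apply_single, one_smul,
    LinearMap.id_apply] at h7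
  rw [LinearMap.comp_apply, LinearMap.comp_apply, h6, h7, LinearMap.proj_apply, Pi.single_apply]

end ConcreteOrbit

/-! ### A valuative integrality criterion -/

section ValuationBound

theorem isNilpotent_adj_mul_of_isNilpotent_offDiag {R : Type*} [CommRing R] {m n : Type*}
    [Fintype m] [DecidableEq m] [Fintype n] [DecidableEq n] {J₁ : Matrix m m R}
    {J₂ : Matrix n n R} {A : Matrix m n R} (h : IsNilpotent (offDiag J₁ J₂ A)) :
    IsNilpotent (adj J₁ J₂ A * A) := by
  obtain ⟨k, hk⟩ := h
  refine ⟨k, ?_⟩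
  have h1 : (offDiag J₁ J₂ A ^ 2) ^ k = 0 := by
    rw [← pow_mul, mul_comm, pow_mul, hk, zero_pow two_ne_zero]
  rw [pow_two, offDiag_mul_offDiag, Matrix.fromBlocks_diagonal_pow] at h1
  have := congrArg Matrix.toBlocks₂₂ h1
  rwa [Matrix.toBlocks_fromBlocks₂₂] at this

/-- A symmetric element supported on the central diagonal is not nilpotent. -/
theorem eq_zero_of_isNilpotent_offDiag_of_central {k : Type*} [Field k] {p q r : ℕ} (hp : Even p)
    (hr : p = q + 2 * r) (D : Matrix (Fin p) (Fin q) k)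
    (h1 : ∀ i j, i.val ≠ j.val + r → D i j = 0)
    (h2 : ∀ (j : Fin q) (i i' : Fin p), i.val = j.val + r → i'.val = j.rev.val + r →
      D i j = D i' j.rev) (hD : IsNilpotent (offDiag (J' k p) (J' k q) D)) : D = 0 := by
  obtain ⟨N, hN⟩ := isNilpotent_adj_mul_of_isNilpotent_offDiag hD
  let ι : Fin q → Fin p := fun j => ⟨j.val + r, by omega⟩
  -- The adjoint reflects the central diagonal, so by symmetry D*D is diagonal with entries ±
  -- squares; a nilpotent diagonal matrix is zero.
  have hdiag : adj (J' k p) (J' k q) D * D =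
      Matrix.diagonal fun j => -((-1) ^ r * D (ι j) j ^ 2) := by
    ext a b
    rw [Matrix.mul_apply, Finset.sum_eq_single (ι b), adj_J'_apply hp]
    · by_cases hab : a = b
      · subst hab
        rw [Matrix.diagonal_apply_eq, h2 a (ι a) (ι a).rev rfl (by simp [ι, Fin.val_rev]; omega),
          show a.val + (ι a).val = 2 * a.val + r by simp [ι]; ring, pow_add, pow_mul]
        ring
      · rw [Matrix.diagonal_apply_ne _ hab, h1]
        · simp
        · intro h
          apply hab
          simp only [ι, Fin.val_rev] at h
          ext; omega
    · intro i _ hi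
      rw [h1 i b, mul_zero]
      intro h; apply hi; ext; exact h
    · simp
  rw [hdiag, Matrix.diagonal_pow, Matrix.diagonal_eq_zero] at hN
  ext i j
  by_cases hij : i.val = j.val + r
  · have h3 := congrFun hN j
    have h4 : i = ι j := Fin.ext hij
    rw [Pi.pow_apply, Pi.zero_apply] at h3
    have h5 := eq_zero_of_pow_eq_zero h3
    rw [neg_eq_zero, mul_eq_zero, or_iff_right (pow_ne_zero _ (neg_ne_zero.2 one_ne_zero))] at h5
    rw [h4, Matrix.zero_apply]
    exact eq_zero_of_pow_eq_zero h5
  · exact h1 i j hij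

/-- A monic relation homogenised with u reduces to X^N = 0 where u becomes zero. -/
theorem isNilpotent_map_of_sum_eq_zero {R k : Type*} [CommRing R] [CommRing k] {n : Type*}
    [Fintype n] [DecidableEq n] (ρ : R →+* k) (X : Matrix n n R) (c : ℕ → R) (u : R) (N : ℕ)
    (hu : ρ u = 0) (hc : c N = 1)
    (h : ∑ i ∈ Finset.range (N + 1), (c i * u ^ (N - i)) • X ^ i = 0) :
    IsNilpotent (X.map ρ) := by
  refine ⟨N, ?_⟩
  have h1 := congrArg ρ.mapMatrix h
  rw [map_sum, map_zero, Finset.sum_range_succ, Finset.sum_eq_zero, zero_add, hc, Nat.sub_self,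
    pow_zero, mul_one, one_smul, map_pow] at h1
  · exact h1
  · intro i hi
    ext a b
    rw [RingHom.mapMatrix_apply, Matrix.map_apply, Matrix.smul_apply, smul_eq_mul, map_mul, map_mul,
      map_pow, hu, zero_pow]
    · simp
    · have := Finset.mem_range.1 hi; omega

/-- Otherwise divide A by an entry of largest valuation and reduce to the residue field. The
integral coordinates disappear, leaving a symmetric block supported on the central diagonal,
nilpotent by the monic equation, yet with an entry equal to 1. -/
theorem mem_valuationSubring_of_aeval_offDiag {L : Type*} [Field L] (V : ValuationSubring L)
    {p q r : ℕ} (hp : Even p) (hr : p = q + 2 * r) (A : Matrix (Fin p) (Fin q) L)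
    (c : Polynomial V) (hc : c.Monic)
    (hA : Polynomial.aeval (offDiag (J' L p) (J' L q) A) (c.map V.subtype) = 0)
    (h1 : ∀ i j, i.val ≠ j.val + r → A i j ∈ V)
    (h2 : ∀ (j : Fin q) (i i' : Fin p), i.val = j.val + r → i'.val = j.rev.val + r →
      A i j - A i' j.rev ∈ V) (i : Fin p) (j : Fin q) : A i j ∈ V := by
  by_contra hij
  have : Nonempty (Fin p × Fin q) := ⟨(i, j)⟩
  obtain ⟨⟨i₀, j₀⟩, hmax⟩ := Finite.exists_max
    (fun ij : Fin p × Fin q => V.valuation (A ij.1 ij.2))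
  have hy : 1 < V.valuation (A i₀ j₀) := by
    rw [← V.valuation_le_one_iff, not_le] at hij
    exact hij.trans_le (hmax (i, j))
  have hy0 : A i₀ j₀ ≠ 0 := by
    intro h; rw [h, map_zero] at hy; exact not_lt_zero hy
  set u := (A i₀ j₀)⁻¹ with hu
  have huv : V.valuation u < 1 := by
    rw [hu, map_inv₀]; exact inv_lt_one_of_one_lt₀ hy
  have huV : u ∈ V := (V.valuation_le_one_iff u).1 huv.le
  have hB : ∀ i j, u * A i j ∈ V := by
    intro i j
    rw [← V.valuation_le_one_iff, map_mul, hu, map_inv₀]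
    rw [inv_mul_le_one₀ (zero_lt_one.trans hy)]
    exact hmax (i, j)
  let B : Matrix (Fin p) (Fin q) V := Matrix.of fun i j => ⟨u * A i j, hB i j⟩
  let u' : V := ⟨u, huV⟩
  let ρ := IsLocalRing.residue V
  have hρ : ρ u' = 0 := by
    rw [IsLocalRing.residue_eq_zero_iff]
    exact (V.valuation_lt_one_iff u').2 huv
  have hBA : B.map V.subtype = u • A := rfl
  have hnil : IsNilpotent ((offDiag (J' V p) (J' V q) B).map ρ) := by
    refine isNilpotent_map_of_sum_eq_zero ρ _ c.coeff u' c.natDegree hρ hc ?_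
    have hinj : Function.Injective (V.subtype.mapMatrix : Matrix (Fin p ⊕ Fin q) (Fin p ⊕ Fin q) V
        →+* Matrix (Fin p ⊕ Fin q) (Fin p ⊕ Fin q) L) :=
      Matrix.map_injective Subtype.val_injective
    apply hinj
    have hX : V.subtype.mapMatrix (offDiag (J' V p) (J' V q) B) =
        u • offDiag (J' L p) (J' L q) A := by
      rw [RingHom.mapMatrix_apply, ← offDiag_map, J'_map, J'_map, hBA]
      exact map_smul (offDiagL (J' L p) (J' L q)) u A
    rw [map_sum, map_zero]
    rw [Polynomial.aeval_eq_sum_range, hc.natDegree_map] at hA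
    have hA' := congrArg (u ^ c.natDegree • ·) hA
    simp only [smul_zero, Finset.smul_sum] at hA'
    rw [← hA']
    refine Finset.sum_congr rfl fun i hi => ?_
    have hs : ∀ (a : V) (M : Matrix (Fin p ⊕ Fin q) (Fin p ⊕ Fin q) V),
        V.subtype.mapMatrix (a • M) = (a : L) • V.subtype.mapMatrix M := by
      intro a M; ext x y; simp
    rw [hs, map_pow, hX, smul_pow, smul_smul, smul_smul, Polynomial.coeff_map]
    congr 1
    have h3 : u ^ c.natDegree = u ^ (c.natDegree - i) * u ^ i := by
      rw [← pow_add]; congr 1; have := Finset.mem_range.1 hi; omega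
    rw [h3]
    change ((c.coeff i : L) * u ^ (c.natDegree - i)) * u ^ i = _ * (c.coeff i : L)
    ring
  rw [← offDiag_map, J'_map, J'_map] at hnil
  have hz := eq_zero_of_isNilpotent_offDiag_of_central hp hr (B.map ρ) ?_ ?_ hnil
  · have h3 := congrFun (congrFun hz i₀) j₀
    have h4 : B i₀ j₀ = 1 := Subtype.ext (inv_mul_cancel₀ hy0)
    rw [Matrix.map_apply, h4, map_one] at h3
    exact one_ne_zero h3
  · intro i j hij
    have : B i j = u' * ⟨A i j, h1 i j hij⟩ := rfl
    rw [Matrix.map_apply, this, map_mul, hρ, zero_mul]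
  · intro j i i' hi hi'
    have : B i j = B i' j.rev + u' * ⟨_, h2 j i i' hi hi'⟩ := by
      apply Subtype.ext
      change u * A i j = u * A i' j.rev + u * (A i j - A i' j.rev)
      ring
    rw [Matrix.map_apply, this, map_add, map_mul, hρ, zero_mul, add_zero]
    rfl

/-- The integral closure in a field is the intersection of the valuation rings containing the base;
the rest passes from the image of B back to B. -/
theorem isIntegral_of_forall_valuationSubring {B L : Type*} [CommRing B] [Field L] [Algebra B L]
    (x : L) (h : ∀ V : ValuationSubring L, (∀ b : B, algebraMap B L b ∈ V) → x ∈ V) :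
    IsIntegral B x := by
  have h1 : x ∈ (⨅ V : {V : ValuationSubring L // ((algebraMap B L).range : Set L) ⊆ V.toSubring},
      V.1.toSubring) := by
    rw [Subring.mem_iInf]
    exact fun V => h V.1 fun b => V.2 ⟨b, rfl⟩
  rw [iInf_valuationSubring_superset, Subring.closure_eq] at h1
  obtain ⟨f, hf, hx⟩ := (h1 : IsIntegral (algebraMap B L).range x)
  obtain ⟨g, hg, -, hgm⟩ := Polynomial.lifts_and_natDegree_eq_and_monic
    (f := (algebraMap B L).rangeRestrict) (p := f)
    ((Polynomial.mem_lifts _).2 (Polynomial.map_surjective _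
      (algebraMap B L).rangeRestrict_surjective f)) hf
  refine ⟨g, hgm, ?_⟩
  rw [← hg, Polynomial.eval₂_map] at hx
  exact hx

end ValuationBound

/-! ### Bounds for the transcendence degree -/

section TrdegBound

variable {K : Type*} [Field K]

/-- The transcendence degree of an algebra is bounded by those of its prime quotients. -/
theorem trdeg_le_of_forall_prime {R : Type*} [CommRing R] [Algebra K R] (d : Cardinal)
    (h : ∀ P : Ideal R, P.IsPrime → Algebra.trdeg K (R ⧸ P) ≤ d) : Algebra.trdeg K R ≤ d := by
  refine ciSup_le' fun s => ?_
  have hs : AlgebraicIndependent K ((↑) : s.1 → R) := s.2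
  -- A prime avoiding all values of nonzero polynomials at s keeps s independent in the quotient.
  -- Hence the vanishing ideal of an orbit need not be shown prime.
  let M : Submonoid R := (nonZeroDivisors (MvPolynomial s.1 K)).map
    (MvPolynomial.aeval ((↑) : s.1 → R)).toMonoidHom
  have hM : Disjoint ((⊥ : Ideal R) : Set R) M := by
    rw [Set.disjoint_left]
    rintro _ h0 ⟨f, hf, rfl⟩
    have h1 : f = 0 := (algebraicIndependent_iff.1 hs) f h0
    exact nonZeroDivisors.ne_zero hf h1
  obtain ⟨P, hP, -, hPM⟩ := Ideal.exists_le_prime_disjoint ⊥ M hM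
  have hs' : AlgebraicIndependent K fun x : s.1 => Ideal.Quotient.mkₐ K P (x : R) := by
    rw [algebraicIndependent_iff]
    intro f hf
    by_contra hf0
    have hP' : MvPolynomial.aeval ((↑) : s.1 → R) f ∈ P := by
      rw [← Ideal.Quotient.eq_zero_iff_mem, ← hf]
      exact MvPolynomial.comp_aeval_apply _ (Ideal.Quotient.mkₐ K P) f
    exact Set.disjoint_left.1 hPM hP' ⟨f, mem_nonZeroDivisors_of_ne_zero hf0, rfl⟩
  exact hs'.cardinalMk_le_trdeg.trans (h P hP)

/-- A domain generated by elements that are integral over the subalgebra generated by `s` has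
transcendence degree at most the cardinality of `s`. -/
theorem trdeg_le_of_isIntegral {A σ : Type*} [CommRing A] [IsDomain A] [Algebra K A] (x : σ → A)
    (hx : Algebra.adjoin K (Set.range x) = ⊤) (s : Set A)
    (h : ∀ i, IsIntegral (Algebra.adjoin K s) (x i)) : Algebra.trdeg K A ≤ Cardinal.mk s := by
  have : Algebra.IsIntegral (Algebra.adjoin K s) A := by
    refine ⟨fun a => ?_⟩
    have ha : a ∈ Algebra.adjoin K (Set.range x) := hx ▸ Algebra.mem_top
    have hle : Algebra.adjoin K (Set.range x) ≤
        (integralClosure (Algebra.adjoin K s) A).restrictScalars K := by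
      rw [Algebra.adjoin_le_iff]
      rintro _ ⟨i, rfl⟩
      exact h i
    exact hle ha
  have : Algebra.IsAlgebraic (Algebra.adjoin K s) A := Algebra.IsIntegral.isAlgebraic
  exact Algebra.IsAlgebraic.trdeg_le_cardinalMk K s

end TrdegBound

/-! ### Equations satisfied on an orbit -/

section OrbitRelations

variable {K : Type*} [Field K] [CharZero K] {p q : ℕ}

theorem conj_mem_gMinus (hp : Even p) (hq : Even q)
    {Y : Matrix (Fin p ⊕ Fin q) (Fin p ⊕ Fin q) K} (hY : Y ∈ gMinus K p q)
    {g : GL (Fin p ⊕ Fin q) K} (hg : g ∈ G1 K p q) :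
    (g : Matrix (Fin p ⊕ Fin q) (Fin p ⊕ Fin q) K) * Y * (g⁻¹ : GL (Fin p ⊕ Fin q) K)
      ∈ gMinus K p q := by
  have hJJ : J'pq K p q * J'pq K p q = -1 := by
    rw [J'pq, Matrix.fromBlocks_multiply]
    simp [(isSympl_J' (R := K) hp).mul_self, (isSympl_J' (R := K) hq).mul_self,
      ← Matrix.fromBlocks_one, Matrix.fromBlocks_neg]
  have hI : ∀ k ∈ G1 K p q, Matrix.fromBlocks 1 0 0 (-1) * (k : Matrix (Fin p ⊕ Fin q) (Fin p ⊕ Fin q) K) =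
      (k : Matrix (Fin p ⊕ Fin q) (Fin p ⊕ Fin q) K) * Matrix.fromBlocks 1 0 0 (-1) := by
    intro k hk
    have h1 : Ipq K p q * k * (Ipq K p q)⁻¹ = k := hk.2
    rw [mul_inv_eq_iff_eq_mul] at h1
    exact congrArg Units.val h1
  have hS : ∀ k ∈ G1 K p q, (k : Matrix (Fin p ⊕ Fin q) (Fin p ⊕ Fin q) K) * J'pq K p q * (k : Matrix (Fin p ⊕ Fin q) (Fin p ⊕ Fin q) K)ᵀ = J'pq K p q :=
    fun k hk => hk.1
  have hJ : ∀ k ∈ G1 K p q, (k : Matrix (Fin p ⊕ Fin q) (Fin p ⊕ Fin q) K)ᵀ * J'pq K p q =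
      J'pq K p q * (k⁻¹ : GL (Fin p ⊕ Fin q) K) := by
    intro k hk
    have h1 : J'pq K p q * (k : Matrix (Fin p ⊕ Fin q) (Fin p ⊕ Fin q) K)ᵀ = (k⁻¹ : GL (Fin p ⊕ Fin q) K) * J'pq K p q := by
      rw [← hS k hk, ← Matrix.mul_assoc, ← Matrix.mul_assoc, Units.inv_mul, Matrix.one_mul, hS k hk]
    have h2 := congrArg (fun M => J'pq K p q * M * J'pq K p q) h1
    rw [← Matrix.mul_assoc, hJJ, ← Matrix.mul_assoc, Matrix.mul_assoc _ (J'pq K p q), hJJ] at h2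
    simpa using h2
  rw [mem_gMinus_iff_blocks] at hY ⊢
  have hg' := inv_mem hg
  constructor
  · rw [Matrix.transpose_mul, Matrix.transpose_mul, Matrix.mul_assoc, Matrix.mul_assoc, hJ g hg,
      ← Matrix.mul_assoc Yᵀ, hY.1, ← Matrix.mul_assoc, Matrix.mul_neg, ← Matrix.mul_assoc,
      hJ _ hg', inv_inv]
    simp [Matrix.mul_assoc]
  · rw [← Matrix.mul_assoc, ← Matrix.mul_assoc, hI g hg, Matrix.mul_assoc _ _ (Matrix.fromBlocks _ _ _ _),
      ← hI _ hg']
    have h3 := congrArg (fun M => (g : Matrix (Fin p ⊕ Fin q) (Fin p ⊕ Fin q) K) * M *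
      (g⁻¹ : GL (Fin p ⊕ Fin q) K)) hY.2
    simp only [Matrix.mul_assoc, Matrix.mul_neg, Matrix.neg_mul] at h3 ⊢
    exact h3

/-- The matrix of coordinate functions. -/
noncomputable def genericMatrix (K : Type*) [Field K] (p q : ℕ) : Matrix (Fin p ⊕ Fin q) (Fin p ⊕ Fin q)
    (MvPolynomial ((Fin p ⊕ Fin q) × (Fin p ⊕ Fin q)) K) :=
  Matrix.of fun i j => MvPolynomial.X (i, j)

/-- Conjugation by G(1) preserves 𝔤(-1) and the characteristic polynomial. Both conditions are
polynomial identities on the orbit, hence survive any homomorphism killing its vanishing ideal. -/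
theorem genericMatrix_relations (hp : Even p) (hq : Even q)
    {Y : Matrix (Fin p ⊕ Fin q) (Fin p ⊕ Fin q) K} (hY : Y ∈ gMinus K p q) {L : Type*} [Field L]
    [Algebra K L] (f : MvPolynomial ((Fin p ⊕ Fin q) × (Fin p ⊕ Fin q)) K →ₐ[K] L)
    (hf : ∀ P ∈ MvPolynomial.vanishingIdeal K (orbit Y), f P = 0) :
    offDiag (J' L p) (J' L q) ((genericMatrix K p q).map f).toBlocks₁₂ =
        (genericMatrix K p q).map f ∧
      Polynomial.aeval ((genericMatrix K p q).map f) Y.charpoly = 0 := by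
  set G := genericMatrix K p q with hG
  have hpt : ∀ v ∈ orbit Y, G.map (MvPolynomial.aeval v) ∈ gMinus K p q ∧
      Polynomial.aeval (G.map (MvPolynomial.aeval v)) Y.charpoly = 0 := by
    rintro v ⟨g, hg, hv⟩
    have h1 : G.map (MvPolynomial.aeval v) =
        (g : Matrix (Fin p ⊕ Fin q) (Fin p ⊕ Fin q) K) * Y * (g⁻¹ : GL (Fin p ⊕ Fin q) K) := by
      ext i j
      rw [← hv (i, j)]
      simp [G, genericMatrix]
    rw [h1]
    refine ⟨conj_mem_gMinus hp hq hY hg, ?_⟩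
    have h2 : ((g : Matrix (Fin p ⊕ Fin q) (Fin p ⊕ Fin q) K) * Y *
        (g⁻¹ : GL (Fin p ⊕ Fin q) K)).charpoly = Y.charpoly := by
      rw [Matrix.coe_units_inv]; exact Matrix.charpoly_units_conj g Y
    rw [← h2]
    exact Matrix.aeval_self_charpoly _
  have hz : ∀ M : Matrix (Fin p ⊕ Fin q) (Fin p ⊕ Fin q)
      (MvPolynomial ((Fin p ⊕ Fin q) × (Fin p ⊕ Fin q)) K),
      (∀ v ∈ orbit Y, M.map (MvPolynomial.aeval v) = 0) → M.map f = 0 := by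
    intro M hM
    ext i j
    refine hf _ (MvPolynomial.mem_vanishingIdeal_iff.2 fun v hv => ?_)
    exact congrFun (congrFun (hM v hv) i) j
  constructor
  · have h2 := hz (offDiag (J' _ p) (J' _ q) G.toBlocks₁₂ - G) ?_
    · rw [Matrix.map_sub _ (map_sub f), sub_eq_zero] at h2
      rw [← h2]
      have := offDiag_map (f : _ →+* L) (J' _ p) (J' _ q) G.toBlocks₁₂
      rw [J'_map, J'_map] at this
      exact this
    · intro v hv
      obtain ⟨A, hA⟩ := (mem_gMinus_iff hp hq).1 (hpt v hv).1
      have := offDiag_map (MvPolynomial.aeval v : _ →ₐ[K] K).toRingHom (J' _ p) (J' _ q)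
        G.toBlocks₁₂
      rw [J'_map, J'_map] at this
      rw [Matrix.map_sub _ (map_sub _), sub_eq_zero]
      refine this.symm.trans ?_
      have h3 : G.toBlocks₁₂.map (MvPolynomial.aeval v : _ →ₐ[K] K).toRingHom = A := by
        change (G.map (MvPolynomial.aeval v)).toBlocks₁₂ = A
        rw [← hA]
        exact Matrix.toBlocks_fromBlocks₁₂ _ _ _ _
      rw [h3, hA]
  · have h2 := hz (Polynomial.aeval G Y.charpoly) ?_
    · rw [← h2]
      exact Polynomial.aeval_algHom_apply f.mapMatrix G Y.charpoly
    · intro v hv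
      rw [← (hpt v hv).2]
      exact (Polynomial.aeval_algHom_apply (MvPolynomial.aeval v : _ →ₐ[K] K).mapMatrix G
        Y.charpoly).symm

end OrbitRelations

/-! ### Upper bound for all orbit dimensions -/

section UpperBound

variable {K : Type*} [Field K] [CharZero K] {p q r : ℕ}

/-- The places of the upper right block carrying the coordinates over which the other coordinates
are integral: all but the first half of the central diagonal. -/
def noetherIndices (p q r : ℕ) : Finset (Fin p × Fin q) :=
  Finset.univ.filter fun ij => ¬(ij.1.val = ij.2.val + r ∧ ij.2.val < q / 2)

theorem card_noetherIndices (hr : p = q + 2 * r) :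
    (noetherIndices p q r).card = p * q - q / 2 := by
  let g : Fin (q / 2) → Fin p × Fin q := fun j => (⟨j.val + r, by omega⟩, ⟨j.val, by omega⟩)
  have hg : Function.Injective g := fun a b h => Fin.ext (Fin.mk.inj (Prod.mk.inj h).2)
  have h1 : noetherIndices p q r = Finset.univ \ Finset.univ.image g := by
    ext ⟨i, j⟩
    simp only [noetherIndices, Finset.mem_filter, Finset.mem_univ, true_and, Finset.mem_sdiff,
      Finset.mem_image, not_iff_not]
    constructor
    · rintro ⟨h1, h2⟩
      exact ⟨⟨j.val, h2⟩, Prod.ext (Fin.ext h1.symm) rfl⟩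
    · rintro ⟨a, ha⟩
      obtain ⟨h1, h2⟩ := Prod.mk.inj ha
      rw [← h1, ← h2]
      exact ⟨rfl, a.isLt⟩
  rw [h1, Finset.card_sdiff_of_subset (Finset.subset_univ _), Finset.card_image_of_injective _ hg]
  simp

/-- No orbit of `G(1)` in `𝔤(-1)` has dimension more than `p q - q / 2`. -/
theorem zariskiDim_orbit_le (hp : Even p) (hq : Even q) (hr : p = q + 2 * r)
    {Y : Matrix (Fin p ⊕ Fin q) (Fin p ⊕ Fin q) K} (hY : Y ∈ gMinus K p q) :
    zariskiDim K (orbit Y) ≤ ((p * q - q / 2 : ℕ) : Cardinal) := by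
  classical
  let I := MvPolynomial.vanishingIdeal K (orbit Y)
  change Algebra.trdeg K (MvPolynomial ((Fin p ⊕ Fin q) × (Fin p ⊕ Fin q)) K ⧸ I) ≤ _
  refine trdeg_le_of_forall_prime _ fun P hP => ?_
  let A := (MvPolynomial ((Fin p ⊕ Fin q) × (Fin p ⊕ Fin q)) K ⧸ I) ⧸ P
  have : IsDomain A := Ideal.Quotient.isDomain P
  let fA : MvPolynomial ((Fin p ⊕ Fin q) × (Fin p ⊕ Fin q)) K →ₐ[K] A :=
    (Ideal.Quotient.mkₐ K P).comp (Ideal.Quotient.mkₐ K I)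
  have hfA : Function.Surjective fA :=
    (Ideal.Quotient.mkₐ_surjective K P).comp (Ideal.Quotient.mkₐ_surjective K I)
  have hfA0 : ∀ g ∈ I, fA g = 0 := by
    intro g hg
    change Ideal.Quotient.mk P (Ideal.Quotient.mk I g) = 0
    rw [Ideal.Quotient.eq_zero_iff_mem.2 hg, map_zero]
  let x := fun ij => fA (MvPolynomial.X ij)
  have hx : Algebra.adjoin K (Set.range x) = ⊤ := by
    have h1 : Set.range x = fA '' Set.range MvPolynomial.X := by
      rw [← Set.range_comp]; rfl
    rw [h1, ← AlgHom.map_adjoin, MvPolynomial.adjoin_range_X, Algebra.map_top,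
      AlgHom.range_eq_top]
    exact hfA
  -- On the central diagonal only the difference of an entry and its mirror image is used; mirror
  -- differences are negatives of each other, so half of them suffice.
  let l : Fin p × Fin q → A := fun ij =>
    if ij.1.val = ij.2.val + r then
      x (Sum.inl ij.1, Sum.inr ij.2) - x (Sum.inl ⟨ij.2.rev.val + r, by omega⟩, Sum.inr ij.2.rev)
    else x (Sum.inl ij.1, Sum.inr ij.2)
  let s : Finset A := (noetherIndices p q r).image l
  refine (trdeg_le_of_isIntegral x hx (s : Set A) ?_).trans ?_
  swap
  · have h1 : Cardinal.mk (s : Set A) = (s.card : Cardinal) := Cardinal.mk_coe_finset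
    rw [h1, ← card_noetherIndices hr]
    exact Nat.cast_le.2 Finset.card_image_le
  let L := FractionRing A
  let f : MvPolynomial ((Fin p ⊕ Fin q) × (Fin p ⊕ Fin q)) K →ₐ[K] L :=
    (IsScalarTower.toAlgHom K A L).comp fA
  obtain ⟨hX, hc⟩ := genericMatrix_relations hp hq hY f fun g hg => by
    change algebraMap A L (fA g) = 0
    rw [hfA0 g hg, map_zero]
  set 𝔸 := ((genericMatrix K p q).map f).toBlocks₁₂ with h𝔸
  have h𝔸x : ∀ i j, 𝔸 i j = algebraMap A L (x (Sum.inl i, Sum.inr j)) := fun i j => rfl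
  intro ij
  rw [← isIntegral_algebraMap_iff (B := L) (IsFractionRing.injective A L)]
  refine isIntegral_of_forall_valuationSubring _ fun V hV => ?_
  have hKV : ∀ c : K, algebraMap K L c ∈ V := fun c =>
    hV (algebraMap K (Algebra.adjoin K (s : Set A)) c)
  have hlV : ∀ t ∈ noetherIndices p q r, algebraMap A L (l t) ∈ V := fun t ht =>
    hV ⟨l t, Algebra.subset_adjoin (Finset.mem_coe.2 (Finset.mem_image_of_mem l ht))⟩
  let kV : K →+* V := (algebraMap K L).codRestrict V.toSubring hKV
  have hmem : ∀ i j, 𝔸 i j ∈ V := by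
    refine mem_valuationSubring_of_aeval_offDiag V hp hr 𝔸 (Y.charpoly.map kV)
      ((Matrix.charpoly_monic Y).map kV) ?_ ?_ ?_
    · rw [Polynomial.map_map, hX]
      exact (Polynomial.aeval_map_algebraMap L _ _).trans hc
    · intro i j hij
      have h1 := hlV (i, j) (Finset.mem_filter.2 ⟨Finset.mem_univ _, fun h => hij h.1⟩)
      simp only [l] at h1
      rw [if_neg hij] at h1
      exact h1
    · intro j i i' hi hi'
      have hl : ∀ (j : Fin q) (i i' : Fin p), i.val = j.val + r → i'.val = j.rev.val + r →
          ¬ j.val < q / 2 → 𝔸 i j - 𝔸 i' j.rev ∈ V := by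
        intro j i i' hi hi' hj
        have h1 := hlV (i, j) (Finset.mem_filter.2 ⟨Finset.mem_univ _, fun h => hj h.2⟩)
        simp only [l] at h1
        rw [if_pos hi, map_sub] at h1
        have h2 : i' = ⟨j.rev.val + r, by omega⟩ := Fin.ext hi'
        rw [h2]
        exact h1
      -- As q is even, the mirror image of a place in the first half lies in the second half, whose
      -- difference is among the chosen forms.
      by_cases hj : j.val < q / 2
      · have h1 := hl j.rev i' i hi' (by rw [Fin.rev_rev]; exact hi)
          (by rw [Fin.val_rev]; obtain ⟨k, hk⟩ := hq; omega)
        rw [Fin.rev_rev] at h1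
        rw [← neg_sub]
        exact neg_mem h1
      · exact hl j i i' hi hi' hj
  have hent : algebraMap A L (x ij) = offDiag (J' L p) (J' L q) 𝔸 ij.1 ij.2 := by
    rw [hX]; rfl
  rw [hent]
  obtain ⟨i | i, j | j⟩ := ij
  · exact zero_mem V
  · exact hmem i j
  · change adj (J' L p) (J' L q) 𝔸 i j ∈ V
    rw [adj_J'_apply hp]
    exact neg_mem (mul_mem (pow_mem (neg_mem (one_mem V)) _) (hmem _ _))
  · exact zero_mem V

end UpperBound

/-! ### Relative regularity of e and the main theorem -/

theorem eBlock_map {R S : Type*} [CommRing R] [CommRing S] (g : R →+* S) (p q r : ℕ) :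
    (eBlock R p q r).map g = eBlock S p q r := by
  ext i j
  simp only [eBlock, Matrix.map_apply, Matrix.of_apply]
  split_ifs <;> simp

/-- The centralizer of e has dimension q/2, so the lower bound for its orbit equals the upper bound
pq - q/2 valid for every orbit. -/
theorem isRelativelyRegular_e {K : Type*} [Field K] [CharZero K] {p q r : ℕ} (hp : Even p)
    (hq : Even q) (hr : p = q + 2 * r) :
    IsRelativelyRegular (offDiag (J' K p) (J' K q) (eBlock K p q r)) := by
  refine ⟨(mem_gMinus_iff hp hq).2 ⟨_, rfl⟩, fun Y hY => ?_⟩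
  refine (zariskiDim_orbit_le hp hq hr hY).trans ?_
  rw [← finrank_blockCentralizer_eBlock (K := K) hp hq hr]
  exact le_zariskiDim_orbit_offDiag hp hq _

end SympSym

theorem mainTheorem6 {F : Type*} [Field F] [CharZero F]
    {Fbar : Type*} [Field Fbar] [Algebra F Fbar] [IsAlgClosure F Fbar]
    (p q : ℕ) (hq0 : 0 < q) (hqp : q ≤ p) (hp : Even p) (hq : Even q) :
    SympSym.e F p q ∈ SympSym.gMinus F p q ∧
    IsNilpotent (SympSym.e F p q) ∧
    Module.finrank F (SympSym.gMinusCentralizer (SympSym.e F p q)) = q / 2 ∧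
    SympSym.ThetaHasRank F p q (q / 2) ∧
    SympSym.IsRelativelyRegular ((SympSym.e F p q).map (algebraMap F Fbar)) := by
  have hr : p = q + 2 * ((p - q) / 2) := by
    obtain ⟨a, ha⟩ := hp
    obtain ⟨b, hb⟩ := hq
    omega
  have : CharZero Fbar := charZero_of_injective_algebraMap (algebraMap F Fbar).injective
  rw [SympSym.e_eq_offDiag hp hr]
  refine ⟨(SympSym.mem_gMinus_iff hp hq).2 ⟨_, rfl⟩,
    SympSym.isNilpotent_offDiag (SympSym.isNilpotent_adj_eBlock_mul_eBlock hp hr), ?_,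
    SympSym.thetaHasRank hqp hp hq, ?_⟩
  · rw [SympSym.finrank_gMinusCentralizer_offDiag hp hq,
      SympSym.finrank_blockCentralizer_eBlock hp hq hr]
  · rw [← SympSym.offDiag_map, SympSym.J'_map, SympSym.J'_map, SympSym.eBlock_map]
    exact SympSym.isRelativelyRegular_e hp hq hr
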